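/- Let $k$ be an algebraically closed field of characteristic $0$. Fix primitive $n$-th roots of unity $\zeta_n\in k$ ($n\ge 1$) with $\zeta_{mn}^{m}=\zeta_n$ for all $m,n\ge 1$, and write $\zeta^{a/b}=\zeta_b^{a}$ for $a\in\mathbb Z$, $b\in\mathbb Z_{>0}$. **Multiloop Lie algebras.** Let $n\ge 1$, let $\mathfrak g$ be a finite dimensional simple Lie algebra over $k$, let $\sigma=(\sigma_1,\dots,\sigma_n)$ be pairwise commuting automorphisms of $\mathfrak g$ and let $m\in\mathbb Z_{>0}^n$ with $\sigma_i^{m_i}=\mathrm{id}$ for all $i$. Let $\mathfrak h$ be a Cartan subalgebra of the fixed subalgebra $\mathfrak g^\sigma$ (so $\mathfrak h=0$ if $\mathfrak g^\sigma=0$). For $\alpha\in\mathfrak h^*$ put $\mathfrak g_\alpha=\{x\in\mathfrak g: [h,x]=\alpha(h)x \ \forall h\in\mathfrak h\}$, let $Q_{\mathfrak h}\subseteq\mathfrak h^*$ be the subgroup generated by the nonzero $\alpha$ with $\mathfrak g_\alpha\ne0$, and for $\lambda\in\mathbb Z^n$ put $\mathfrak g_\alpha^{\bar\lambda}=\{x\in\mathfrak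 g_\alpha:\sigma_i(x)=\zeta_{m_i}^{\lambda_i}x\ \forall i\}$. The multiloop Lie algebra of nullity $n$ is the $Q_{\mathfrak h}\times\mathbb Z^n$-graded Lie algebra $$L_m(\mathfrak g,\sigma,\mathfrak h)=\bigoplus_{(\alpha,\lambda)\in Q_{\mathfrak h}\times\mathbb Z^n}\mathfrak g_\alpha^{\bar\lambda}\otimes t^\lambda\ \subseteq\ \mathfrak g\otimes k[t_1^{\pm1},\dots,t_n^{\pm1}].$$ **Graded notions.** For a $\Lambda$-graded Lie algebra $B=\bigoplus_{\lambda\in\Lambda} B^\lambda$ let $\langle\mathrm{supp}_\Lambda B\rangle$ be the subgroup of $\Lambda$ generated by the $\lambda$ with $B^\lambda\neq0$. A $\Lambda$-graded $B$ and a $\Lambda'$-graded $B'$ are *isograded-isomorphic* if there are a Lie algebra isomorphism $\varphi:B\to B'$ and a group isomorphism $f:\Lambda\to\Lambda'$ with $\varphi(B^\lambda)=B'^{f(\lambda)}$ for all $\lambda$; they are *support-isomorphic* if this holds with $\Lambda,\Lambda'$ replaced by $\langle\mathrm{supp}_\Lambda B\rangle,\langle\mathrm{supp}_{\Lambda'}B'\rangle$.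 A $Q\times\mathbb Z^n$-graded Lie algebra is also $\mathbb Z^n$-graded by $B^\lambda=\bigoplus_{\alpha\in Q}B^\lambda_\alpha$; *$\mathbb Z^n$-isograded-isomorphic* means isograded-isomorphic for these $\mathbb Z^n$-gradings. For a $Q\times\mathbb Z^n$-graded $B$ and an injective homomorphism $\rho:\langle\mathrm{supp}_{\mathbb Z^n}B\rangle\to\mathbb Z^n$, $B_{(\rho)}$ is the Lie algebra $B$ with $(B_{(\rho)})_\alpha^\lambda=B_\alpha^{\rho^{-1}(\lambda)}$ if $\lambda\in\operatorname{Im}\rho$ and $0$ otherwise. For $s\in\mathrm{Hom}(Q,\mathbb Z^n)$, $B^{(s)}$ is the Lie algebra $B$ with $(B^{(s)})_\alpha^\lambda=B_\alpha^{\lambda+s(\alpha)}$. **Theorem.** Let $L=L_m(\mathfrak g,\sigma,\mathfrak h)$ and $L'=L_{m'}(\mathfrak g',\sigma',\mathfrak h')$ be multiloop Lie algebras of nullity $n$. The following are equivalent. (a) $L$ and $L'$ are support-isomorphic (as $Q_{\mathfrak h}\times\mathbb Z^n$- and $Q_{\mathfrak h'}\times\mathbb Z^n$-graded Lie algebras).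 (b) There are $s=(s_1,\dots,s_n)\in\mathrm{Hom}(Q_{\mathfrak h},\mathbb Q^n)$, $P=(p_{ij})\in\mathrm{GL}_n(\mathbb Z)$ and a Lie algebra isomorphism $\varphi:\mathfrak g\to\mathfrak g'$ such that, if $\tau_i\in\mathrm{Aut}(\mathfrak g)$ is the automorphism with $\tau_i(x)=\zeta^{-s_i(\alpha)}x$ for $\alpha\in Q_{\mathfrak h}$, $x\in\mathfrak g_\alpha$, then $\sigma'_j=\varphi\,\bigl(\prod_{i=1}^n(\tau_i\sigma_i)^{p_{ij}}\bigr)\varphi^{-1}$ for $1\le j\le n$. (c) There is a finite sequence $L_0,\dots,L_p$ ($p\ge0$) of $Q_{\mathfrak h}\times\mathbb Z^n$-graded Lie algebras such that $L_0=L$; $L_p$ is $\mathbb Z^n$-isograded-isomorphic to $L'$; and for $0\le i\le p-1$, $L_{i+1}$ is either $(L_i)_{(\rho_i)}$ for some injective homomorphism $\rho_i:\langle\mathrm{supp}_{\mathbb Z^n}L_i\rangle\to\mathbb Z^n$ or $(L_i)^{(s_i)}$ for some $s_i\in\mathrm{Hom}(Q_{\mathfrak h},\mathbb Z^n)$. 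-/

import Mathlib

open scoped TensorProduct

noncomputable section

namespace MultiloopLie

/-! ### Automorphisms of a Lie algebra -/

section Automorphisms

variable {k : Type*} [CommRing k] {L : Type*} [LieRing L] [LieAlgebra k L]

/-- The automorphism group of a Lie algebra; `f * g` is the composite `x ↦ f (g x)`. -/
instance : Group (L ≃ₗ⁅k⁆ L) where
  mul f g := g.trans f
  one := 1
  inv f := f.symm
  mul_assoc _ _ _ := rfl
  one_mul _ := rfl
  mul_one _ := rfl
  inv_mul_cancel f := LieEquiv.ext (fun x => f.symm_apply_apply x)

theorem aut_mul_apply (f g : L ≃ₗ⁅k⁆ L) (x : L) : (f * g) x = f (g x) := rfl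

/-- `φ σ φ⁻¹`, the automorphism of `L'` obtained by transporting `σ` along `φ : L ≃ L'`. -/
def conj {L' : Type*} [LieRing L'] [LieAlgebra k L'] (φ : L ≃ₗ⁅k⁆ L') (σ : L ≃ₗ⁅k⁆ L) :
    L' ≃ₗ⁅k⁆ L' :=
  (φ.symm.trans σ).trans φ

/-- For `P = (p i j)`, the tuple `σ ^ P` whose `j`-th entry is the product of the
`σ i ^ p i j`, taken in increasing order of `i` (the order is irrelevant for commuting tuples). -/
def tuplePow {n : ℕ} (σ : Fin n → (L ≃ₗ⁅k⁆ L)) (P : Matrix.GeneralLinearGroup (Fin n) ℤ)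
    (j : Fin n) : L ≃ₗ⁅k⁆ L :=
  (List.ofFn fun i => σ i ^ (P.1 i j)).prod

/-- The fixed subalgebra `L^σ` of a tuple of automorphisms. -/
def fixed {n : ℕ} (σ : Fin n → (L ≃ₗ⁅k⁆ L)) : LieSubalgebra k L where
  carrier := {x | ∀ i, σ i x = x}
  add_mem' ha hb i := by rw [map_add, ha i, hb i]
  zero_mem' i := map_zero _
  smul_mem' c x hx i := by rw [map_smul, hx i]
  lie_mem' ha hb i := by rw [LieEquiv.map_lie, ha i, hb i]

end Automorphisms

/-! ### Graded Lie algebras -/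

/-- A grading of the Lie algebra `L` by the abelian group `Λ`: `L` is the internal direct sum of
the subspaces `comp a`, and `⁅comp a, comp b⁆ ⊆ comp (a + b)`. -/
structure LieGrading (k : Type*) [CommRing k] (Λ : Type*) [AddCommGroup Λ]
    (L : Type*) [LieRing L] [LieAlgebra k L] where
  /-- the homogeneous component of a given degree -/
  comp : Λ → Submodule k L
  indep : iSupIndep comp
  iSup_eq_top : ⨆ a, comp a = ⊤
  lie_mem : ∀ {a b : Λ} {x y : L}, x ∈ comp a → y ∈ comp b → ⁅x, y⁆ ∈ comp (a + b)

theorem iSupIndep_group {k V ι κ : Type*} [Ring k] [AddCommGroup V] [Module k V]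
    {f : ι → Submodule k V} (hf : iSupIndep f) (d : ι → κ) (S : κ → Set ι)
    (hS : ∀ a, ∀ i ∈ S a, d i = a) : iSupIndep fun a => ⨆ i ∈ S a, f i := by
  intro a
  have h1 : Disjoint (S a) {i | d i ≠ a} := by
    rw [Set.disjoint_left]
    intro i hi hi'
    exact hi' (hS a i hi)
  refine (hf.disjoint_biSup_biSup h1).mono_right ?_
  refine iSup₂_le fun b hb => iSup₂_le fun i hi => ?_
  have : i ∈ {i | d i ≠ a} := by
    intro h
    exact hb ((hS b i hi).symm.trans h)
  exact le_iSup₂ (f := fun i (_ : i ∈ {i | d i ≠ a}) => f i) i this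

theorem lie_mem_iSup {k L ι κ : Type*} [CommRing k] [LieRing L] [LieAlgebra k L]
    (f : ι → Submodule k L) (g : κ → Submodule k L) (N : Submodule k L)
    (h : ∀ i j x y, x ∈ f i → y ∈ g j → ⁅x, y⁆ ∈ N) {x y : L}
    (hx : x ∈ ⨆ i, f i) (hy : y ∈ ⨆ j, g j) : ⁅x, y⁆ ∈ N := by
  refine Submodule.iSup_induction f (motive := fun x => ⁅x, y⁆ ∈ N) hx ?_ (by simp) ?_
  · intro i x hx
    refine Submodule.iSup_induction g (motive := fun y => ⁅x, y⁆ ∈ N) hy ?_ (by simp) ?_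
    · intro j y hy
      exact h i j x y hx hy
    · intro a b ha hb
      rw [lie_add]
      exact N.add_mem ha hb
  · intro a b ha hb
    rw [add_lie]
    exact N.add_mem ha hb

namespace LieGrading

section Basic

variable {k : Type*} [CommRing k] {Λ Λ' : Type*} [AddCommGroup Λ] [AddCommGroup Λ']
  {L L' : Type*} [LieRing L] [LieAlgebra k L] [LieRing L'] [LieAlgebra k L']

/-- The support: the set of degrees whose homogeneous component is non-zero. -/
def supp (B : LieGrading k Λ L) : Set Λ := {a | B.comp a ≠ ⊥}

/-- The subgroup generated by the support. -/
def suppGroup (B : LieGrading k Λ L) : AddSubgroup Λ := AddSubgroup.closure B.supp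

/-- Two graded Lie algebras are isograded-isomorphic if some Lie algebra isomorphism carries
homogeneous components onto homogeneous components according to an isomorphism of the grading
groups. -/
def IsogradedIso (B : LieGrading k Λ L) (B' : LieGrading k Λ' L') : Prop :=
  ∃ (φ : L ≃ₗ⁅k⁆ L') (f : Λ ≃+ Λ'),
    ∀ a : Λ, (B.comp a).map (φ.toLinearEquiv : L →ₗ[k] L') = B'.comp (f a)

/-- Two graded Lie algebras are support-isomorphic if they are isograded-isomorphic after their
grading groups are replaced by the subgroups generated by the supports. -/
def SupportIso (B : LieGrading k Λ L) (B' : LieGrading k Λ' L') : Prop :=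
  ∃ (φ : L ≃ₗ⁅k⁆ L') (f : B.suppGroup ≃+ B'.suppGroup),
    ∀ a : B.suppGroup, (B.comp a).map (φ.toLinearEquiv : L →ₗ[k] L') = B'.comp (f a)

end Basic

section Product

variable {k : Type*} [CommRing k] {Q Λ : Type*} [AddCommGroup Q] [AddCommGroup Λ]
  {L : Type*} [LieRing L] [LieAlgebra k L]

/-- The `Λ`-grading underlying a `Q × Λ`-grading: the component of degree `a` is the sum of all
components of degree `(q, a)`. -/
def second (B : LieGrading k (Q × Λ) L) : LieGrading k Λ L where
  comp a := ⨆ q : Q, B.comp (q, a)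
  indep := by
    have h := iSupIndep_group B.indep (fun p : Q × Λ => p.2) (fun a => {p | p.2 = a})
      (fun a p hp => hp)
    refine h.mono fun a => iSup_le fun q => ?_
    exact le_iSup₂ (f := fun (p : Q × Λ) (_ : p ∈ {p : Q × Λ | p.2 = a}) => B.comp p) (q, a) rfl
  iSup_eq_top := by
    rw [eq_top_iff, ← B.iSup_eq_top]
    refine iSup_le fun p => ?_
    exact le_trans (le_iSup (fun q : Q => B.comp (q, p.2)) p.1)
      (le_iSup (fun a : Λ => ⨆ q : Q, B.comp (q, a)) p.2)
  lie_mem {a b x y} hx hy := by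
    refine lie_mem_iSup _ _ _ (fun q r u v hu hv => ?_) hx hy
    exact Submodule.mem_iSup_of_mem (q + r) (B.lie_mem hu hv)

theorem mem_second_suppGroup (B : LieGrading k (Q × Λ) L) {p : Q × Λ} (hp : B.comp p ≠ ⊥) :
    p.2 ∈ B.second.suppGroup := by
  refine AddSubgroup.subset_closure fun h => hp ?_
  rw [eq_bot_iff, ← h]
  exact le_iSup (fun q : Q => B.comp (q, p.2)) p.1

/-- For a monomorphism `ρ` from the group generated by the `Λ`-support to `Λ`, the regraded Lie
algebra `B_(ρ)`: its component of degree `(q, a)` is `B.comp (q, ρ⁻¹ a)` if `a` is in the image of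
`ρ`, and zero otherwise. (The supremum below has at most one term, since `ρ` is injective.) -/
def regrade (B : LieGrading k (Q × Λ) L) (ρ : B.second.suppGroup →+ Λ)
    (_hρ : Function.Injective ρ) : LieGrading k (Q × Λ) L where
  comp p := ⨆ (c : B.second.suppGroup) (_ : ρ c = p.2), B.comp (p.1, c)
  indep := by
    classical
    have h := iSupIndep_group B.indep
      (fun p : Q × Λ => if hp : p.2 ∈ B.second.suppGroup then (p.1, ρ ⟨p.2, hp⟩) else p)
      (fun a => {p | ∃ c : B.second.suppGroup, ρ c = a.2 ∧ p = (a.1, (c : Λ))}) (by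
        rintro a p ⟨c, hc, rfl⟩
        simp [hc])
    refine h.mono fun a => iSup₂_le fun c hc => ?_
    exact le_iSup₂ (f := fun (p : Q × Λ)
      (_ : p ∈ {p | ∃ c : B.second.suppGroup, ρ c = a.2 ∧ p = (a.1, (c : Λ))}) => B.comp p)
      (a.1, (c : Λ)) ⟨c, hc, rfl⟩
  iSup_eq_top := by
    rw [eq_top_iff, ← B.iSup_eq_top]
    refine iSup_le fun p => ?_
    by_cases hp : B.comp p = ⊥
    · rw [hp]
      exact bot_le
    · let c : B.second.suppGroup := ⟨p.2, B.mem_second_suppGroup hp⟩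
      refine le_trans ?_ (le_iSup _ ((p.1, ρ c) : Q × Λ))
      exact le_iSup₂ (f := fun (c' : B.second.suppGroup) (_ : ρ c' = ρ c) =>
        B.comp (p.1, (c' : Λ))) c rfl
  lie_mem {a b x y} hx hy := by
    rw [iSup_subtype'] at hx hy
    refine lie_mem_iSup _ _ _ (fun c d u v hu hv => ?_) hx hy
    refine Submodule.mem_iSup_of_mem (c.1 + d.1) (Submodule.mem_iSup_of_mem ?_ ?_)
    · rw [map_add, c.2, d.2]
      rfl
    · exact B.lie_mem hu hv

theorem regrade_comp_apply (B : LieGrading k (Q × Λ) L) (ρ : B.second.suppGroup →+ Λ)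
    (hρ : Function.Injective ρ) (q : Q) (c : B.second.suppGroup) :
    (B.regrade ρ hρ).comp (q, ρ c) = B.comp (q, c) := by
  refine le_antisymm (iSup₂_le fun d hd => ?_) ?_
  · obtain rfl := hρ hd
    exact le_rfl
  · exact le_iSup₂ (f := fun (c' : B.second.suppGroup) (_ : ρ c' = ρ c) =>
      B.comp (q, (c' : Λ))) c rfl

theorem regrade_comp_of_notMem_range (B : LieGrading k (Q × Λ) L) (ρ : B.second.suppGroup →+ Λ)
    (hρ : Function.Injective ρ) (q : Q) (a : Λ) (ha : a ∉ ρ.range) :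
    (B.regrade ρ hρ).comp (q, a) = ⊥ := by
  rw [eq_bot_iff]
  exact iSup₂_le fun d hd => (ha ⟨d, hd⟩).elim

/-- For a homomorphism `s : Q → Λ`, the shifted graded Lie algebra `B^(s)`: its component of degree
`(q, a)` is `B.comp (q, a + s q)`. -/
def shift (B : LieGrading k (Q × Λ) L) (s : Q →+ Λ) : LieGrading k (Q × Λ) L where
  comp p := B.comp (p.1, p.2 + s p.1)
  indep := by
    refine B.indep.comp (f := fun p : Q × Λ => (p.1, p.2 + s p.1)) ?_
    rintro ⟨q, a⟩ ⟨r, b⟩ h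
    simp only [Prod.mk.injEq] at h
    obtain ⟨rfl, h⟩ := h
    rw [add_right_cancel h]
  iSup_eq_top := by
    rw [eq_top_iff, ← B.iSup_eq_top]
    refine iSup_le fun p => ?_
    have h := le_iSup (fun p : Q × Λ => B.comp (p.1, p.2 + s p.1)) (p.1, p.2 - s p.1)
    simpa using h
  lie_mem {a b x y} hx hy := by
    have h := B.lie_mem hx hy
    have e : ((a.1, a.2 + s a.1) + (b.1, b.2 + s b.1) : Q × Λ)
        = ((a + b).1, (a + b).2 + s (a + b).1) := by
      simp only [Prod.mk_add_mk, Prod.fst_add, Prod.snd_add, map_add]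
      rw [add_add_add_comm]
    rwa [e] at h

/-- `B'` arises from `B` by one regrading, either `B' = B_(ρ)` or `B' = B^(s)`. -/
def IsRegrading (B B' : LieGrading k (Q × Λ) L) : Prop :=
  (∃ (ρ : B.second.suppGroup →+ Λ) (hρ : Function.Injective ρ), B' = B.regrade ρ hρ) ∨
    ∃ s : Q →+ Λ, B' = B.shift s

end Product

end LieGrading

/-! ### Multiloop Lie algebras -/

/-- A choice of primitive `n`-th roots of unity `ζ_n ∈ k` such that `ζ_{mn} ^ m = ζ_n`. -/
structure CompatibleRoots (k : Type*) [Field k] where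
  root : ℕ+ → k
  isPrimitiveRoot : ∀ n : ℕ+, IsPrimitiveRoot (root n) n
  root_mul_pow : ∀ m n : ℕ+, root (m * n) ^ (m : ℕ) = root n

namespace CompatibleRoots

variable {k : Type*} [Field k] (ζ : CompatibleRoots k)

/-- For a rational number `q = a / b`, the root of unity `ζ ^ q = ζ_b ^ a`. -/
def ratPow (q : ℚ) : k := ζ.root q.pnatDen ^ q.num

theorem root_ne_zero (n : ℕ+) : ζ.root n ≠ 0 :=
  (ζ.isPrimitiveRoot n).ne_zero n.ne_zero

end CompatibleRoots

section Multiloop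

variable {k : Type*} [Field k] {𝔤 : Type*} [LieRing 𝔤] [LieAlgebra k 𝔤] {n : ℕ}

/-- The simultaneous eigenspace of the elements `x` such that `σ i x = ζ_{m i} ^ (l i) x` for all
`i`. It depends only on the classes of the `l i` modulo `m i`. -/
def eigenComp (ζ : CompatibleRoots k) (m : Fin n → ℕ+) (σ : Fin n → (𝔤 ≃ₗ⁅k⁆ 𝔤))
    (l : Fin n → ℤ) : Submodule k 𝔤 where
  carrier := {x | ∀ i, σ i x = ζ.root (m i) ^ (l i) • x}
  add_mem' ha hb i := by rw [map_add, ha i, hb i, smul_add]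
  zero_mem' i := by rw [map_zero, smul_zero]
  smul_mem' c x hx i := by rw [map_smul, hx i, smul_comm]

/-- For a subalgebra `𝔥` of `𝔤^σ` and `α ∈ 𝔥^*`, the root space `𝔤_α` (in all of `𝔤`) of the `x`
such that `⁅h, x⁆ = α(h) x` for all `h ∈ 𝔥`. -/
def rootSpace (σ : Fin n → (𝔤 ≃ₗ⁅k⁆ 𝔤)) (𝔥 : LieSubalgebra k (fixed σ))
    (α : Module.Dual k 𝔥) : Submodule k 𝔤 where
  carrier := {x | ∀ h : 𝔥, ⁅((h : fixed σ) : 𝔤), x⁆ = α h • x}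
  add_mem' ha hb h := by rw [lie_add, ha h, hb h, smul_add]
  zero_mem' h := by rw [lie_zero, smul_zero]
  smul_mem' c x hx h := by rw [lie_smul, hx h, smul_comm]

/-- The roots: the non-zero `α ∈ 𝔥^*` with `𝔤_α ≠ 0`. -/
def roots (σ : Fin n → (𝔤 ≃ₗ⁅k⁆ 𝔤)) (𝔥 : LieSubalgebra k (fixed σ)) : Set (Module.Dual k 𝔥) :=
  {α | α ≠ 0 ∧ rootSpace σ 𝔥 α ≠ ⊥}

/-- The root lattice `Q_𝔥`, the subgroup of `𝔥^*` generated by the roots. -/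
abbrev rootLattice (σ : Fin n → (𝔤 ≃ₗ⁅k⁆ 𝔤)) (𝔥 : LieSubalgebra k (fixed σ)) :
    AddSubgroup (Module.Dual k 𝔥) :=
  AddSubgroup.closure (roots σ 𝔥)

/-- The subspace `𝔤_α^l ⊗ t^l` of the algebra of `𝔤`-valued Laurent polynomials in `n` variables;
here `t^l` is `AddMonoidAlgebra.single l 1`, and Laurent polynomials are the left tensor factor. -/
def loopComp (ζ : CompatibleRoots k) (m : Fin n → ℕ+) (σ : Fin n → (𝔤 ≃ₗ⁅k⁆ 𝔤))
    (𝔥 : LieSubalgebra k (fixed σ)) (p : rootLattice σ 𝔥 × (Fin n → ℤ)) :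
    Submodule k (LieAlgebra.loopAlgebra k (Fin n → ℤ) 𝔤) :=
  (rootSpace σ 𝔥 p.1 ⊓ eigenComp ζ m σ p.2).map
    (TensorProduct.mk k (AddMonoidAlgebra k (Fin n → ℤ)) 𝔤 (AddMonoidAlgebra.single p.2 1))

theorem loopComp_lie_mem (ζ : CompatibleRoots k) (m : Fin n → ℕ+) (σ : Fin n → (𝔤 ≃ₗ⁅k⁆ 𝔤))
    (𝔥 : LieSubalgebra k (fixed σ)) {p q : rootLattice σ 𝔥 × (Fin n → ℤ)}
    {x y : LieAlgebra.loopAlgebra k (Fin n → ℤ) 𝔤}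
    (hx : x ∈ loopComp ζ m σ 𝔥 p) (hy : y ∈ loopComp ζ m σ 𝔥 q) :
    ⁅x, y⁆ ∈ loopComp ζ m σ 𝔥 (p + q) := by
  obtain ⟨u, ⟨hu1, hu2⟩, rfl⟩ := hx
  obtain ⟨v, ⟨hv1, hv2⟩, rfl⟩ := hy
  refine ⟨⁅u, v⁆, ⟨fun h => ?_, fun i => ?_⟩, ?_⟩
  · rw [leibniz_lie, hu1 h, hv1 h, smul_lie, lie_smul, ← add_smul]
    rfl
  · rw [LieEquiv.map_lie, hu2 i, hv2 i, smul_lie, lie_smul, smul_smul, ← zpow_add₀ (ζ.root_ne_zero _)]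
    rfl
  · simp [LieAlgebra.ExtendScalars.bracket_tmul, AddMonoidAlgebra.single_mul_single]

/-- The multiloop Lie algebra `L_m(𝔤, σ, 𝔥)`, the sum of the subspaces `𝔤_α^l ⊗ t^l`, as a
Lie subalgebra of the `𝔤`-valued Laurent polynomials. -/
def multiloop (ζ : CompatibleRoots k) (m : Fin n → ℕ+) (σ : Fin n → (𝔤 ≃ₗ⁅k⁆ 𝔤))
    (𝔥 : LieSubalgebra k (fixed σ)) :
    LieSubalgebra k (LieAlgebra.loopAlgebra k (Fin n → ℤ) 𝔤) where
  toSubmodule := ⨆ p, loopComp ζ m σ 𝔥 p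
  lie_mem' hx hy := lie_mem_iSup _ _ _ (fun p q _ _ hu hv =>
    Submodule.mem_iSup_of_mem (p + q) (loopComp_lie_mem ζ m σ 𝔥 hu hv)) hx hy

theorem iSupIndep_rootSpace (σ : Fin n → (𝔤 ≃ₗ⁅k⁆ 𝔤)) (𝔥 : LieSubalgebra k (fixed σ)) :
    iSupIndep fun α : rootLattice σ 𝔥 => rootSpace σ 𝔥 α := by
  have h := iSupIndep.iInf
    (fun (h : 𝔥) (c : k) => (LieAlgebra.ad k 𝔤 ((h : fixed σ) : 𝔤)).eigenspace c)
    (fun h => Module.End.eigenspaces_iSupIndep _)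
  have h' := h.comp (f := fun (α : rootLattice σ 𝔥) (h : 𝔥) => (α : Module.Dual k 𝔥) h) (by
    intro α β hαβ
    exact Subtype.ext (LinearMap.ext fun h => congrFun hαβ h))
  refine h'.mono fun α x hx => ?_
  refine Submodule.mem_iInf _ |>.2 fun h => ?_
  rw [Module.End.mem_eigenspace_iff]
  exact hx h

theorem iSupIndep_loopComp (ζ : CompatibleRoots k) (m : Fin n → ℕ+) (σ : Fin n → (𝔤 ≃ₗ⁅k⁆ 𝔤))
    (𝔥 : LieSubalgebra k (fixed σ)) : iSupIndep (loopComp ζ m σ 𝔥) := by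
  intro p
  rw [Submodule.disjoint_def]
  intro x hx hx'
  let c : LieAlgebra.loopAlgebra k (Fin n → ℤ) 𝔤 →ₗ[k] 𝔤 :=
    (Finsupp.lapply p.2).comp (LieAlgebra.LoopAlgebra.toFinsupp k (Fin n → ℤ) 𝔤).toLinearMap
  have hc : ∀ (l : Fin n → ℤ) (u : 𝔤), c (AddMonoidAlgebra.single l 1 ⊗ₜ[k] u) =
      Finsupp.single l u p.2 := by
    intro l u
    change (LieAlgebra.LoopAlgebra.toFinsupp k (Fin n → ℤ) 𝔤
      (AddMonoidAlgebra.single l 1 ⊗ₜ[k] u)) p.2 = _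
    rw [LieAlgebra.LoopAlgebra.toFinsupp_single_tmul]
  obtain ⟨u, ⟨hu, -⟩, rfl⟩ := hx
  have h1 : (⨆ (q) (_ : q ≠ p), loopComp ζ m σ 𝔥 q) ≤
      (⨆ (β : rootLattice σ 𝔥) (_ : β ≠ p.1), rootSpace σ 𝔥 β).comap c := by
    refine iSup₂_le fun q hq => ?_
    rintro _ ⟨v, ⟨hv, -⟩, rfl⟩
    rw [Submodule.mem_comap, TensorProduct.mk_apply, hc]
    by_cases h : q.2 = p.2
    · rw [h, Finsupp.single_eq_same]
      have hβ : q.1 ≠ p.1 := fun h' => hq (Prod.ext h' h)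
      exact Submodule.mem_iSup_of_mem q.1 (Submodule.mem_iSup_of_mem hβ hv)
    · rw [Finsupp.single_eq_of_ne (Ne.symm h)]
      exact Submodule.zero_mem _
  have h2 := h1 hx'
  rw [Submodule.mem_comap, TensorProduct.mk_apply, hc, Finsupp.single_eq_same] at h2
  have h3 := Submodule.disjoint_def.1 (iSupIndep_rootSpace σ 𝔥 p.1) u hu h2
  rw [h3, map_zero]

/-- The `Q_𝔥 × ℤ^n`-grading of the multiloop Lie algebra, whose component of degree `(α, l)` is
`𝔤_α^l ⊗ t^l`. -/
def multiloopGrading (ζ : CompatibleRoots k) (m : Fin n → ℕ+) (σ : Fin n → (𝔤 ≃ₗ⁅k⁆ 𝔤))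
    (𝔥 : LieSubalgebra k (fixed σ)) :
    LieGrading k (rootLattice σ 𝔥 × (Fin n → ℤ)) (multiloop ζ m σ 𝔥) where
  comp p := (loopComp ζ m σ 𝔥 p).comap (multiloop ζ m σ 𝔥).toSubmodule.subtype
  indep := by
    intro p
    rw [Submodule.disjoint_def]
    intro x hx hx'
    have h := iSupIndep_loopComp ζ m σ 𝔥 p
    rw [Submodule.disjoint_def] at h
    refine Subtype.ext (h x.1 hx ?_)
    have h2 := Submodule.mem_map_of_mem (f := (multiloop ζ m σ 𝔥).toSubmodule.subtype) hx'
    simp only [Submodule.map_iSup] at h2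
    exact (iSup₂_mono fun q hq => Submodule.map_comap_le _ _ :
      (⨆ (q) (_ : q ≠ p), _) ≤ ⨆ (q) (_ : q ≠ p), loopComp ζ m σ 𝔥 q) h2
  iSup_eq_top := by
    refine Submodule.map_injective_of_injective
      (multiloop ζ m σ 𝔥).toSubmodule.injective_subtype ?_
    rw [Submodule.map_iSup, Submodule.map_top, Submodule.range_subtype]
    refine iSup_congr fun p => ?_
    rw [Submodule.map_comap_subtype, inf_eq_right]
    exact le_iSup (loopComp ζ m σ 𝔥) p
  lie_mem hx hy := loopComp_lie_mem ζ m σ 𝔥 hx hy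

end Multiloop

end MultiloopLie

end

open MultiloopLie

/-! Write `w(α, l)_j = ∑ i, p_ij (l_i / m_i - s_i(α))` (`twistWeight`). If `x ∈ 𝔤_α^l`, then `∏ (τ_i
σ_i)^{p_ij}` multiplies `x` by `ζ^{w_j}`, so (b) says that `φ` carries `𝔤_α^l` into the joint
eigenspace of `σ'` with eigenvalues `ζ^{w(α, l)}`. Everything is a comparison of these exponents
with degrees.

From (a) or (c) to (b). Both hypotheses give a Lie isomorphism `Φ` between the multiloop algebras
and a homomorphism `F` from the support group of `L` to `ℤ^n` such that `Φ` sends degree `a` into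
`ℤ^n`-degree `F a`; for (c) this is carried along the chain of regradings
(`IsRegrading.exists_hom`). Compose `Φ` with evaluation at `t = 1`. Multiplication by `t^{mμ}` lies
in the centroid of `L`, hence becomes a scalar `c μ` on the simple algebra `𝔤'`. Dividing by a
character `χ` with `χ (mμ) = c μ` makes the composite independent of the choice of `l` modulo `m`,
and yields an isomorphism `φ : 𝔤 → 𝔤'` (`exists_untwist`). On the degrees `(0, mμ)` the map `F`
takes the form `m' (A μ)` with `A` an automorphism of `ℤ^n`; its matrix is the transpose of `P`. The
remaining discrepancy between `F / m'` and `l / m` transformed by `P` depends only on `α` and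
determines `s` (`exists_rational_shift`).

From (b) to (a) and (c). The image `φ(𝔥)` is a self-centralizing subspace of `𝔤'^σ'` made of
commuting ad-semisimple elements (`isToralCartan_map`), but need not be `𝔥'`. Such subspaces are
conjugate under automorphisms commuting with `σ'` (`IsToralCartan.exists_conj`), so `φ` may be
corrected to satisfy `φ(𝔥) = 𝔥'` without changing its effect on eigenvalues. Then `F = m' w` is
integral on the support group, and `x ⊗ t^l ↦ φ(x) ⊗ t^{F(α, l)}` is an isomorphism of multiloop
algebras compatible with `(α, l) ↦ (g α, F(α, l))`, where `g` is the induced map of root lattices.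
This map of degrees is injective, giving (a). It also factors as multiplication of degrees by an
integer `N`, a shift by the integral homomorphism `N m s`, and an injective linear map, giving (c)
in three moves.

Two ingredients are classical. A Cartan subalgebra of `𝔤^σ` is abelian and ad-semisimple on all of
`𝔤`, because the Killing form of `𝔤` stays nondegenerate on `𝔤^σ` and on `𝔥`. Conjugacy is proved by
showing that the conjugates of each such subspace contain a nonempty principal open subset of `𝔤^σ`.
-/

namespace MultiloopLie

/-! ### Independent families of subspaces -/

section Independence

/-- Split `x ∈ E i` as `u + w` with `u ∈ U i` and `w` in the span of the other `U j`. Then `w = x -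
u` lies both in `E i` and in the span of the other `E j`, so it vanishes. -/
theorem eq_of_le_of_iSupIndep {k V ι : Type*} [Ring k] [AddCommGroup V] [Module k V]
    {U E : ι → Submodule k V} (hE : iSupIndep E) (hU : ∀ i, U i ≤ E i) (htop : ⨆ i, U i = ⊤)
    (i : ι) : U i = E i := by
  refine le_antisymm (hU i) fun x hx => ?_
  have h1 : U i ⊔ ⨆ (j) (_ : j ≠ i), U j = ⊤ := by
    rw [eq_top_iff, ← htop]
    refine iSup_le fun j => ?_
    by_cases h : j = i
    · subst h; exact le_sup_left
    · exact le_sup_of_le_right (le_iSup₂ (f := fun j (_ : j ≠ i) => U j) j h)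
  obtain ⟨u, hu, w, hw, rfl⟩ := Submodule.mem_sup.1 (h1.symm ▸ Submodule.mem_top (x := x))
  have hw' : w ∈ ⨆ (j) (_ : j ≠ i), E j := (iSup₂_mono fun j _ => hU j) hw
  have hw'' : w ∈ E i := by
    have := (E i).sub_mem hx (hU i hu)
    rwa [add_sub_cancel_left] at this
  have := Submodule.disjoint_def.1 (hE i) w hw'' hw'
  rw [this, add_zero]
  exact hu

/-- The main tool for computing eigenspaces: when a fine decomposition `W` consists of eigenvectors,
each eigenspace is exactly the sum of the pieces with that eigenvalue. -/
theorem eq_iSup_fiber {k V ι κ : Type*} [Ring k] [AddCommGroup V] [Module k V]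
    {W : ι → Submodule k V} {E : κ → Submodule k V} (hE : iSupIndep E) (c : ι → κ)
    (hW : ∀ i, W i ≤ E (c i)) (htop : ⨆ i, W i = ⊤) (j : κ) :
    E j = ⨆ (i) (_ : c i = j), W i := by
  refine (eq_of_le_of_iSupIndep (U := fun j => ⨆ (i) (_ : c i = j), W i) hE ?_ ?_ j).symm
  · refine fun j => iSup₂_le fun i hi => ?_
    subst hi
    exact hW i
  · rw [eq_top_iff, ← htop]
    refine iSup_le fun i => ?_
    refine le_trans ?_ (le_iSup _ (c i))
    exact le_iSup₂ (f := fun i' (_ : c i' = c i) => W i') i rfl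

theorem exists_fiber_of_mem {k V ι κ : Type*} [Ring k] [AddCommGroup V] [Module k V]
    {W : ι → Submodule k V} {E : κ → Submodule k V} (hE : iSupIndep E) (c : ι → κ)
    (hW : ∀ i, W i ≤ E (c i)) {x : V} (hx : x ≠ 0) {j : κ} (hxj : x ∈ E j)
    {S : Set ι} (hxS : x ∈ ⨆ i ∈ S, W i) : ∃ i ∈ S, c i = j ∧ W i ≠ ⊥ := by
  by_contra! h
  refine hx (Submodule.disjoint_def.1 (hE j) x hxj ?_)
  refine (iSup₂_le fun i hi => ?_ : (⨆ i ∈ S, W i) ≤ _) hxS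
  by_cases hij : c i = j
  · rw [h i hi hij]
    exact bot_le
  · exact (hW i).trans (le_iSup₂ (f := fun j' (_ : j' ≠ j) => E j') (c i) hij)

theorem exists_linearMap_of_iSupIndep {k V W ι : Type*} [Ring k] [AddCommGroup V] [Module k V]
    [AddCommGroup W] [Module k W]
    {E : ι → Submodule k V} (hE : iSupIndep E) (htop : ⨆ i, E i = ⊤) (e : ι → V →ₗ[k] W) :
    ∃ φ : V →ₗ[k] W, ∀ i, ∀ x ∈ E i, φ x = e i x := by
  classical
  have hint := DirectSum.isInternal_submodule_of_iSupIndep_of_iSup_eq_top hE htop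
  let f := LinearEquiv.ofBijective (DirectSum.coeLinearMap E) hint
  refine ⟨(DirectSum.toModule k ι W fun i => (e i).comp (E i).subtype).comp f.symm.toLinearMap,
    fun i x hx => ?_⟩
  have h : f.symm x = DirectSum.lof k ι (fun i => E i) i ⟨x, hx⟩ := by
    rw [LinearEquiv.symm_apply_eq]
    exact (DirectSum.coeLinearMap_lof E i ⟨x, hx⟩).symm
  simp [h]

/-- Induction over a family of submodules whose supremum is everything. -/
theorem iSup_top_induction {k V ι : Type*} [Ring k] [AddCommGroup V] [Module k V]
    {E : ι → Submodule k V} (htop : ⨆ i, E i = ⊤) {p : V → Prop} (x : V)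
    (hmem : ∀ i, ∀ x ∈ E i, p x) (h0 : p 0) (hadd : ∀ x y, p x → p y → p (x + y)) : p x :=
  Submodule.iSup_induction E (motive := p) (htop.symm ▸ Submodule.mem_top) hmem h0 hadd

theorem linearMap_ext_iSup {k V W ι : Type*} [Ring k] [AddCommGroup V] [Module k V]
    [AddCommGroup W] [Module k W] {E : ι → Submodule k V} (htop : ⨆ i, E i = ⊤)
    {f g : V →ₗ[k] W} (h : ∀ i, ∀ x ∈ E i, f x = g x) : f = g := by
  ext x
  refine iSup_top_induction htop (p := fun x => f x = g x) x h (by simp) fun x y hx hy => ?_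
  rw [map_add, map_add, hx, hy]

/-- Distinct nonzero pieces are sent into distinct members of an independent family, so their images
cannot cancel. -/
theorem injective_of_iSupIndep_map {k V V' ι κ : Type*} [Ring k] [AddCommGroup V] [Module k V]
    [AddCommGroup V'] [Module k V'] {W : ι → Submodule k V} {E : κ → Submodule k V'}
    (htop : ⨆ i, W i = ⊤) (hE : iSupIndep E) (Φ : V →ₗ[k] V') (g : ι → κ)
    (hg : Set.InjOn g {i | W i ≠ ⊥}) (hΦ : ∀ i, ∀ x ∈ W i, Φ x ∈ E (g i))
    (hinj : ∀ i, ∀ x ∈ W i, Φ x = 0 → x = 0) : Function.Injective Φ := by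
  rw [injective_iff_map_eq_zero]
  intro x hx
  obtain ⟨f, hf, rfl⟩ := (Submodule.mem_iSup_iff_exists_finsupp W x).1
    (htop.symm ▸ Submodule.mem_top)
  have hne : ∀ i : f.support, W i ≠ ⊥ := fun i hb => by
    refine Finsupp.mem_support_iff.1 i.2 ?_
    simpa [hb] using hf i
  have hE' : iSupIndep fun i : f.support => E (g i) :=
    hE.comp (f := fun i : f.support => g i) fun i j hij => Subtype.ext (hg (hne i) (hne j) hij)
  rw [iSupIndep_iff_finsetSum_eq_zero_imp_eq_zero] at hE'
  refine Finset.sum_eq_zero fun i hi => hinj i _ (hf i) ?_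
  refine hE' Finset.univ (fun i => Φ (f i)) (fun i _ => hΦ i _ (hf i)) ?_ ⟨i, hi⟩
    (Finset.mem_univ _)
  rw [Finset.sum_coe_sort f.support fun i => Φ (f i), ← map_sum]
  exact hx

end Independence

/-! ### Homomorphisms on generated subgroups, and integrality -/

section Closure

theorem mem_of_closure_hom {A B : Type*} [AddCommGroup A] [AddCommGroup B] {S : Set A}
    (F : AddSubgroup.closure S →+ B) (K : AddSubgroup B)
    (h : ∀ a, ∀ ha : a ∈ S, F ⟨a, AddSubgroup.subset_closure ha⟩ ∈ K)
    (a : AddSubgroup.closure S) : F a ∈ K := by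
  obtain ⟨a, ha⟩ := a
  induction ha using AddSubgroup.closure_induction with
  | mem a ha => exact h a ha
  | zero => rw [show (⟨0, _⟩ : AddSubgroup.closure S) = 0 from rfl, map_zero]; exact K.zero_mem
  | add a b ha hb h1 h2 =>
    rw [show (⟨a + b, _⟩ : AddSubgroup.closure S) = ⟨a, ha⟩ + ⟨b, hb⟩ from rfl, map_add]
    exact K.add_mem h1 h2
  | neg a ha h1 =>
    rw [show (⟨-a, _⟩ : AddSubgroup.closure S) = -⟨a, ha⟩ from rfl, map_neg]
    exact K.neg_mem h1

theorem exists_int_lift {n : ℕ} {A : Type*} [AddCommGroup A] (F : A →+ (Fin n → ℚ))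
    (h : ∀ a i, ∃ z : ℤ, F a i = z) : ∃ G : A →+ (Fin n → ℤ), ∀ a i, (G a i : ℚ) = F a i := by
  choose z hz using h
  refine ⟨AddMonoidHom.mk' z fun a b => ?_, fun a i => (hz a i).symm⟩
  ext i
  have : ((z (a + b) i : ℤ) : ℚ) = ((z a i + z b i : ℤ) : ℚ) := by
    rw [← hz, map_add, Pi.add_apply, hz, hz]
    push_cast
    rfl
  exact_mod_cast this

/-- The subgroup of rational vectors with integral coordinates. -/
def integralVectors (n : ℕ) : AddSubgroup (Fin n → ℚ) where
  carrier := {v | ∀ i, ∃ z : ℤ, v i = z}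
  add_mem' {a b} ha hb i := by
    obtain ⟨x, hx⟩ := ha i
    obtain ⟨y, hy⟩ := hb i
    exact ⟨x + y, by simp [hx, hy]⟩
  zero_mem' i := ⟨0, by simp⟩
  neg_mem' {a} ha i := by
    obtain ⟨x, hx⟩ := ha i
    exact ⟨-x, by simp [hx]⟩

end Closure

/-! ### Maps between graded Lie algebras -/

namespace LieGrading

variable {k : Type*} [CommRing k] {Λ Λ' : Type*} [AddCommGroup Λ] [AddCommGroup Λ']
  {L L' : Type*} [LieRing L] [LieAlgebra k L] [LieRing L'] [LieAlgebra k L']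

/-- Only the values of `e a` on the component of degree `a` matter; bilinearity reduces
compatibility with brackets to homogeneous elements. -/
theorem exists_lieHom (B : LieGrading k Λ L) (e : Λ → L →ₗ[k] L')
    (he : ∀ a b, ∀ x ∈ B.comp a, ∀ y ∈ B.comp b, e (a + b) ⁅x, y⁆ = ⁅e a x, e b y⁆) :
    ∃ Φ : L →ₗ⁅k⁆ L', ∀ a, ∀ x ∈ B.comp a, Φ x = e a x := by
  obtain ⟨φ, hφ⟩ := exists_linearMap_of_iSupIndep B.indep B.iSup_eq_top e
  refine ⟨{ φ with map_lie' := fun {x y} => ?_ }, hφ⟩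
  change φ ⁅x, y⁆ = ⁅φ x, φ y⁆
  refine iSup_top_induction B.iSup_eq_top (p := fun x => φ ⁅x, y⁆ = ⁅φ x, φ y⁆) x ?_ (by simp)
    fun u v hu hv => by rw [add_lie, map_add, map_add, add_lie, hu, hv]
  intro a x hx
  refine iSup_top_induction B.iSup_eq_top (p := fun y => φ ⁅x, y⁆ = ⁅φ x, φ y⁆) y ?_ (by simp)
    fun u v hu hv => by rw [lie_add, map_add, map_add, lie_add, hu, hv]
  intro b y hy
  rw [hφ _ _ (B.lie_mem hx hy), he a b x hx y hy, hφ a x hx, hφ b y hy]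

theorem mem_suppGroup (B : LieGrading k Λ L) {a : Λ} {x : L} (hx : x ∈ B.comp a) (h : x ≠ 0) :
    a ∈ B.suppGroup := by
  refine AddSubgroup.subset_closure fun hb => h ?_
  rw [hb] at hx
  simpa using hx

/-- The images of the components of `B` span `L'` because `Φ` is onto, so mere inclusions already
determine every component of `B'`. Neither injectivity nor additivity of `f` is needed, which is
what permits its use for the coarser `ℤ^n`-gradings. -/
theorem map_comp_eq (B : LieGrading k Λ L) (B' : LieGrading k Λ' L') (Φ : L ≃ₗ⁅k⁆ L')
    (f : B.suppGroup → Λ') (hf : ∀ a : B.suppGroup, ∀ x ∈ B.comp a, Φ x ∈ B'.comp (f a)) (b : Λ') :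
    B'.comp b =
      ⨆ (a : B.suppGroup) (_ : f a = b), (B.comp a).map (Φ.toLinearEquiv : L →ₗ[k] L') := by
  refine eq_iSup_fiber B'.indep f (W := fun a : B.suppGroup =>
    (B.comp a).map (Φ.toLinearEquiv : L →ₗ[k] L')) ?_ ?_ b
  · rintro a _ ⟨x, hx, rfl⟩
    exact hf a x hx
  · rw [← Submodule.map_iSup, eq_top_iff, ← (LinearMap.range_eq_top (f := (Φ.toLinearEquiv : L →ₗ[k] L'))).2 Φ.surjective,
      LinearMap.range_eq_map]
    refine Submodule.map_mono ?_
    rw [← B.iSup_eq_top]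
    refine iSup_le fun a => ?_
    by_cases ha : B.comp a = ⊥
    · rw [ha]
      exact bot_le
    · exact le_iSup (fun a : B.suppGroup => B.comp a) ⟨a, AddSubgroup.subset_closure ha⟩

theorem supportIso_of_injective (B : LieGrading k Λ L) (B' : LieGrading k Λ' L') (Φ : L ≃ₗ⁅k⁆ L')
    (f : B.suppGroup →+ Λ') (hinj : Function.Injective f)
    (hf : ∀ a : B.suppGroup, ∀ x ∈ B.comp a, Φ x ∈ B'.comp (f a)) : B.SupportIso B' := by
  have h1 : ∀ a : B.suppGroup, (B.comp a).map (Φ.toLinearEquiv : L →ₗ[k] L') = B'.comp (f a) := by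
    intro a
    rw [map_comp_eq B B' Φ f hf]
    refine le_antisymm (le_iSup₂ (f := fun (c : B.suppGroup) (_ : f c = f a) =>
      (B.comp c).map (Φ.toLinearEquiv : L →ₗ[k] L')) a rfl) (iSup₂_le fun c hc => ?_)
    rw [hinj hc]
  have h2 : ∀ b, B'.comp b ≠ ⊥ → ∃ a : B.suppGroup, f a = b := by
    intro b hb
    by_contra! h
    refine hb ?_
    rw [map_comp_eq B B' Φ f hf, eq_bot_iff]
    exact iSup₂_le fun a ha => (h a ha).elim
  have h3 : ∀ a : B.suppGroup, f a ∈ B'.suppGroup := by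
    refine mem_of_closure_hom f _ fun a ha => AddSubgroup.subset_closure ?_
    intro hb
    refine ha ((Submodule.map_eq_bot_iff (e := Φ.toLinearEquiv)).1 ?_)
    rw [← hb]
    exact h1 ⟨a, AddSubgroup.subset_closure ha⟩
  have h4 : B'.suppGroup ≤ f.range := by
    refine (AddSubgroup.closure_le _).2 fun b hb => ?_
    exact h2 b hb
  refine ⟨Φ, AddEquiv.ofBijective (f.codRestrict B'.suppGroup h3) ⟨fun a b hab => hinj ?_, ?_⟩,
    h1⟩
  · exact congrArg Subtype.val hab
  · rintro ⟨b, hb⟩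
    obtain ⟨a, rfl⟩ := h4 hb
    exact ⟨a, rfl⟩

end LieGrading

/-! ### Rational powers of the compatible roots of unity -/

namespace CompatibleRoots

variable {k : Type*} [Field k] (ζ : CompatibleRoots k)

theorem root_zpow_eq_one_iff (d : ℕ+) (a : ℤ) : ζ.root d ^ a = 1 ↔ ((d : ℕ) : ℤ) ∣ a :=
  (ζ.isPrimitiveRoot d).zpow_eq_one_iff_dvd a

/-- If `c` is the factor cancelled in reducing `a / d`, then `d = c * den`, and the compatibility
`ζ_{c * den} ^ c = ζ_den` absorbs it. -/
theorem ratPow_div (a : ℤ) (d : ℕ+) : ζ.ratPow (a / (d : ℕ)) = ζ.root d ^ a := by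
  obtain ⟨c, hc1, hc2⟩ := Rat.exists_eq_mul_div_num_and_eq_mul_div_den a
    (d := ((d : ℕ) : ℤ)) (by exact_mod_cast d.ne_zero)
  set q : ℚ := (a / (d : ℕ) : ℚ) with hq
  have hq' : ((a : ℚ) / (((d : ℕ) : ℤ) : ℚ)) = q := by simp [hq]
  rw [hq'] at hc1 hc2
  have hcpos : 0 < c := by
    have h1 : (0 : ℤ) < c * q.den := by rw [← hc2]; exact_mod_cast d.pos
    exact pos_of_mul_pos_left h1 (by positivity)
  lift c to ℕ using hcpos.le
  have hcpos' : 0 < c := by exact_mod_cast hcpos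
  lift c to ℕ+ using hcpos'
  have hd : d = c * q.pnatDen := by
    apply PNat.eq
    rw [PNat.mul_coe, Rat.coe_pnatDen]
    exact_mod_cast hc2
  rw [ratPow, hc1, zpow_mul]
  conv_rhs => rw [hd]
  congr 1
  rw [zpow_natCast]
  exact (ζ.root_mul_pow c q.pnatDen).symm

theorem ratPow_add (p q : ℚ) : ζ.ratPow (p + q) = ζ.ratPow p * ζ.ratPow q := by
  have hp : p = ((p.num * q.den : ℤ) : ℚ) / ((p.pnatDen * q.pnatDen : ℕ+) : ℕ) := by
    conv_lhs => rw [← Rat.num_div_den p]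
    have := q.den_ne_zero
    have := p.den_ne_zero
    push_cast [Rat.coe_pnatDen]
    field_simp
  have hq : q = ((q.num * p.den : ℤ) : ℚ) / ((p.pnatDen * q.pnatDen : ℕ+) : ℕ) := by
    conv_lhs => rw [← Rat.num_div_den q]
    have := q.den_ne_zero
    have := p.den_ne_zero
    push_cast [Rat.coe_pnatDen]
    field_simp
  have hpq : p + q = ((p.num * q.den + q.num * p.den : ℤ) : ℚ) /
      ((p.pnatDen * q.pnatDen : ℕ+) : ℕ) := by
    rw [Int.cast_add, add_div, ← hp, ← hq]
  rw [hpq, ratPow_div, zpow_add₀ (ζ.root_ne_zero _), ← ratPow_div, ← ratPow_div, ← hp, ← hq]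

theorem ratPow_eq_one_iff (q : ℚ) : ζ.ratPow q = 1 ↔ ∃ z : ℤ, q = z := by
  rw [ratPow, root_zpow_eq_one_iff, Rat.coe_pnatDen]
  constructor
  · intro h
    have : q.den = 1 := by
      have h2 : q.den ∣ q.num.natAbs := Int.natCast_dvd.1 h
      have := q.reduced
      exact Nat.eq_one_of_dvd_coprimes this h2 dvd_rfl |> fun h => h
    exact ⟨q.num, (Rat.coe_int_num_of_den_eq_one this).symm⟩
  · rintro ⟨z, rfl⟩
    simp

theorem ratPow_zero : ζ.ratPow 0 = 1 := (ζ.ratPow_eq_one_iff 0).2 ⟨0, by simp⟩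

theorem ratPow_ne_zero (q : ℚ) : ζ.ratPow q ≠ 0 := zpow_ne_zero _ (ζ.root_ne_zero _)

/-- `q ↦ ζ ^ q` as a homomorphism. -/
def ratPowHom : Multiplicative ℚ →* k where
  toFun q := ζ.ratPow q.toAdd
  map_one' := ζ.ratPow_zero
  map_mul' _ _ := ζ.ratPow_add _ _

theorem ratPow_neg (q : ℚ) : ζ.ratPow (-q) = (ζ.ratPow q)⁻¹ := by
  refine eq_inv_of_mul_eq_one_left ?_
  rw [← ratPow_add, neg_add_cancel, ratPow_zero]

theorem ratPow_natMul (N : ℕ) (q : ℚ) : ζ.ratPow (N * q) = ζ.ratPow q ^ N := by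
  have := map_pow ζ.ratPowHom (Multiplicative.ofAdd q) N
  simpa [ratPowHom] using this

theorem ratPow_intMul (N : ℤ) (q : ℚ) : ζ.ratPow (N * q) = ζ.ratPow q ^ N := by
  obtain ⟨N, rfl | rfl⟩ := N.eq_nat_or_neg
  · rw [zpow_natCast, ← ratPow_natMul]; simp
  · rw [zpow_neg, zpow_natCast, ← ratPow_natMul, ← ratPow_neg]; simp

theorem ratPow_sum {ι : Type*} (s : Finset ι) (f : ι → ℚ) :
    ζ.ratPow (∑ i ∈ s, f i) = ∏ i ∈ s, ζ.ratPow (f i) := by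
  classical
  induction s using Finset.induction_on with
  | empty => simp [ratPow_zero]
  | insert i s hi h => rw [Finset.sum_insert hi, Finset.prod_insert hi, ratPow_add, h]

end CompatibleRoots

/-! ### Simultaneous diagonalization -/

section Simultaneous

variable {k V ι : Type*} [Field k] [IsAlgClosed k] [AddCommGroup V] [Module k V]
  [FiniteDimensional k V]

/-- The restrictions to `p` commute, so `p` is the sum of joint generalized eigenspaces; these are
traces on `p` of those of the `f i`, where semisimplicity removes the word generalized. -/
theorem le_iSup_inf_eigenspace (f : ι → Module.End k V) (hcomm : ∀ i j, Commute (f i) (f j))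
    (hss : ∀ i, (f i).IsSemisimple) (p : Submodule k V) (hp : ∀ i, ∀ x ∈ p, f i x ∈ p) :
    p ≤ ⨆ χ : ι → k, p ⊓ ⨅ i, (f i).eigenspace (χ i) := by
  have h := Module.End.iSup_iInf_maxGenEigenspace_eq_top_of_iSup_maxGenEigenspace_eq_top_of_commute
    (fun i => (f i).restrict (hp i)) (fun i j _ => LinearMap.restrict_commute (hcomm i j) _ _)
    (fun i => Module.End.iSup_maxGenEigenspace_eq_top _)
  have h2 := congrArg (Submodule.map p.subtype) h
  rw [Submodule.map_iSup, Submodule.map_top, Submodule.range_subtype] at h2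
  conv_lhs => rw [← h2]
  refine iSup_mono fun χ => ?_
  rw [← Submodule.inf_iInf_maxGenEigenspace_of_forall_mapsTo f p hp]
  simp only [(hss _).isFinitelySemisimple.maxGenEigenspace_eq_eigenspace, le_refl]

theorem iSup_iInf_eigenspace_eq_top (f : ι → Module.End k V)
    (hcomm : ∀ i j, Commute (f i) (f j)) (hss : ∀ i, (f i).IsSemisimple) :
    ⨆ χ : ι → k, ⨅ i, (f i).eigenspace (χ i) = ⊤ := by
  simpa using le_iSup_inf_eigenspace f hcomm hss ⊤ (by simp)

omit [IsAlgClosed k] [FiniteDimensional k V] in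
theorem isSemisimple_of_pow_eq_one [CharZero k] (f : Module.End k V) (m : ℕ) (hm : m ≠ 0)
    (hf : f ^ m = 1) : f.IsSemisimple := by
  refine Module.End.isSemisimple_of_squarefree_aeval_eq_zero
    (p := (Polynomial.X ^ m - 1 : Polynomial k)) ?_ (by simp [hf])
  refine Polynomial.Separable.squarefree ?_
  have := Polynomial.separable_X_pow_sub_C (F := k) (n := m) 1 (by exact_mod_cast hm) one_ne_zero
  simpa using this

end Simultaneous

/-! ### Cartan subalgebras of the fixed algebra are toral and self-centralizing -/

section Toral

variable {k : Type*} [Field k] {𝔤 : Type*} [LieRing 𝔤] [LieAlgebra k 𝔤] {n : ℕ}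

/-- A subspace of the subalgebra `R` consisting of commuting elements whose adjoint action on the
whole of `𝔤` is semisimple, and which equals its own centralizer in `R`. -/
structure IsToralCartan (R : LieSubalgebra k 𝔤) (H : Submodule k 𝔤) : Prop where
  le : ∀ x ∈ H, x ∈ R
  lie_eq_zero : ∀ x ∈ H, ∀ y ∈ H, ⁅x, y⁆ = 0
  mem_of_lie : ∀ x ∈ R, (∀ h ∈ H, ⁅h, x⁆ = 0) → x ∈ H
  isSemisimple : ∀ h ∈ H, (LieAlgebra.ad k 𝔤 h).IsSemisimple

/-- The image in `𝔤` of a subalgebra of `𝔤^σ`. -/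
def ambient (σ : Fin n → (𝔤 ≃ₗ⁅k⁆ 𝔤)) (𝔥 : LieSubalgebra k (fixed σ)) : Submodule k 𝔤 :=
  𝔥.toSubmodule.map (fixed σ).toSubmodule.subtype

theorem mem_ambient {σ : Fin n → (𝔤 ≃ₗ⁅k⁆ 𝔤)} {𝔥 : LieSubalgebra k (fixed σ)} {x : 𝔤} :
    x ∈ ambient σ 𝔥 ↔ ∃ h : 𝔥, ((h : fixed σ) : 𝔤) = x := by
  constructor
  · rintro ⟨h, hh, rfl⟩
    exact ⟨⟨h, hh⟩, rfl⟩
  · rintro ⟨h, rfl⟩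
    exact ⟨h.1, h.2, rfl⟩

theorem aut_pow_toLinearMap (f : 𝔤 ≃ₗ⁅k⁆ 𝔤) (m : ℕ) :
    ((f ^ m : 𝔤 ≃ₗ⁅k⁆ 𝔤).toLinearEquiv : 𝔤 →ₗ[k] 𝔤) = (f.toLinearEquiv : Module.End k 𝔤) ^ m := by
  induction m with
  | zero => rfl
  | succ m ih => rw [pow_succ, pow_succ, ← ih]; rfl

theorem aut_commute {σ τ : 𝔤 ≃ₗ⁅k⁆ 𝔤} (h : σ * τ = τ * σ) (x : 𝔤) : σ (τ x) = τ (σ x) := by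
  rw [← aut_mul_apply, h, aut_mul_apply]

theorem lie_apply_commute (σ : 𝔤 ≃ₗ⁅k⁆ 𝔤) (x : 𝔤) (hx : σ x = x) :
    Commute (σ.toLinearEquiv : Module.End k 𝔤) (LieAlgebra.ad k 𝔤 x) := by
  ext y
  change σ ⁅x, y⁆ = ⁅x, σ y⁆
  rw [LieEquiv.map_lie, hx]

theorem commute_ad {x y : 𝔤} (h : ⁅x, y⁆ = 0) :
    Commute (LieAlgebra.ad k 𝔤 x) (LieAlgebra.ad k 𝔤 y) := by
  ext z
  change ⁅x, ⁅y, z⁆⁆ = ⁅y, ⁅x, z⁆⁆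
  rw [leibniz_lie, h, zero_lie, zero_add]

theorem mem_eigenspace_iff_root (ζ : CompatibleRoots k) (f : 𝔤 ≃ₗ⁅k⁆ 𝔤) (m : ℕ+)
    (hf : f ^ (m : ℕ) = 1) (c : k) {x : 𝔤} (hx : x ≠ 0) (h : f x = c • x) :
    ∃ l : ℤ, c = ζ.root m ^ l := by
  have h1 : ∀ j : ℕ, (f ^ j) x = c ^ j • x := by
    intro j
    induction j with
    | zero => simp
    | succ j ih => rw [pow_succ', aut_mul_apply, ih, map_smul, h, smul_smul, pow_succ]
  have h2 : c ^ (m : ℕ) = 1 := by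
    have h3 := h1 m
    rw [hf] at h3
    have h4 : (c ^ (m : ℕ) - 1) • x = 0 := by
      rw [sub_smul, ← h3, one_smul]
      exact sub_self x
    exact sub_eq_zero.1 ((smul_eq_zero.1 h4).resolve_right hx)
  obtain ⟨i, -, hi⟩ := (ζ.isPrimitiveRoot m).eq_pow_of_pow_eq_one h2
  exact ⟨i, by rw [← hi, zpow_natCast]⟩

variable [IsAlgClosed k] [CharZero k] [FiniteDimensional k 𝔤]

theorem iSup_eigenComp_eq_top (ζ : CompatibleRoots k) (m : Fin n → ℕ+) (σ : Fin n → (𝔤 ≃ₗ⁅k⁆ 𝔤))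
    (hσ : ∀ i j, σ i * σ j = σ j * σ i) (hσm : ∀ i, σ i ^ (m i : ℕ) = 1) :
    ⨆ l, eigenComp ζ m σ l = ⊤ := by
  rw [eq_top_iff, ← iSup_iInf_eigenspace_eq_top
    (fun i => ((σ i).toLinearEquiv : Module.End k 𝔤)) (fun i j => ?_)
    (fun i => isSemisimple_of_pow_eq_one _ (m i) (m i).ne_zero ?_)]
  · refine iSup_le fun χ x hx => ?_
    by_cases h0 : x = 0
    · rw [h0]; exact Submodule.zero_mem _
    simp only [Submodule.mem_iInf, Module.End.mem_eigenspace_iff] at hx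
    have := fun i => mem_eigenspace_iff_root ζ (σ i) (m i) (hσm i) (χ i) h0 (hx i)
    choose l hl using this
    refine Submodule.mem_iSup_of_mem l fun i => ?_
    rw [← hl]
    exact hx i
  · ext x
    exact aut_commute (hσ i j) x
  · rw [← aut_pow_toLinearMap, hσm]
    rfl

variable [LieAlgebra.IsKilling k 𝔤]

/-- Invariance of the Killing form under `σ i` gives `κ(x, y) = ζ^{l_i} κ(x, y)` for fixed `x` and
`y` of degree `l`. So the fixed algebra is orthogonal to every other joint eigenspace, and the form
remains nondegenerate on it. -/
theorem killingForm_eq_zero_of_fixed (ζ : CompatibleRoots k) (m : Fin n → ℕ+)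
    (σ : Fin n → (𝔤 ≃ₗ⁅k⁆ 𝔤)) (hσ : ∀ i j, σ i * σ j = σ j * σ i)
    (hσm : ∀ i, σ i ^ (m i : ℕ) = 1) {x : 𝔤} (hx : x ∈ fixed σ)
    (h : ∀ y ∈ fixed σ, killingForm k 𝔤 x y = 0) : x = 0 := by
  have h1 : x ∈ LinearMap.ker (killingForm k 𝔤) := by
    rw [LinearMap.mem_ker]
    ext y
    refine iSup_top_induction (iSup_eigenComp_eq_top ζ m σ hσ hσm)
      (p := fun y => killingForm k 𝔤 x y = 0) y (fun l y hy => ?_) (by simp)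
      fun u v hu hv => by rw [map_add, hu, hv, add_zero]
    by_cases hl : ∀ i, ζ.root (m i) ^ l i = 1
    · exact h y fun i => by rw [hy i, hl i, one_smul]
    · push Not at hl
      obtain ⟨i, hi⟩ := hl
      have h2 := LieAlgebra.killingForm_of_equiv_apply (R := k) (σ i) x y
      rw [hx i, hy i, map_smul, smul_eq_mul] at h2
      have h3 : (ζ.root (m i) ^ l i - 1) * killingForm k 𝔤 x y = 0 := by
        rw [sub_mul, h2, one_mul, sub_self]
      exact (mul_eq_zero.1 h3).resolve_left (sub_ne_zero.2 hi)
  rwa [LieAlgebra.IsKilling.ker_killingForm_eq_bot, Submodule.mem_bot] at h1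

/-- In the Fitting decomposition of `𝔤^σ` under `𝔥`, the null component is `𝔥` itself and is
orthogonal to the positive component, so an element of `𝔥` orthogonal to `𝔥` is orthogonal to all of
`𝔤^σ`. -/
theorem ker_traceForm_cartan (ζ : CompatibleRoots k) (m : Fin n → ℕ+)
    (σ : Fin n → (𝔤 ≃ₗ⁅k⁆ 𝔤)) (hσ : ∀ i j, σ i * σ j = σ j * σ i)
    (hσm : ∀ i, σ i ^ (m i : ℕ) = 1) (𝔥 : LieSubalgebra k (fixed σ)) [𝔥.IsCartanSubalgebra]
    {x : 𝔤} (hx : x ∈ ambient σ 𝔥) (h : ∀ y ∈ ambient σ 𝔥, killingForm k 𝔤 x y = 0) : x = 0 := by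
  obtain ⟨x, rfl⟩ := mem_ambient.1 hx
  refine killingForm_eq_zero_of_fixed ζ m σ hσ hσm x.1.2 fun y hy => ?_
  let B : LinearMap.BilinForm k (fixed σ) := (killingForm k 𝔤).restrict (fixed σ).toSubmodule
  have hcod := (LieModule.isCompl_genWeightSpace_zero_posFittingComp k 𝔥 (fixed σ)).codisjoint
  have hy' : (⟨y, hy⟩ : fixed σ) ∈ LieModule.genWeightSpace (fixed σ) (0 : 𝔥 → k) ⊔
      LieModule.posFittingComp k 𝔥 (fixed σ) := by
    rw [hcod.eq_top]
    exact LieSubmodule.mem_top _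
  obtain ⟨y₀, hy₀, y₁, hy₁, hyy⟩ := (LieSubmodule.mem_sup _ _ _).1 hy'
  have hz : ∀ z : fixed σ, z ∈ LieModule.genWeightSpace (fixed σ) (0 : 𝔥 → k) ↔ z ∈ 𝔥 := by
    intro z
    have := LieAlgebra.rootSpace_zero_eq k (fixed σ) 𝔥
    rw [← LieSubalgebra.mem_toLieSubmodule, ← this]
  have h0 : B x y₀ = 0 := h _ (mem_ambient.2 ⟨⟨y₀, (hz y₀).1 hy₀⟩, rfl⟩)
  have h1 : B x y₁ = 0 := by
    refine LieModule.eq_zero_of_mem_genWeightSpace_mem_posFitting k 𝔥 (fixed σ) (B := B) ?_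
      ((hz x).2 x.2) hy₁
    intro u v w
    exact LieModule.traceForm_apply_lie_apply' k 𝔤 𝔤 ((u : fixed σ) : 𝔤) v w
  have h2 : B x ⟨y, hy⟩ = 0 := by rw [← hyy, map_add, h0, h1, add_zero]
  exact h2

/-- The trace form of the nilpotent algebra `𝔥` on the module `𝔤` has trivial kernel, which forces
`𝔥` to be abelian. -/
theorem cartan_lie_eq_zero (ζ : CompatibleRoots k) (m : Fin n → ℕ+)
    (σ : Fin n → (𝔤 ≃ₗ⁅k⁆ 𝔤)) (hσ : ∀ i j, σ i * σ j = σ j * σ i)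
    (hσm : ∀ i, σ i ^ (m i : ℕ) = 1) (𝔥 : LieSubalgebra k (fixed σ)) [𝔥.IsCartanSubalgebra]
    {x y : 𝔤} (hx : x ∈ ambient σ 𝔥) (hy : y ∈ ambient σ 𝔥) : ⁅x, y⁆ = 0 := by
  obtain ⟨x, rfl⟩ := mem_ambient.1 hx
  obtain ⟨y, rfl⟩ := mem_ambient.1 hy
  have hab : IsLieAbelian 𝔥 := by
    refine LieModule.isLieAbelian_of_ker_traceForm_eq_bot k 𝔥 𝔤 ?_
    rw [LinearMap.ker_eq_bot']
    intro u hu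
    have := ker_traceForm_cartan ζ m σ hσ hσm 𝔥 (mem_ambient.2 ⟨u, rfl⟩) (by
      intro y hy
      obtain ⟨y, rfl⟩ := mem_ambient.1 hy
      exact LinearMap.congr_fun hu y)
    exact Subtype.ext (Subtype.ext this)
  have h := hab.trivial x y
  exact congrArg (fun z : 𝔥 => ((z : fixed σ) : 𝔤)) h

omit [IsAlgClosed k] [CharZero k] [FiniteDimensional k 𝔤] [LieAlgebra.IsKilling k 𝔤] in
theorem mem_cartan_of_lie (σ : Fin n → (𝔤 ≃ₗ⁅k⁆ 𝔤)) (𝔥 : LieSubalgebra k (fixed σ))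
    [h𝔥 : 𝔥.IsCartanSubalgebra] {x : 𝔤} (hx : x ∈ fixed σ)
    (h : ∀ y ∈ ambient σ 𝔥, ⁅y, x⁆ = 0) : x ∈ ambient σ 𝔥 := by
  have h1 : (⟨x, hx⟩ : fixed σ) ∈ 𝔥.normalizer := by
    rw [LieSubalgebra.mem_normalizer_iff]
    intro y hy
    have h2 : ⁅(⟨x, hx⟩ : fixed σ), y⁆ = 0 := by
      rw [← lie_skew, neg_eq_zero]
      exact Subtype.ext (h y (mem_ambient.2 ⟨⟨y, hy⟩, rfl⟩))
    rw [h2]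
    exact 𝔥.zero_mem
  rw [h𝔥.self_normalizing] at h1
  exact mem_ambient.2 ⟨⟨_, h1⟩, rfl⟩

/-- The semisimple part of `ad x` is `ad y` for some `y ∈ 𝔥`, and then `x - y` is ad-nilpotent and
orthogonal to the abelian algebra `𝔥`, hence zero. -/
theorem cartan_isSemisimple (ζ : CompatibleRoots k) (m : Fin n → ℕ+)
    (σ : Fin n → (𝔤 ≃ₗ⁅k⁆ 𝔤)) (hσ : ∀ i j, σ i * σ j = σ j * σ i)
    (hσm : ∀ i, σ i ^ (m i : ℕ) = 1) (𝔥 : LieSubalgebra k (fixed σ)) [𝔥.IsCartanSubalgebra]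
    {x : 𝔤} (hx : x ∈ ambient σ 𝔥) : (LieAlgebra.ad k 𝔤 x).IsSemisimple := by
  obtain ⟨N, hN₀, S, hS₀, hN, hS, hSN⟩ := (LieAlgebra.ad k 𝔤 x).exists_isNilpotent_isSemisimple
  have hcomm : ∀ T : Module.End k 𝔤, Commute T (LieAlgebra.ad k 𝔤 x) → Commute T S := fun T hT =>
    (Algebra.commute_of_mem_adjoin_singleton_of_commute hS₀ hT.symm.symm)
  have hS₁ : Commute (LieAlgebra.ad k 𝔤 x) S := Algebra.commute_of_mem_adjoin_self hS₀
  have hN' := hN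
  rw [eq_sub_of_add_eq hSN.symm] at hN'
  -- `S` acts by the scalar `c` on the generalized eigenspace of `ad x` for `c`. Since the bracket
  -- adds eigenvalues, `S` is a derivation, hence inner.
  have aux : ∀ (c : k) (y : 𝔤), y ∈ (LieAlgebra.ad k 𝔤 x).maxGenEigenspace c → S y = c • y := by
    intro c y hy
    rw [Module.End.maxGenEigenspace_eq] at hy
    exact Module.End.apply_eq_of_mem_of_comm_of_isFinitelySemisimple_of_isNil hy hS₁
      hS.isFinitelySemisimple hN'
  have htop := Module.End.iSup_maxGenEigenspace_eq_top (LieAlgebra.ad k 𝔤 x)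
  have hder : ∀ y z : 𝔤, S ⁅y, z⁆ = ⁅y, S z⁆ - ⁅z, S y⁆ := by
    intro y z
    refine iSup_top_induction htop (p := fun y => S ⁅y, z⁆ = ⁅y, S z⁆ - ⁅z, S y⁆) y
      (fun a y hy => ?_) (by simp) (fun u v hu hv => by
        simp only [add_lie, map_add, lie_add, hu, hv]; abel)
    refine iSup_top_induction htop (p := fun z => S ⁅y, z⁆ = ⁅y, S z⁆ - ⁅z, S y⁆) z
      (fun b z hz => ?_) (by simp) (fun u v hu hv => by
        simp only [add_lie, map_add, lie_add, hu, hv]; abel)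
    have hyz : ⁅y, z⁆ ∈ (LieAlgebra.ad k 𝔤 x).maxGenEigenspace (a + b) :=
      LieModule.lie_mem_maxGenEigenspace_toEnd (M := 𝔤) hy hz
    rw [aux _ _ hyz, aux _ _ hy, aux _ _ hz, lie_smul, lie_smul, ← lie_skew y z, add_smul,
      smul_neg, smul_neg]
    abel
  obtain ⟨y, hy⟩ := LieDerivation.IsKilling.exists_eq_ad (⟨S, hder⟩ : LieDerivation k 𝔤 𝔤)
  have hy : LieAlgebra.ad k 𝔤 y = S := by
    rw [← LieDerivation.coe_ad_apply_eq_ad_apply, hy]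
  have hadinj : ∀ z : 𝔤, LieAlgebra.ad k 𝔤 z = 0 → z = 0 := by
    intro z hz
    refine (LieDerivation.IsKilling.ad_apply_eq_zero_iff k 𝔤 z).1 (LieDerivation.ext fun w => ?_)
    rw [LieDerivation.ad_apply_apply]
    exact LinearMap.congr_fun hz w
  -- `S` is a polynomial in `ad x`, so it commutes with whatever commutes with `ad x`: first with `σ
  -- i`, then with `ad z` for `z ∈ 𝔥`. As `ad` is injective, `y` is fixed by `σ` and centralizes
  -- `𝔥`.
  have hyR : y ∈ fixed σ := by
    intro i
    have h1 := hcomm _ (lie_apply_commute (σ i) x ((mem_ambient.1 hx).choose_spec ▸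
      (mem_ambient.1 hx).choose.1.2 i))
    rw [← sub_eq_zero]
    refine hadinj _ ?_
    ext z
    have h2 : σ i (⁅y, (σ i).symm z⁆) = ⁅y, σ i ((σ i).symm z)⁆ := by
      have := LinearMap.congr_fun h1.eq ((σ i).symm z)
      rw [← hy] at this
      exact this
    rw [LieEquiv.map_lie, LieEquiv.apply_symm_apply] at h2
    simp [h2]
  have hyH : y ∈ ambient σ 𝔥 := by
    refine mem_cartan_of_lie σ 𝔥 hyR fun z hz => ?_
    have h2 := hcomm _ (commute_ad (cartan_lie_eq_zero ζ m σ hσ hσm 𝔥 hz hx))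
    rw [← hy] at h2
    refine hadinj _ (LinearMap.ext fun w => ?_)
    have h3 : ⁅z, ⁅y, w⁆⁆ = ⁅y, ⁅z, w⁆⁆ := LinearMap.congr_fun h2.eq w
    rw [leibniz_lie, add_eq_right] at h3
    exact h3
  -- The product of the nilpotent `ad (x - y)` with a commuting `ad z` is nilpotent, so its trace
  -- vanishes.
  have hxy : x - y = 0 := by
    refine ker_traceForm_cartan ζ m σ hσ hσm 𝔥 (Submodule.sub_mem _ hx hyH) fun z hz => ?_
    have h1 : LieAlgebra.ad k 𝔤 (x - y) = N := by
      rw [map_sub, hy, hSN, add_sub_cancel_right]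
    have h2 : Commute (LieAlgebra.ad k 𝔤 (x - y)) (LieAlgebra.ad k 𝔤 z) :=
      commute_ad (cartan_lie_eq_zero ζ m σ hσ hσm 𝔥 (Submodule.sub_mem _ hx hyH) hz)
    rw [_root_.killingForm_apply_apply, ← Module.End.mul_eq_comp]
    refine (LinearMap.isNilpotent_trace_of_isNilpotent (h2.isNilpotent_mul_right ?_)).eq_zero
    rwa [h1]
  rw [sub_eq_zero.1 hxy, hy]
  exact hS

theorem isToralCartan_ambient (ζ : CompatibleRoots k) (m : Fin n → ℕ+)
    (σ : Fin n → (𝔤 ≃ₗ⁅k⁆ 𝔤)) (hσ : ∀ i j, σ i * σ j = σ j * σ i)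
    (hσm : ∀ i, σ i ^ (m i : ℕ) = 1) (𝔥 : LieSubalgebra k (fixed σ)) [𝔥.IsCartanSubalgebra] :
    IsToralCartan (fixed σ) (ambient σ 𝔥) where
  le x hx := by
    obtain ⟨x, rfl⟩ := mem_ambient.1 hx
    exact x.1.2
  lie_eq_zero x hx y hy := cartan_lie_eq_zero ζ m σ hσ hσm 𝔥 hx hy
  mem_of_lie x hx h := mem_cartan_of_lie σ 𝔥 hx h
  isSemisimple h hh := cartan_isSemisimple ζ m σ hσ hσm 𝔥 hh

end Toral

/-! ### The Jacobian criterion and dominant polynomial maps -/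

section PolynomialMaps

open MvPolynomial

variable {k ι : Type*} [Field k] [Fintype ι]

/-- The chain rule. -/
theorem pderiv_aeval {κ : Type*} (P : ι → MvPolynomial κ k) (Q : MvPolynomial ι k) (i : κ) :
    pderiv i (aeval P Q) = ∑ j, aeval P (pderiv j Q) * pderiv i (P j) := by
  classical
  induction Q using MvPolynomial.induction_on with
  | C a => simp [MvPolynomial.algebraMap_eq]
  | add p q hp hq => simp only [map_add, hp, hq, add_mul, Finset.sum_add_distrib]
  | mul_X p j hp =>
    simp only [map_mul, aeval_X, pderiv_mul, hp, pderiv_X, map_add, add_mul,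
      Finset.sum_add_distrib]
    congr 1
    · rw [Finset.sum_mul]
      exact Finset.sum_congr rfl fun l _ => by ring
    · rw [Finset.sum_eq_single j]
      · simp
      · intro l _ hl
        simp [Pi.single_eq_of_ne hl.symm]
      · simp

theorem totalDegree_pderiv_le {κ : Type*} (Q : MvPolynomial κ k) (i : κ) {d : ℕ}
    (h : Q.totalDegree ≤ d + 1) : (pderiv i Q).totalDegree ≤ d := by
  classical
  refine Finset.sup_le fun s hs => ?_
  rw [mem_support_iff, coeff_pderiv] at hs
  have h1 : s + Finsupp.single i 1 ∈ Q.support := by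
    rw [mem_support_iff]
    intro h0
    rw [h0, zero_mul] at hs
    exact hs rfl
  have h2 := (le_totalDegree h1).trans h
  rw [Finsupp.sum_add_index' (by simp) (by simp), Finsupp.sum_single_index rfl] at h2
  omega

theorem eq_C_of_pderiv_eq_zero [CharZero k] {κ : Type*} (Q : MvPolynomial κ k)
    (h : ∀ i, pderiv i Q = 0) : Q = C (coeff 0 Q) := by
  classical
  ext s
  rw [coeff_C]
  split_ifs with hs
  · rw [hs]
  · obtain ⟨i, hi⟩ : ∃ i, s i ≠ 0 := by
      by_contra! h0
      exact hs (Finsupp.ext fun i => (h0 i).symm)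
    have h1 := congrArg (coeff (s - Finsupp.single i 1)) (h i)
    have h2 : Finsupp.single i 1 ≤ s := by
      rw [Finsupp.single_le_iff]
      omega
    rw [coeff_pderiv, tsub_add_cancel_of_le h2, coeff_zero] at h1
    refine (mul_eq_zero.1 h1).resolve_right ?_
    exact Nat.cast_add_one_ne_zero _

/-- Differentiating a relation `Q(P) = 0` gives `J · (∂_j Q)(P) = 0` with `det J ≠ 0`, so every `∂_j
Q` is again a relation, of smaller degree. By induction all of them vanish; in characteristic zero
`Q` is then constant, hence zero. -/
theorem algebraicIndependent_of_det_pderiv_ne_zero [CharZero k] [DecidableEq ι]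
    (P : ι → MvPolynomial ι k) (x : ι → k)
    (h : (Matrix.of fun i j => eval x (pderiv i (P j))).det ≠ 0) : AlgebraicIndependent k P := by
  let J : Matrix ι ι (MvPolynomial ι k) := Matrix.of fun i j => pderiv i (P j)
  have hJ : J.det ≠ 0 := by
    intro h0
    refine h ?_
    have := congrArg (eval x) h0
    rw [RingHom.map_det, map_zero] at this
    exact this
  have key : ∀ d, ∀ Q : MvPolynomial ι k, Q.totalDegree ≤ d → aeval P Q = 0 → Q = 0 := by
    have hconst : ∀ Q : MvPolynomial ι k, Q = C (coeff 0 Q) → aeval P Q = 0 → Q = 0 := by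
      intro Q hQ h0
      rw [hQ, aeval_C, MvPolynomial.algebraMap_eq] at h0
      rw [hQ, h0]
    intro d
    induction d with
    | zero =>
      intro Q hQ h0
      exact hconst Q (totalDegree_eq_zero_iff_eq_C.1 (Nat.le_zero.1 hQ)) h0
    | succ d ih =>
      intro Q hQ h0
      refine hconst Q (eq_C_of_pderiv_eq_zero Q fun j => ?_) h0
      refine ih _ (totalDegree_pderiv_le Q j hQ) ?_
      have h1 : J.mulVec (fun j => aeval P (pderiv j Q)) = 0 := by
        ext1 i
        have := pderiv_aeval P Q i
        rw [h0, map_zero] at this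
        simp only [Matrix.mulVec, dotProduct, J, Matrix.of_apply, Pi.zero_apply]
        rw [this]
        exact Finset.sum_congr rfl fun j _ => mul_comm _ _
      exact congrFun (Matrix.eq_zero_of_mulVec_eq_zero hJ h1) j
  rw [algebraicIndependent_iff]
  exact fun Q hQ => key _ Q le_rfl hQ

/-- A dominant polynomial self-map of affine space has an image containing a principal open set. -/
theorem exists_open_subset_range [IsAlgClosed k] (P : ι → MvPolynomial ι k)
    (hP : AlgebraicIndependent k P) :
    ∃ f : MvPolynomial ι k, f ≠ 0 ∧ ∀ y : ι → k, eval y f ≠ 0 → ∃ x, ∀ j, eval x (P j) = y j := by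
  classical
  -- As many independent elements as the transcendence degree; hence the polynomial ring is
  -- algebraic over `A = k[P]`.
  have hbasis : IsTranscendenceBasis k P :=
    hP.isTranscendenceBasis_of_lift_trdeg_le_of_finite (by simp)
  have halg := hbasis.isAlgebraic
  set A := Algebra.adjoin k (Set.range P) with hA
  -- `f` is a common denominator making every variable integral over `A`, so each polynomial becomes
  -- integral after multiplication by a power of `f`. Its nonvanishing locus is the required open
  -- set.
  obtain ⟨f, hf0, hf⟩ := Algebra.IsAlgebraic.exists_integral_multiples (R := A)
    (A := MvPolynomial ι k) (Finset.univ.image X)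
  have hint : ∀ b : MvPolynomial ι k, ∃ e : ℕ, IsIntegral A (f ^ e • b) := by
    intro b
    induction b using MvPolynomial.induction_on with
    | C a =>
      refine ⟨0, ?_⟩
      rw [pow_zero, one_smul]
      exact isIntegral_algebraMap (R := A) (x := algebraMap k A a)
    | add p q hp hq =>
      obtain ⟨a, ha⟩ := hp
      obtain ⟨b, hb⟩ := hq
      refine ⟨a + b, ?_⟩
      have h1 : f ^ (a + b) • (p + q) = f ^ b • (f ^ a • p) + f ^ a • (f ^ b • q) := by
        rw [smul_add, smul_smul, smul_smul, ← pow_add, ← pow_add, add_comm b a]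
      rw [h1]
      exact (ha.smul _).add (hb.smul _)
    | mul_X p i hp =>
      obtain ⟨a, ha⟩ := hp
      refine ⟨a + 1, ?_⟩
      have h1 : f ^ (a + 1) • (p * X i) = (f ^ a • p) * (f • X i) := by
        rw [smul_mul_smul_comm, pow_succ]
      rw [h1]
      exact ha.mul (hf _ (Finset.mem_image_of_mem _ (Finset.mem_univ _)))
  refine ⟨hP.aevalEquiv.symm f, fun h => hf0 ?_, fun y hy => ?_⟩
  · simpa using h
  by_contra hno
  let ev : A →+* k := (eval y).comp (hP.aevalEquiv.symm : A →+* MvPolynomial ι k)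
  let I : Ideal (MvPolynomial ι k) := Ideal.span (Set.range fun j => P j - C (y j))
  -- Nullstellensatz: a proper ideal containing all `P j - y j` would have a zero, which is a
  -- preimage of `y`.
  have hI : I = ⊤ := by
    by_contra hI
    obtain ⟨J, hJ, hIJ⟩ := Ideal.exists_le_maximal I hI
    obtain ⟨x, rfl⟩ := isMaximal_iff_eq_vanishingIdeal_singleton.1 hJ
    refine hno ⟨x, fun j => ?_⟩
    have h1 := hIJ (Ideal.subset_span ⟨j, rfl⟩)
    rw [mem_vanishingIdeal_singleton_iff] at h1
    simpa [sub_eq_zero] using h1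
  have h1 : (1 : MvPolynomial ι k) ∈ I := hI ▸ Submodule.mem_top
  obtain ⟨b, hb⟩ := (Ideal.mem_span_range_iff_exists_fun).1 h1
  choose e he using fun j => hint (b j)
  let E := ∑ j, e j
  have he' : ∀ j, IsIntegral A (f ^ E • b j) := by
    intro j
    have h2 : E = (E - e j) + e j :=
      (Nat.sub_add_cancel (Finset.single_le_sum (fun _ _ => Nat.zero_le _) (Finset.mem_univ j))).symm
    rw [h2, pow_add, mul_smul]
    exact (he j).smul _
  let p : Ideal A := RingHom.ker ev
  have hp : p.IsPrime := RingHom.ker_isPrime ev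
  -- Lying over in the integral closure of `A`: a prime `Q` above the kernel `p` of evaluation at
  -- `y`. Multiplying `1 = ∑ b j (P j - y j)` by `f ^ E` gives an identity inside the integral
  -- closure, whose right side lies in `Q`. So `f ^ E ∈ p`, that is, `f` vanishes at `y`.
  obtain ⟨Q, -, hQ, hQp⟩ := Ideal.exists_ideal_over_prime_of_isIntegral
    (S := integralClosure A (MvPolynomial ι k)) p ⊥ (by
      rw [← RingHom.ker_eq_comap_bot]
      intro a ha
      have h2 : (algebraMap A (integralClosure A (MvPolynomial ι k)) a : MvPolynomial ι k) = 0 := by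
        rw [RingHom.mem_ker.1 ha]
        rfl
      have h3 : a = 0 := Subtype.ext h2
      rw [h3]
      exact p.zero_mem)
  have hfE : f ^ E ∈ p := by
    rw [← hQp, Ideal.mem_comap]
    let c : ι → integralClosure A (MvPolynomial ι k) := fun j => ⟨f ^ E • b j, he' j⟩
    let a : ι → A := fun j => ⟨P j, Algebra.subset_adjoin ⟨j, rfl⟩⟩ - algebraMap k A (y j)
    have ha : ∀ j, a j ∈ p := by
      intro j
      have h2 : (⟨P j, Algebra.subset_adjoin ⟨j, rfl⟩⟩ : A) = hP.aevalEquiv (X j) := by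
        apply Subtype.ext
        have := hP.algebraMap_aevalEquiv (X j)
        rw [aeval_X] at this
        exact this.symm
      change ev (a j) = 0
      simp only [a, ev, h2, map_sub, RingHom.comp_apply]
      have h3 : hP.aevalEquiv.symm (algebraMap k A (y j)) = C (y j) := by
        rw [AlgEquiv.commutes]
        rfl
      simp [h3]
    have hsum : algebraMap A (integralClosure A (MvPolynomial ι k)) (f ^ E) =
        ∑ j, c j * algebraMap A (integralClosure A (MvPolynomial ι k)) (a j) := by
      apply Subtype.ext
      have h2 : ((∑ j, c j * algebraMap A (integralClosure A (MvPolynomial ι k)) (a j) :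
          integralClosure A (MvPolynomial ι k)) : MvPolynomial ι k) =
          ∑ j, (f ^ E • b j) * (P j - C (y j)) := by
        rw [AddSubmonoidClass.coe_finsetSum]
        rfl
      rw [h2]
      simp only [smul_mul_assoc, ← Finset.smul_sum]
      rw [hb, Algebra.smul_def, mul_one]
      rfl
    rw [hsum]
    refine Q.sum_mem fun j _ => Q.mul_mem_left _ ?_
    rw [← Ideal.mem_comap, hQp]
    exact ha j
  exact hy (hp.mem_of_pow_mem _ hfE)

end PolynomialMaps

/-! ### Vector-valued polynomial maps and their derivatives along coordinate lines -/

section PolyMap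

variable {k : Type*} [Field k] {ι V W : Type*} [AddCommGroup V] [Module k V]
  [AddCommGroup W] [Module k W]

/-- A map from affine space to a vector space all of whose coordinates are polynomials. -/
def IsPolyMap (F : (ι → k) → V) : Prop :=
  ∀ φ : Module.Dual k V, ∃ P : MvPolynomial ι k, ∀ x, MvPolynomial.eval x P = φ (F x)

namespace IsPolyMap

theorem const (v : V) : IsPolyMap fun _ : ι → k => v :=
  fun φ => ⟨MvPolynomial.C (φ v), fun x => by simp⟩

theorem sum {κ : Type*} (s : Finset κ) {F : κ → (ι → k) → V} (hF : ∀ i, IsPolyMap (F i)) :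
    IsPolyMap fun x => ∑ i ∈ s, F i x := by
  intro φ
  choose P hP using fun i => hF i φ
  exact ⟨∑ i ∈ s, P i, fun x => by simp [hP]⟩

theorem smul {F : (ι → k) → V} (hF : IsPolyMap F) (Q : MvPolynomial ι k) :
    IsPolyMap fun x => MvPolynomial.eval x Q • F x := by
  intro φ
  obtain ⟨P, hP⟩ := hF φ
  exact ⟨Q * P, fun x => by simp [hP]⟩

theorem map {F : (ι → k) → V} (hF : IsPolyMap F) (T : V →ₗ[k] W) : IsPolyMap fun x => T (F x) :=
  fun φ => hF (φ.comp T)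

theorem of_subtype {p : Submodule k V} {F : (ι → k) → p} (hF : IsPolyMap fun x => (F x : V)) :
    IsPolyMap F := by
  intro φ
  obtain ⟨ψ, hψ⟩ := LinearMap.exists_extend φ
  obtain ⟨P, hP⟩ := hF ψ
  refine ⟨P, fun x => ?_⟩
  rw [hP, ← hψ]
  rfl

end IsPolyMap

/-- A partial derivative is the linear coefficient of the restriction to a coordinate line.
Derivatives of products of exponentials can thus be read off where all but one factor is trivial. -/
theorem coeff_one_eq_eval_pderiv [Infinite k] [DecidableEq ι] (P : MvPolynomial ι k) (x : ι → k)
    (i : ι) (p : Polynomial k)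
    (h : ∀ ε, p.eval ε = MvPolynomial.eval (x + ε • Pi.single i 1) P) :
    MvPolynomial.eval x (MvPolynomial.pderiv i P) = p.coeff 1 := by
  let l : ι → Polynomial k := fun j =>
    Polynomial.C (x j) + Polynomial.X * Polynomial.C (Pi.single i (1 : k) j)
  have h1 : ∀ (Q : MvPolynomial ι k) (ε : k), (MvPolynomial.aeval l Q).eval ε =
      MvPolynomial.eval (x + ε • Pi.single i 1) Q := by
    intro Q ε
    induction Q using MvPolynomial.induction_on with
    | C a => simp
    | add p q hp hq => simp [hp, hq]
    | mul_X p j hp =>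
      rw [map_mul, Polynomial.eval_mul, hp, MvPolynomial.aeval_X, map_mul, MvPolynomial.eval_X]
      simp only [l, Polynomial.eval_add, Polynomial.eval_C, Polynomial.eval_mul, Polynomial.eval_X,
        Pi.add_apply, Pi.smul_apply, smul_eq_mul]
  have h2 : p = MvPolynomial.aeval l P := Polynomial.funext fun ε => by rw [h, h1]
  have h3 : ∀ Q : MvPolynomial ι k, (Polynomial.derivative (MvPolynomial.aeval l Q)).eval 0 =
      MvPolynomial.eval x (MvPolynomial.pderiv i Q) := by
    intro Q
    induction Q using MvPolynomial.induction_on with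
    | C a => simp
    | add p q hp hq => simp [hp, hq]
    | mul_X p j hp =>
      have h4 := h1 p 0
      rw [zero_smul, add_zero] at h4
      rw [map_mul, Polynomial.derivative_mul, Polynomial.eval_add, Polynomial.eval_mul, hp,
        Polynomial.eval_mul, h4, MvPolynomial.pderiv_mul]
      by_cases hij : j = i
      · subst hij
        simp [l]
      · simp [l, hij, MvPolynomial.pderiv_X_of_ne hij]
  rw [← h3, ← h2, ← Polynomial.coeff_zero_eq_eval_zero, Polynomial.coeff_derivative]
  simp

/-- Here `D i` is the derivative of `F` at `x` in direction `i`. The Jacobian in the coordinates of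
`b` is the transposed change-of-basis matrix from `D` to `b`, which is invertible. -/
theorem IsPolyMap.exists_algebraicIndependent [CharZero k] [Fintype ι] [DecidableEq ι]
    {F : (ι → k) → V} (hF : IsPolyMap F) (b : Module.Basis ι k V) (x : ι → k)
    (D : Module.Basis ι k V)
    (hD : ∀ i, ∀ φ : Module.Dual k V, ∃ p : Polynomial k,
      (∀ ε, p.eval ε = φ (F (x + ε • Pi.single i 1))) ∧ p.coeff 1 = φ (D i)) :
    ∃ P : ι → MvPolynomial ι k, AlgebraicIndependent k P ∧
      ∀ y j, MvPolynomial.eval y (P j) = b.repr (F y) j := by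
  choose P hP using fun j => hF (b.coord j)
  refine ⟨P, ?_, fun y j => hP j y⟩
  refine algebraicIndependent_of_det_pderiv_ne_zero P x ?_
  have h1 : (Matrix.of fun i j => MvPolynomial.eval x (MvPolynomial.pderiv i (P j))) =
      (b.toMatrix D).transpose := by
    ext i j
    obtain ⟨p, hp, hp1⟩ := hD i (b.coord j)
    rw [Matrix.of_apply, Matrix.transpose_apply, Module.Basis.toMatrix_apply,
      coeff_one_eq_eval_pderiv (P j) x i p (fun ε => by rw [hp, hP]), hp1]
    rfl
  rw [h1, Matrix.det_transpose]
  exact (b.isUnit_det D).ne_zero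

theorem exists_eval_ne_zero [Infinite k] (P : MvPolynomial ι k) (hP : P ≠ 0) :
    ∃ x, MvPolynomial.eval x P ≠ 0 := by
  by_contra! h
  exact hP (MvPolynomial.funext fun x => by rw [h, map_zero])

end PolyMap

/-! ### Exponentials of ad-nilpotent fixed elements -/

section Exponential

variable {k : Type*} [Field k] [CharZero k] {𝔤 : Type*} [LieRing 𝔤] [LieAlgebra k 𝔤] {n : ℕ}

/-- A nonzero power `(ad e)^N` is an eigenvector of commutation with `ad h` for the eigenvalue `N
c`. In characteristic zero these are pairwise distinct, so only finitely many powers are nonzero. -/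
theorem isNilpotent_ad_of_lie_eq_smul [FiniteDimensional k 𝔤] {h e : 𝔤} {c : k} (hc : c ≠ 0)
    (he : ⁅h, e⁆ = c • e) : IsNilpotent (LieAlgebra.ad k 𝔤 e) := by
  let A := LieAlgebra.ad k 𝔤 h
  let T := LieAlgebra.ad k 𝔤 e
  have h1 : A * T = T * A + c • T := by
    ext x
    change ⁅h, ⁅e, x⁆⁆ = ⁅e, ⁅h, x⁆⁆ + c • ⁅e, x⁆
    rw [leibniz_lie, he, smul_lie, add_comm]
  have h2 : ∀ N : ℕ, A * T ^ N = T ^ N * A + (N * c) • T ^ N := by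
    intro N
    induction N with
    | zero => simp
    | succ N ih =>
      rw [pow_succ, ← mul_assoc, ih, add_mul, mul_assoc, h1, mul_add, ← mul_assoc, smul_mul_assoc,
        mul_smul_comm, add_assoc, ← add_smul]
      congr 2
      push_cast
      ring
  by_contra hT
  have hT' : ∀ N, T ^ N ≠ 0 := fun N hN => hT ⟨N, hN⟩
  let f : Module.End k (Module.End k 𝔤) := LinearMap.mulLeft k A - LinearMap.mulRight k A
  have h3 : ∀ N : ℕ, f.HasEigenvalue (N * c) := by
    intro N
    refine Module.End.hasEigenvalue_of_hasEigenvector (x := T ^ N) ⟨?_, hT' N⟩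
    rw [Module.End.mem_eigenspace_iff]
    change A * T ^ N - T ^ N * A = _
    rw [h2, add_sub_cancel_left]
  refine Set.infinite_of_injective_forall_mem (f := fun N : ℕ => (N * c : k)) ?_ h3
    (Module.End.finite_hasEigenvalue f)
  intro a b hab
  exact_mod_cast mul_right_cancel₀ hc hab

theorem exists_exp (e : 𝔤) (he : IsNilpotent (LieAlgebra.ad k 𝔤 e)) :
    ∃ ψ : 𝔤 ≃ₗ⁅k⁆ 𝔤, ∀ K, (LieAlgebra.ad k 𝔤 e) ^ K = 0 → ∀ x,
      ψ x = ∑ i ∈ Finset.range K, ((i.factorial : k)⁻¹) • ((LieAlgebra.ad k 𝔤 e) ^ i) x := by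
  let _ : Algebra ℚ k := DivisionRing.toRatAlgebra
  let _ : Module ℚ 𝔤 := Module.compHom 𝔤 (algebraMap ℚ k)
  let _ : LieAlgebra ℚ 𝔤 := { lie_smul := fun t x y => lie_smul (algebraMap ℚ k t) x y }
  have h1 : (LieDerivation.ad k 𝔤 e).toLinearMap = LieAlgebra.ad k 𝔤 e :=
    LieDerivation.coe_ad_apply_eq_ad_apply e
  refine ⟨LieDerivation.exp (LieDerivation.ad k 𝔤 e) (h1.symm ▸ he), fun K hK x => ?_⟩
  rw [LieDerivation.exp_map_apply]
  rw [h1, IsNilpotent.exp_eq_sum hK, LinearMap.sum_apply]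
  refine Finset.sum_congr rfl fun i _ => ?_
  rw [LinearMap.smul_apply]
  change algebraMap ℚ k ((i.factorial : ℚ)⁻¹) • ((LieAlgebra.ad k 𝔤 e) ^ i) x = _
  simp

/-- The automorphisms commuting with the tuple `σ`. -/
def autCentralizer (σ : Fin n → (𝔤 ≃ₗ⁅k⁆ 𝔤)) : Subgroup (𝔤 ≃ₗ⁅k⁆ 𝔤) :=
  Subgroup.centralizer (Set.range σ)

omit [CharZero k] in
theorem mem_autCentralizer {σ : Fin n → (𝔤 ≃ₗ⁅k⁆ 𝔤)} {ψ : 𝔤 ≃ₗ⁅k⁆ 𝔤} :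
    ψ ∈ autCentralizer σ ↔ ∀ i x, σ i (ψ x) = ψ (σ i x) := by
  rw [autCentralizer, Subgroup.mem_centralizer_iff]
  constructor
  · exact fun h i x => aut_commute (h _ ⟨i, rfl⟩) x
  · rintro h _ ⟨i, rfl⟩
    exact LieEquiv.ext fun x => h i x

omit [CharZero k] in
theorem map_mem_fixed {σ : Fin n → (𝔤 ≃ₗ⁅k⁆ 𝔤)} {ψ : 𝔤 ≃ₗ⁅k⁆ 𝔤} (hψ : ψ ∈ autCentralizer σ)
    {x : 𝔤} (hx : x ∈ fixed σ) : ψ x ∈ fixed σ := by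
  intro i
  rw [mem_autCentralizer.1 hψ, hx i]

theorem exists_oneParameter (σ : Fin n → (𝔤 ≃ₗ⁅k⁆ 𝔤)) {e : 𝔤} (he : IsNilpotent (LieAlgebra.ad k 𝔤 e))
    (heσ : e ∈ fixed σ) :
    ∃ (E : k → 𝔤 ≃ₗ⁅k⁆ 𝔤) (K : ℕ), (∀ t, E t ∈ autCentralizer σ) ∧ ∀ t x,
      E t x = ∑ i ∈ Finset.range (K + 2),
        t ^ i • ((i.factorial : k)⁻¹ • ((LieAlgebra.ad k 𝔤 e) ^ i) x) := by
  obtain ⟨K, hK⟩ := id he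
  -- Two extra terms guarantee that index `1`, which carries the derivative at `t = 0`, always
  -- occurs in the sum.
  have hK2 : (LieAlgebra.ad k 𝔤 e) ^ (K + 2) = 0 := pow_eq_zero_of_le (by omega) hK
  have h1 : ∀ t : k, ∀ i : ℕ, (LieAlgebra.ad k 𝔤 (t • e)) ^ i = t ^ i • (LieAlgebra.ad k 𝔤 e) ^ i :=
    fun t i => by rw [map_smul, smul_pow]
  have h2 : ∀ t : k, IsNilpotent (LieAlgebra.ad k 𝔤 (t • e)) := fun t => ⟨K, by
    rw [h1, hK, smul_zero]⟩
  choose E hE using fun t => exists_exp (t • e) (h2 t)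
  have hE' : ∀ t x, E t x = ∑ i ∈ Finset.range (K + 2),
        t ^ i • ((i.factorial : k)⁻¹ • ((LieAlgebra.ad k 𝔤 e) ^ i) x) := by
    intro t x
    rw [hE t (K + 2) (by rw [h1, hK2, smul_zero])]
    refine Finset.sum_congr rfl fun i _ => ?_
    rw [h1, LinearMap.smul_apply, smul_comm]
  refine ⟨E, K, fun t => mem_autCentralizer.2 fun i x => ?_, hE'⟩
  rw [hE', hE', map_sum]
  refine Finset.sum_congr rfl fun j _ => ?_
  rw [map_smul, map_smul]
  congr 2
  have := (lie_apply_commute (σ i) e (heσ i)).pow_right j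
  exact LinearMap.congr_fun this.eq x

end Exponential

/-! ### Conjugacy of toral self-centralizing subspaces -/

section Conjugacy

variable {k : Type*} [Field k] {𝔤 : Type*} [LieRing 𝔤] [LieAlgebra k 𝔤]
  [FiniteDimensional k 𝔤] {n : ℕ}

theorem IsToralCartan.exists_weight_basis [IsAlgClosed k] {R : LieSubalgebra k 𝔤}
    {H : Submodule k 𝔤} (hH : IsToralCartan R H) :
    ∃ (b : Module.Basis (Fin (Module.finrank k R)) k R)
      (β : Fin (Module.finrank k R) → Module.Dual k H),
      ∀ i (h : H), ⁅(h : 𝔤), (b i : 𝔤)⁆ = β i h • (b i : 𝔤) := by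
  let S : Set R := {x | ∃ χ : H → k, ∀ h : H, ⁅(h : 𝔤), (x : 𝔤)⁆ = χ h • (x : 𝔤)}
  have h1 := le_iSup_inf_eigenspace (fun h : H => LieAlgebra.ad k 𝔤 h)
    (fun h h' => commute_ad (hH.lie_eq_zero _ h.2 _ h'.2)) (fun h => hH.isSemisimple _ h.2)
    R.toSubmodule (fun h x hx => R.lie_mem (hH.le _ h.2) hx)
  have hS : (⊤ : Submodule k R) ≤ Submodule.span k S := by
    intro x _
    have h2 : (⨆ χ : H → k, R.toSubmodule ⊓ ⨅ h : H, (LieAlgebra.ad k 𝔤 h).eigenspace (χ h)) ≤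
        (Submodule.span k S).map R.toSubmodule.subtype := by
      refine iSup_le fun χ y hy => ⟨⟨y, hy.1⟩, Submodule.subset_span ⟨χ, fun h => ?_⟩, rfl⟩
      exact Module.End.mem_eigenspace_iff.1 ((Submodule.mem_iInf _).1 hy.2 h)
    obtain ⟨y, hy, hyx⟩ := h2 (h1 x.2)
    rwa [← Subtype.ext hyx]
  let b₀ := Module.Basis.ofSpan hS
  have hb₀ : ∀ i, b₀ i ∈ S := fun i => Module.Basis.ofSpan_subset hS ⟨i, rfl⟩
  let b := b₀.reindex (b₀.indexEquiv (Module.finBasis k R))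
  have hb : ∀ i, b i ∈ S := fun i => by
    rw [Module.Basis.reindex_apply]
    exact hb₀ _
  let ι : H →ₗ[k] R := Submodule.inclusion (p' := R.toSubmodule) hH.le
  -- The weight of `b i` is written as the `i`-th coordinate of `⁅h, b i⁆`, which makes its
  -- linearity in `h` evident.
  refine ⟨b, fun i => (b.coord i).comp
    ((((LieAlgebra.ad k R : R →ₗ[k] Module.End k R).flip (b i))).comp ι), fun i h => ?_⟩
  obtain ⟨χ, hχ⟩ := hb i
  have h2 : ⁅ι h, b i⁆ = χ h • b i := Subtype.ext (hχ h)
  have h3 : (b.coord i) ⁅ι h, b i⁆ = χ h := by rw [h2]; simp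
  rw [hχ]
  congr 1
  exact h3.symm

/-- For a weight basis `b` of `𝔤^σ`, consider the map `x ↦ ∏ exp(x_i ad b_i) (∑ x_i b_i)`, where the
product runs over nonzero weights and the sum over zero weights. It takes values in the conjugates
of `H` and has invertible derivative at a regular element of `H`, so its coordinates `P` are
algebraically independent. The polynomial `r` is the product of the nonzero weights at `∑ x_i b_i`;
where it does not vanish, that element is regular and its centralizer in `𝔤^σ` lies in `H`. -/
theorem exists_conjugates_algebraicIndependent [IsAlgClosed k] [CharZero k]
    {σ : Fin n → (𝔤 ≃ₗ⁅k⁆ 𝔤)} {H : Submodule k 𝔤} (hH : IsToralCartan (fixed σ) H)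
    (b₀ : Module.Basis (Fin (Module.finrank k (fixed σ))) k (fixed σ)) :
    ∃ P : Fin (Module.finrank k (fixed σ)) → MvPolynomial (Fin (Module.finrank k (fixed σ))) k,
      AlgebraicIndependent k P ∧ ∃ r : MvPolynomial (Fin (Module.finrank k (fixed σ))) k, r ≠ 0 ∧
        ∀ x, ∃ ψ ∈ autCentralizer σ, ∃ h ∈ H, ∃ v : fixed σ, (v : 𝔤) = ψ h ∧
          (∀ j, MvPolynomial.eval x (P j) = b₀.repr v j) ∧
          (MvPolynomial.eval x r ≠ 0 → ∀ y ∈ fixed σ, ⁅h, y⁆ = 0 → y ∈ H) := by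
  classical
  obtain ⟨b, β, hβ⟩ := hH.exists_weight_basis
  have hrepr : ∀ (h : H) (y : fixed σ),
      (⁅(h : 𝔤), (y : 𝔤)⁆ = ∑ i, (b.repr y i * β i h) • (b i : 𝔤)) := by
    intro h y
    conv_lhs => rw [← b.sum_repr y]
    rw [AddSubmonoidClass.coe_finsetSum, lie_sum]
    refine Finset.sum_congr rfl fun i _ => ?_
    change ⁅(h : 𝔤), b.repr y i • (b i : 𝔤)⁆ = _
    rw [lie_smul, hβ, smul_smul]
  have hcentr : ∀ (h : H) (y : fixed σ), ⁅(h : 𝔤), (y : 𝔤)⁆ = 0 → ∀ i, β i h ≠ 0 →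
      b.repr y i = 0 := by
    intro h y hy i hi
    rw [hrepr] at hy
    have h1 : ∑ i, (b.repr y i * β i h) • b i = 0 := by
      refine Subtype.ext ?_
      rw [AddSubmonoidClass.coe_finsetSum]
      exact hy
    have h2 := Fintype.linearIndependent_iff.1 b.linearIndependent _ h1 i
    exact (mul_eq_zero.1 h2).resolve_right hi
  have hbH : ∀ i, β i = 0 → (b i : 𝔤) ∈ H := fun i hi =>
    hH.mem_of_lie _ (b i).2 fun h hh => by rw [hβ i ⟨h, hh⟩, hi]; simp
  -- Vectors of weight zero lie in `H` since `H` is self-centralizing. Setting `g i = 0` for the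
  -- other indices, and later `E i = 1` for weight zero, lets one tuple `x` serve both as
  -- exponential parameters and as coordinates on `H`.
  let g : Fin (Module.finrank k (fixed σ)) → H := fun i =>
    if hi : β i = 0 then ⟨b i, hbH i hi⟩ else 0
  have hg : ∀ i, β i = 0 → (g i : 𝔤) = b i := fun i hi => by simp [g, hi]
  have hg' : ∀ i, β i ≠ 0 → g i = 0 := fun i hi => by simp [g, hi]
  -- A regular element: no nonzero weight vanishes at `h₀`. Its coordinates `x₀` vanish at nonzero
  -- weights, so all exponentials are trivial at `x₀`.
  obtain ⟨h₀, hh₀⟩ := Module.Dual.exists_forall_ne_zero_of_forall_exists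
    (fun i : {i // β i ≠ 0} => β i) (fun i => by
      by_contra! h
      exact i.2 (LinearMap.ext h))
  let x₀ : Fin (Module.finrank k (fixed σ)) → k := fun i => b.repr ⟨h₀, hH.le _ h₀.2⟩ i
  have hx₀ : ∀ i, β i ≠ 0 → x₀ i = 0 := fun i hi =>
    hcentr h₀ ⟨h₀, hH.le _ h₀.2⟩ (lie_self _) i (hh₀ ⟨i, hi⟩)
  have hsum₀ : ∑ i, x₀ i • g i = h₀ := by
    refine Subtype.ext ?_
    have h1 := congrArg (fun v : fixed σ => (v : 𝔤)) (b.sum_repr ⟨h₀, hH.le _ h₀.2⟩)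
    simp only [AddSubmonoidClass.coe_finsetSum] at h1
    rw [Submodule.coe_sum]
    refine Eq.trans (Finset.sum_congr rfl fun i _ => ?_) h1
    by_cases hi : β i = 0
    · rw [Submodule.coe_smul, hg i hi]; rfl
    · rw [hx₀ i hi, zero_smul]
      have : b.repr ⟨h₀, hH.le _ h₀.2⟩ i = 0 := hx₀ i hi
      rw [this, zero_smul]
      rfl
  have hE : ∀ i, ∃ (E : k → 𝔤 ≃ₗ⁅k⁆ 𝔤) (K : ℕ) (A : ℕ → Module.End k 𝔤),
      (∀ t, E t ∈ autCentralizer σ) ∧ (∀ t x, E t x = ∑ j ∈ Finset.range (K + 2), t ^ j • A j x) ∧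
      A 0 = 1 ∧ A 1 = (if β i = 0 then 0 else LieAlgebra.ad k 𝔤 (b i)) ∧
      (β i = 0 → ∀ t, E t = 1) := by
    intro i
    by_cases hi : β i = 0
    · refine ⟨fun _ => 1, 0, fun j => if j = 0 then 1 else 0, fun t => one_mem _, fun t x => ?_,
        rfl, by simp [hi], fun _ _ => rfl⟩
      simp [Finset.sum_range_succ]
    · obtain ⟨h, hh⟩ : ∃ h, β i h ≠ 0 := by
        by_contra! h
        exact hi (LinearMap.ext h)
      obtain ⟨E, K, hE1, hE2⟩ := exists_oneParameter σ
        (isNilpotent_ad_of_lie_eq_smul hh (hβ i h)) (b i).2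
      exact ⟨E, K, fun j => (j.factorial : k)⁻¹ • (LieAlgebra.ad k 𝔤 (b i)) ^ j, hE1, hE2,
        by simp, by simp [hi], fun h => (hi h).elim⟩
  choose E K A hEσ hEA hA0 hA1 hE1 using hE
  have hE0 : ∀ i, E i 0 = 1 := fun i => LieEquiv.ext fun x => by
    rw [hEA, Finset.sum_eq_single 0]
    · simp [hA0]
    · intro j _ hj; simp [hj]
    · simp
  let ψ : (Fin (Module.finrank k (fixed σ)) → k) → List (Fin (Module.finrank k (fixed σ))) →
    (𝔤 ≃ₗ⁅k⁆ 𝔤) := fun x l => (l.map fun i => E i (x i)).prod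
  have hψσ : ∀ x l, ψ x l ∈ autCentralizer σ := by
    intro x l
    refine Subgroup.list_prod_mem _ fun y hy => ?_
    obtain ⟨i, -, rfl⟩ := List.mem_map.1 hy
    exact hEσ i _
  have hψpoly : ∀ (l : List (Fin (Module.finrank k (fixed σ)))) (G : _ → 𝔤), IsPolyMap G →
      IsPolyMap fun x => ψ x l (G x) := by
    intro l G hG
    induction l with
    | nil => exact hG
    | cons i l ih =>
      have h1 : (fun x => ψ x (i :: l) (G x)) = fun x => ∑ j ∈ Finset.range (K i + 2),
          MvPolynomial.eval x (MvPolynomial.X i ^ j) • A i j (ψ x l (G x)) := by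
        ext x
        simp only [ψ, List.map_cons, List.prod_cons, aut_mul_apply, hEA, map_pow,
          MvPolynomial.eval_X]
      rw [h1]
      exact IsPolyMap.sum _ fun j => (ih.map (A i j)).smul _
  have hψone : ∀ (l : List (Fin (Module.finrank k (fixed σ)))) x, (∀ j ∈ l, E j (x j) = 1) →
      ψ x l = 1 := by
    intro l x h
    refine List.prod_eq_one fun y hy => ?_
    obtain ⟨i, hi, rfl⟩ := List.mem_map.1 hy
    exact h i hi
  have hψsingle : ∀ (l : List (Fin (Module.finrank k (fixed σ)))) i x, l.Nodup → i ∈ l →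
      (∀ j ≠ i, E j (x j) = 1) → ψ x l = E i (x i) := by
    intro l i x hl hi h
    induction l with
    | nil => simp at hi
    | cons a l ih =>
      have h1 : ψ x (a :: l) = E a (x a) * ψ x l := by simp [ψ]
      rw [List.nodup_cons] at hl
      rw [h1]
      by_cases hai : a = i
      · subst hai
        rw [hψone l x fun j hj => h j fun hja => hl.1 (hja ▸ hj), mul_one]
      · rw [h a hai, one_mul]
        exact ih hl.2 ((List.mem_cons.1 hi).resolve_left (Ne.symm hai))
  let l := (Finset.univ : Finset (Fin (Module.finrank k (fixed σ)))).toList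
  let F : (Fin (Module.finrank k (fixed σ)) → k) → fixed σ := fun x =>
    ⟨ψ x l (∑ i, x i • g i : H), map_mem_fixed (hψσ x l) (hH.le _ (∑ i, x i • g i : H).2)⟩
  have hF : IsPolyMap F := by
    refine IsPolyMap.of_subtype (p := (fixed σ).toSubmodule) (F := F) ?_
    refine hψpoly l (fun x => ((∑ i, x i • g i : H) : 𝔤)) ?_
    have h1 : (fun x : Fin (Module.finrank k (fixed σ)) → k => ((∑ i, x i • g i : H) : 𝔤)) =
        fun x => ∑ i, MvPolynomial.eval x (MvPolynomial.X i) • (g i : 𝔤) := by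
      ext x
      simp
    rw [h1]
    exact IsPolyMap.sum _ fun i => (IsPolyMap.const (g i : 𝔤)).smul _
  have hw : ∀ i, IsUnit (if hi : β i = 0 then (1 : k) else -β i h₀) := by
    intro i
    by_cases hi : β i = 0
    · simp [hi]
    · simpa [hi] using hh₀ ⟨i, hi⟩
  -- The derivative of `F` at `x₀`. Along coordinate `i` only the factor `E i` moves: for weight
  -- zero `F` is `h₀ + ε b_i`, with derivative `b_i`; otherwise it is `exp(ε ad b_i) h₀`, with
  -- derivative `⁅b_i, h₀⁆ = -β_i(h₀) b_i`.
  let D := b.isUnitSMul hw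
  obtain ⟨P, hP, hPF⟩ := hF.exists_algebraicIndependent b₀ x₀ D (by
    intro i φ
    obtain ⟨φ, rfl⟩ := LinearMap.exists_extend (p := (fixed σ).toSubmodule) φ
    have hsum : ∀ ε : k, (∑ j, (x₀ + ε • Pi.single i (1 : k) : Fin (Module.finrank k (fixed σ)) → k) j • g j) = h₀ + ε • g i := by
      intro ε
      simp only [Pi.add_apply, add_smul, Finset.sum_add_distrib, hsum₀, Pi.smul_apply,
        smul_eq_mul]
      congr 1
      rw [Finset.sum_eq_single i]
      · simp
      · intro j _ hj; simp [hj]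
      · simp
    have hFi : ∀ ε : k, (F (x₀ + ε • Pi.single i 1) : 𝔤) =
        E i (x₀ i + ε) (h₀ + ε • g i : H) := by
      intro ε
      change ψ _ l ((∑ j, (x₀ + ε • Pi.single i (1 : k) : Fin (Module.finrank k (fixed σ)) → k) j • g j : H) : 𝔤) = _
      rw [hsum, hψsingle l i _ (Finset.nodup_toList _) (by simp [l])]
      · simp
      · intro j hj
        by_cases hj' : β j = 0
        · exact hE1 j hj' _
        · have : (x₀ + ε • Pi.single i (1 : k) : Fin (Module.finrank k (fixed σ)) → k) j = 0 := by
            rw [Pi.add_apply, hx₀ j hj']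
            simp [hj]
          rw [this, hE0]
    by_cases hi : β i = 0
    · refine ⟨Polynomial.C (φ h₀) + Polynomial.X * Polynomial.C (φ (b i)), fun ε => ?_, ?_⟩
      · change _ = φ (F (x₀ + ε • Pi.single i 1) : 𝔤)
        rw [hFi, hE1 i hi]
        change _ = φ ((h₀ + ε • g i : H) : 𝔤)
        rw [Submodule.coe_add, Submodule.coe_smul, hg i hi]
        simp
        exact mul_comm _ _
      · simp only [D, Module.Basis.isUnitSMul_apply, hi]
        simp
        rfl
    · refine ⟨∑ j ∈ Finset.range (K i + 2), Polynomial.X ^ j * Polynomial.C (φ (A i j h₀)),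
        fun ε => ?_, ?_⟩
      · change _ = φ (F (x₀ + ε • Pi.single i 1) : 𝔤)
        rw [hFi, hx₀ i hi, hg' i hi, hEA, zero_add, smul_zero, add_zero, map_sum,
          Polynomial.eval_finsetSum]
        simp
        exact Finset.sum_congr rfl fun _ _ => mul_comm _ _
      · rw [Polynomial.finsetSum_coeff, Finset.sum_eq_single 1]
        · rw [pow_one, mul_comm, Polynomial.coeff_C_mul_X, if_pos rfl, hA1, if_neg hi]
          simp only [D, Module.Basis.isUnitSMul_apply, hi]
          change φ ⁅(b i : 𝔤), (h₀ : 𝔤)⁆ = φ ((-β i h₀) • (b i : 𝔤))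
          rw [← lie_skew, hβ, neg_smul]
        · intro j _ hj
          rw [mul_comm, Polynomial.coeff_C_mul_X_pow, if_neg (Ne.symm hj)]
        · simp)
  let r : MvPolynomial (Fin (Module.finrank k (fixed σ))) k :=
    ∏ j, if β j = 0 then 1 else ∑ i, MvPolynomial.C (β j (g i)) * MvPolynomial.X i
  have hr : ∀ x, MvPolynomial.eval x r = ∏ j, if β j = 0 then 1 else β j (∑ i, x i • g i) := by
    intro x
    rw [map_prod]
    refine Finset.prod_congr rfl fun j _ => ?_
    split_ifs
    · simp
    · simp [mul_comm]
  refine ⟨P, hP, r, ?_, fun x => ⟨ψ x l, hψσ x l, (∑ i, x i • g i : H), Subtype.property _, F x,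
    rfl, hPF x, fun hx y hy hxy => ?_⟩⟩
  · intro h0
    have h1 := hr x₀
    rw [h0, map_zero, hsum₀, eq_comm, Finset.prod_eq_zero_iff] at h1
    obtain ⟨j, -, hj⟩ := h1
    split_ifs at hj with hj'
    · exact one_ne_zero hj
    · exact hh₀ ⟨j, hj'⟩ hj
  · rw [hr, Finset.prod_ne_zero_iff] at hx
    have h1 := hcentr (∑ i, x i • g i) ⟨y, hy⟩ hxy
    have h2 := congrArg (fun v : fixed σ => (v : 𝔤)) (b.sum_repr ⟨y, hy⟩)
    simp only [AddSubmonoidClass.coe_finsetSum] at h2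
    rw [← h2]
    refine Submodule.sum_mem _ fun i _ => ?_
    by_cases hi : β i = 0
    · exact H.smul_mem _ (hbH i hi)
    · have h3 := hx i (Finset.mem_univ _)
      rw [if_neg hi] at h3
      rw [h1 i h3, zero_smul]
      exact H.zero_mem

/-- The conjugates of `H₂` contain a principal open set, which the conjugates of regular elements of
`H₁` must meet. At a common point `ψ₁ u = ψ₂ u'` with `u` regular, the automorphism `ψ₁⁻¹ ψ₂` sends
`H₂` into the centralizer of `u`, which is contained in `H₁`. -/
theorem IsToralCartan.exists_conj [IsAlgClosed k] [CharZero k] {σ : Fin n → (𝔤 ≃ₗ⁅k⁆ 𝔤)}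
    {H₁ H₂ : Submodule k 𝔤} (h₁ : IsToralCartan (fixed σ) H₁) (h₂ : IsToralCartan (fixed σ) H₂) :
    ∃ ψ ∈ autCentralizer σ, ∀ x, ψ x ∈ H₁ ↔ x ∈ H₂ := by
  let b₀ := Module.finBasis k (fixed σ)
  obtain ⟨P₁, hP₁, r, hr, hx₁⟩ := exists_conjugates_algebraicIndependent h₁ b₀
  obtain ⟨P₂, hP₂, r₂, -, hx₂⟩ := exists_conjugates_algebraicIndependent h₂ b₀
  obtain ⟨f, hf, hf'⟩ := exists_open_subset_range P₂ hP₂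
  -- Independence of `P₁` keeps `f ∘ P₁` nonzero, so some `x` is regular for `H₁` and has its image
  -- in the open set for `H₂`.
  have h3 : MvPolynomial.aeval P₁ f * r ≠ 0 :=
    mul_ne_zero (fun h => hf (hP₁ (h.trans (map_zero _).symm))) hr
  obtain ⟨x, hx⟩ := exists_eval_ne_zero _ h3
  rw [map_mul] at hx
  obtain ⟨ψ₁, hψ₁, u, hu, v, hv, hPv, hreg⟩ := hx₁ x
  have h4 : MvPolynomial.eval x (MvPolynomial.aeval P₁ f) =
      MvPolynomial.eval (fun j => MvPolynomial.eval x (P₁ j)) f := by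
    rw [MvPolynomial.aeval_def, ← MvPolynomial.coe_eval₂Hom, ← RingHom.comp_apply,
      MvPolynomial.comp_eval₂Hom]
    congr 1
    ext <;> simp
  obtain ⟨y, hy⟩ := hf' _ (h4 ▸ left_ne_zero_of_mul hx)
  obtain ⟨ψ₂, hψ₂, u', hu', v', hv', hPv', -⟩ := hx₂ y
  have hvv : v = v' := b₀.repr.injective (Finsupp.ext fun j => by rw [← hPv, ← hy, hPv'])
  have hψ : (ψ₁⁻¹ * ψ₂) u' = u := by
    have h5 : ψ₁ u = ψ₂ u' := by rw [← hv, ← hv', hvv]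
    rw [aut_mul_apply, ← h5]
    exact ψ₁.symm_apply_apply u
  have hmem : ψ₁⁻¹ * ψ₂ ∈ autCentralizer σ := mul_mem (inv_mem hψ₁) hψ₂
  have h6 : ∀ z ∈ H₂, (ψ₁⁻¹ * ψ₂) z ∈ H₁ := by
    intro z hz
    refine hreg (right_ne_zero_of_mul hx) _ (map_mem_fixed hmem (h₂.le _ hz)) ?_
    rw [← hψ, ← LieEquiv.map_lie, h₂.lie_eq_zero _ hu' _ hz, map_zero]
  refine ⟨ψ₁⁻¹ * ψ₂, hmem, fun z => ⟨fun hz => ?_, h6 z⟩⟩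
  have h7 : z ∈ fixed σ := by
    have h8 := map_mem_fixed (inv_mem hmem) (h₁.le _ hz)
    rwa [← aut_mul_apply, inv_mul_cancel] at h8
  -- Conversely, if `ψ z ∈ H₁` then `z` commutes with `H₂`, because `ψ` maps both into the commuting
  -- set `H₁`.
  refine h₂.mem_of_lie z h7 fun h hh => ?_
  refine (ψ₁⁻¹ * ψ₂).injective ?_
  change (ψ₁⁻¹ * ψ₂) ⁅h, z⁆ = (ψ₁⁻¹ * ψ₂) 0
  rw [LieEquiv.map_lie, h₁.lie_eq_zero _ (h6 h hh) _ hz, map_zero]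

end Conjugacy

/-! ### Joint eigenspaces and their periodicity modulo `m` -/

section Joint

variable {k : Type*} [Field k] {𝔤 : Type*} [LieRing 𝔤] [LieAlgebra k 𝔤] {n : ℕ}

/-- The joint eigenspace of a tuple of automorphisms inside a root space. -/
def jointComp (σ : Fin n → (𝔤 ≃ₗ⁅k⁆ 𝔤)) (𝔥 : LieSubalgebra k (fixed σ))
    (f : Fin n → (𝔤 ≃ₗ⁅k⁆ 𝔤)) (p : rootLattice σ 𝔥 × (Fin n → k)) : Submodule k 𝔤 where
  carrier := {x | x ∈ rootSpace σ 𝔥 p.1 ∧ ∀ i, f i x = p.2 i • x}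
  add_mem' ha hb := ⟨add_mem ha.1 hb.1, fun i => by rw [map_add, ha.2 i, hb.2 i, smul_add]⟩
  zero_mem' := ⟨zero_mem _, fun i => by rw [map_zero, smul_zero]⟩
  smul_mem' c x hx := ⟨Submodule.smul_mem _ _ hx.1,
    fun i => by rw [map_smul, hx.2 i, smul_comm]⟩

theorem iSupIndep_jointComp (σ : Fin n → (𝔤 ≃ₗ⁅k⁆ 𝔤)) (𝔥 : LieSubalgebra k (fixed σ))
    (f : Fin n → (𝔤 ≃ₗ⁅k⁆ 𝔤)) : iSupIndep (jointComp σ 𝔥 f) := by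
  have h := iSupIndep.iInf
    (fun (a : 𝔥 ⊕ Fin n) (c : k) => (Sum.elim
      (fun h : 𝔥 => LieAlgebra.ad k 𝔤 ((h : fixed σ) : 𝔤))
      (fun i => ((f i).toLinearEquiv : Module.End k 𝔤)) a).eigenspace c)
    (fun h => Module.End.eigenspaces_iSupIndep _)
  have h' := h.comp (f := fun (p : rootLattice σ 𝔥 × (Fin n → k)) (a : 𝔥 ⊕ Fin n) =>
    Sum.elim (fun h : 𝔥 => (p.1 : Module.Dual k 𝔥) h) p.2 a) (by
    rintro ⟨α, c⟩ ⟨β, d⟩ h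
    refine Prod.ext (Subtype.ext (LinearMap.ext fun u => congrFun h (Sum.inl u)))
      (funext fun i => congrFun h (Sum.inr i)))
  refine h'.mono fun p x hx => ?_
  refine Submodule.mem_iInf _ |>.2 fun a => ?_
  rw [Module.End.mem_eigenspace_iff]
  rcases a with h | i
  · exact hx.1 h
  · exact hx.2 i

/-- The joint eigenspace of a tuple of automorphisms. -/
def jointEigen (f : Fin n → (𝔤 ≃ₗ⁅k⁆ 𝔤)) (c : Fin n → k) : Submodule k 𝔤 :=
  ⨅ i, Module.End.eigenspace ((f i).toLinearEquiv : 𝔤 →ₗ[k] 𝔤) (c i)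

theorem mem_jointEigen {f : Fin n → (𝔤 ≃ₗ⁅k⁆ 𝔤)} {c : Fin n → k} {x : 𝔤} :
    x ∈ jointEigen f c ↔ ∀ i, f i x = c i • x := by
  simp only [jointEigen, Submodule.mem_iInf, Module.End.mem_eigenspace_iff]
  rfl

theorem iSupIndep_jointEigen (f : Fin n → (𝔤 ≃ₗ⁅k⁆ 𝔤)) : iSupIndep (jointEigen f) :=
  iSupIndep.iInf (fun (i : Fin n) (c : k) =>
    Module.End.eigenspace ((f i).toLinearEquiv : 𝔤 →ₗ[k] 𝔤) c)
    fun _ => Module.End.eigenspaces_iSupIndep _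

variable (ζ : CompatibleRoots k) (m : Fin n → ℕ+) (σ : Fin n → (𝔤 ≃ₗ⁅k⁆ 𝔤))
  (𝔥 : LieSubalgebra k (fixed σ))

/-- The joint component `𝔤_α^l`. -/
def homComp (p : rootLattice σ 𝔥 × (Fin n → ℤ)) : Submodule k 𝔤 :=
  rootSpace σ 𝔥 p.1 ⊓ eigenComp ζ m σ p.2

variable {ζ m σ 𝔥}

theorem eigenComp_eq_jointEigen (l : Fin n → ℤ) :
    eigenComp ζ m σ l = jointEigen σ fun i => ζ.root (m i) ^ l i := by
  ext x
  rw [mem_jointEigen]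
  rfl

/-- The vector with entries `m i * μ i`. -/
def scale (m : Fin n → ℕ+) : (Fin n → ℤ) →+ (Fin n → ℤ) where
  toFun μ i := (m i : ℕ) * μ i
  map_zero' := by ext; simp
  map_add' a b := by ext; simp [mul_add]

theorem scale_apply (m : Fin n → ℕ+) (μ : Fin n → ℤ) (i : Fin n) :
    scale m μ i = (m i : ℕ) * μ i := rfl

theorem root_zpow_eq_iff (l l' : Fin n → ℤ) :
    (∀ i, ζ.root (m i) ^ l i = ζ.root (m i) ^ l' i) ↔ ∃ μ, l' = l + scale m μ := by
  have h1 : ∀ i, ζ.root (m i) ^ l i = ζ.root (m i) ^ l' i ↔ ((m i : ℕ) : ℤ) ∣ l' i - l i := by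
    intro i
    rw [← ζ.root_zpow_eq_one_iff, zpow_sub₀ (ζ.root_ne_zero _), div_eq_one_iff_eq
      (zpow_ne_zero _ (ζ.root_ne_zero _)), eq_comm]
  constructor
  · intro h
    choose μ hμ using fun i => (h1 i).1 (h i)
    refine ⟨μ, funext fun i => ?_⟩
    rw [Pi.add_apply, scale_apply, ← hμ]
    ring
  · rintro ⟨μ, rfl⟩ i
    rw [h1, Pi.add_apply, scale_apply, add_sub_cancel_left]
    exact dvd_mul_right _ _

theorem eigenComp_add_scale (l μ : Fin n → ℤ) :
    eigenComp ζ m σ (l + scale m μ) = eigenComp ζ m σ l := by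
  rw [eigenComp_eq_jointEigen, eigenComp_eq_jointEigen]
  congr 1
  ext i
  exact ((root_zpow_eq_iff l _).2 ⟨μ, rfl⟩ i).symm

theorem homComp_add_scale (p : rootLattice σ 𝔥 × (Fin n → ℤ)) (μ : Fin n → ℤ) :
    homComp ζ m σ 𝔥 (p + (0, scale m μ)) = homComp ζ m σ 𝔥 p := by
  rw [homComp, homComp, Prod.snd_add, eigenComp_add_scale, Prod.fst_add, add_zero]

theorem exists_scale_of_mem {x : 𝔤} (hx : x ≠ 0) {l l' : Fin n → ℤ} (h : x ∈ eigenComp ζ m σ l)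
    (h' : x ∈ eigenComp ζ m σ l') : ∃ μ, l' = l + scale m μ := by
  refine (root_zpow_eq_iff (ζ := ζ) l l').1 fun i => ?_
  have h1 := (h i).symm.trans (h' i)
  exact smul_left_injective k hx h1

theorem homComp_le_jointComp (p : rootLattice σ 𝔥 × (Fin n → ℤ)) :
    homComp ζ m σ 𝔥 p ≤ jointComp σ 𝔥 σ (p.1, fun i => ζ.root (m i) ^ p.2 i) :=
  fun _ hx => ⟨hx.1, hx.2⟩

end Joint

/-! ### Homogeneous elements of the loop algebra and evaluation at `1` -/

section Loop

variable {k : Type*} [Field k] {𝔤 : Type*} [LieRing 𝔤] [LieAlgebra k 𝔤] {n : ℕ}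

/-- The map `x ↦ t ^ l ⊗ x` -/
noncomputable def loopMk (l : Fin n → ℤ) : 𝔤 →ₗ[k] LieAlgebra.loopAlgebra k (Fin n → ℤ) 𝔤 :=
  TensorProduct.mk k (AddMonoidAlgebra k (Fin n → ℤ)) 𝔤 (AddMonoidAlgebra.single l 1)

theorem loopMk_lie (l l' : Fin n → ℤ) (x y : 𝔤) :
    ⁅loopMk (k := k) l x, loopMk (k := k) l' y⁆ = loopMk (k := k) (l + l') ⁅x, y⁆ := by
  simp [loopMk, LieAlgebra.ExtendScalars.bracket_tmul, AddMonoidAlgebra.single_mul_single]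

/-- Evaluation at the unit element of the torus. -/
noncomputable def loopEval : LieAlgebra.loopAlgebra k (Fin n → ℤ) 𝔤 →ₗ⁅k⁆ 𝔤 where
  __ := TensorProduct.lift ((LinearMap.lsmul k 𝔤).comp
    (AddMonoidAlgebra.lift k k (Fin n → ℤ) 1).toLinearMap)
  map_lie' {x y} := by
    let e : LieAlgebra.loopAlgebra k (Fin n → ℤ) 𝔤 →ₗ[k] 𝔤 :=
      TensorProduct.lift ((LinearMap.lsmul k 𝔤).comp
        (AddMonoidAlgebra.lift k k (Fin n → ℤ) 1).toLinearMap)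
    change e ⁅x, y⁆ = ⁅e x, e y⁆
    induction x using TensorProduct.induction_on with
    | zero => exact (congrArg e (zero_lie y)).trans (by simp)
    | add u v hu hv =>
      exact (congrArg e (add_lie (L := LieAlgebra.loopAlgebra k (Fin n → ℤ) 𝔤) u v y)).trans
        (by rw [map_add, map_add, add_lie, hu, hv])
    | tmul a u =>
      induction y using TensorProduct.induction_on with
      | zero => exact (congrArg e (lie_zero (L := LieAlgebra.loopAlgebra k (Fin n → ℤ) 𝔤)
          (a ⊗ₜ[k] u))).trans (by simp)
      | add v w hu hv =>
        exact (congrArg e (lie_add (L := LieAlgebra.loopAlgebra k (Fin n → ℤ) 𝔤)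
          (a ⊗ₜ[k] u) v w)).trans (by rw [map_add, map_add, lie_add, hu, hv])
      | tmul b v =>
        rw [LieAlgebra.ExtendScalars.bracket_tmul]
        simp [e, smul_smul, mul_comm]

theorem loopEval_mk (l : Fin n → ℤ) (x : 𝔤) :
    loopEval (k := k) (loopMk (k := k) l x) = x := by
  change TensorProduct.lift _ (_ ⊗ₜ[k] x) = x
  simp

theorem smul_loopMk (l μ : Fin n → ℤ) (x : 𝔤) :
    (AddMonoidAlgebra.single μ (1 : k)) •
      (loopMk l x : LieAlgebra.loopAlgebra k (Fin n → ℤ) 𝔤) = loopMk (l + μ) x := by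
  change _ • ((AddMonoidAlgebra.single l (1 : k)) ⊗ₜ[k] x) = (AddMonoidAlgebra.single (l + μ) (1 : k)) ⊗ₜ[k] x
  rw [TensorProduct.smul_tmul', smul_eq_mul, AddMonoidAlgebra.single_mul_single, one_mul, add_comm]

variable {ζ : CompatibleRoots k} {m : Fin n → ℕ+} {σ : Fin n → (𝔤 ≃ₗ⁅k⁆ 𝔤)}
  {𝔥 : LieSubalgebra k (fixed σ)}

theorem mem_multiloopGrading_comp {p : rootLattice σ 𝔥 × (Fin n → ℤ)} {y : multiloop ζ m σ 𝔥} :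
    y ∈ (multiloopGrading ζ m σ 𝔥).comp p ↔ ∃ x ∈ homComp ζ m σ 𝔥 p, loopMk p.2 x = y.1 :=
  Iff.rfl

theorem loopMk_mem_of_homComp {p : rootLattice σ 𝔥 × (Fin n → ℤ)} {x : 𝔤}
    (hx : x ∈ homComp ζ m σ 𝔥 p) : loopMk p.2 x ∈ multiloop ζ m σ 𝔥 :=
  (le_iSup (loopComp ζ m σ 𝔥) p) ⟨x, hx, rfl⟩

theorem comp_ne_bot_iff (p : rootLattice σ 𝔥 × (Fin n → ℤ)) :
    (multiloopGrading ζ m σ 𝔥).comp p ≠ ⊥ ↔ homComp ζ m σ 𝔥 p ≠ ⊥ := by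
  rw [Submodule.ne_bot_iff, Submodule.ne_bot_iff]
  constructor
  · rintro ⟨y, hy, hy0⟩
    obtain ⟨x, hx, hxy⟩ := mem_multiloopGrading_comp.1 hy
    refine ⟨x, hx, ?_⟩
    rintro rfl
    exact hy0 (Subtype.ext (by rw [← hxy, map_zero]; rfl))
  · rintro ⟨x, hx, hx0⟩
    refine ⟨⟨_, loopMk_mem_of_homComp hx⟩, mem_multiloopGrading_comp.2 ⟨x, hx, rfl⟩, ?_⟩
    intro h
    apply hx0
    rw [← loopEval_mk (k := k) p.2 x, show loopMk p.2 x = 0 from congrArg Subtype.val h, map_zero]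

theorem mem_suppGroup_of_homComp {p : rootLattice σ 𝔥 × (Fin n → ℤ)}
    (h : homComp ζ m σ 𝔥 p ≠ ⊥) : p ∈ (multiloopGrading ζ m σ 𝔥).suppGroup :=
  AddSubgroup.subset_closure ((comp_ne_bot_iff p).2 h)

end Loop

/-! ### The components `𝔤_α^l` span `𝔤`; size of the support group -/

section Spanning

variable {k : Type*} [Field k] [IsAlgClosed k] [CharZero k] {𝔤 : Type*} [LieRing 𝔤]
  [LieAlgebra k 𝔤] [FiniteDimensional k 𝔤] [LieAlgebra.IsKilling k 𝔤] {n : ℕ}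
  (ζ : CompatibleRoots k) (m : Fin n → ℕ+) (σ : Fin n → (𝔤 ≃ₗ⁅k⁆ 𝔤))
  (hσ : ∀ i j, σ i * σ j = σ j * σ i) (hσm : ∀ i, σ i ^ (m i : ℕ) = 1)
  (𝔥 : LieSubalgebra k (fixed σ)) [𝔥.IsCartanSubalgebra]

include hσ hσm

theorem iSup_homComp_eq_top : ⨆ p, homComp ζ m σ 𝔥 p = ⊤ := by
  have hH := isToralCartan_ambient ζ m σ hσ hσm 𝔥
  rw [eq_top_iff, ← iSup_iInf_eigenspace_eq_top (Sum.elim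
      (fun h : 𝔥 => LieAlgebra.ad k 𝔤 ((h : fixed σ) : 𝔤))
      (fun i => ((σ i).toLinearEquiv : Module.End k 𝔤))) ?_ ?_]
  · refine iSup_le fun χ x hx => ?_
    by_cases h0 : x = 0
    · rw [h0]; exact Submodule.zero_mem _
    simp only [Submodule.mem_iInf, Module.End.mem_eigenspace_iff] at hx
    have h1 : ∀ h : 𝔥, ⁅((h : fixed σ) : 𝔤), x⁆ = χ (Sum.inl h) • x := fun h => hx (Sum.inl h)
    have h2 : ∀ i, σ i x = χ (Sum.inr i) • x := fun i => hx (Sum.inr i)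
    choose l hl using fun i => mem_eigenspace_iff_root ζ (σ i) (m i) (hσm i) _ h0 (h2 i)
    -- A joint eigenvector `x ≠ 0` only provides a function of eigenvalues; its linearity follows by
    -- comparing actions on `x`.
    let α : Module.Dual k 𝔥 :=
      { toFun := fun h => χ (Sum.inl h)
        map_add' := fun u v => smul_left_injective k h0 (by
          change χ (Sum.inl (u + v)) • x = (χ (Sum.inl u) + χ (Sum.inl v)) • x
          rw [← h1, add_smul, ← h1, ← h1, ← add_lie]
          rfl)
        map_smul' := fun c v => smul_left_injective k h0 (by
          change χ (Sum.inl (c • v)) • x = (c * χ (Sum.inl v)) • x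
          rw [← h1, mul_smul, ← h1, ← smul_lie]
          rfl) }
    have hxα : x ∈ rootSpace σ 𝔥 α := h1
    have hα : α ∈ rootLattice σ 𝔥 := by
      by_cases hα : α = 0
      · rw [hα]; exact zero_mem _
      · refine AddSubgroup.subset_closure ⟨hα, ?_⟩
        exact (Submodule.ne_bot_iff _).2 ⟨x, hxα, h0⟩
    exact Submodule.mem_iSup_of_mem (⟨α, hα⟩, l) ⟨hxα, fun i => by rw [← hl]; exact h2 i⟩
  · rintro (h | i) (h' | j)
    · exact commute_ad (hH.lie_eq_zero _ (mem_ambient.2 ⟨h, rfl⟩) _ (mem_ambient.2 ⟨h', rfl⟩))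
    · exact (lie_apply_commute (σ j) _ (h.1.2 j)).symm
    · exact lie_apply_commute (σ i) _ (h'.1.2 i)
    · exact LinearMap.ext fun x => aut_commute (hσ i j) x
  · rintro (h | i)
    · exact hH.isSemisimple _ (mem_ambient.2 ⟨h, rfl⟩)
    · refine isSemisimple_of_pow_eq_one _ (m i) (m i).ne_zero ?_
      change ((σ i).toLinearEquiv : Module.End k 𝔤) ^ _ = 1
      rw [← aut_pow_toLinearMap, hσm]
      rfl

theorem exists_homComp_ne_bot [Nontrivial 𝔤] : ∃ p, homComp ζ m σ 𝔥 p ≠ ⊥ := by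
  by_contra! h
  have h1 := iSup_homComp_eq_top ζ m σ hσ hσm 𝔥
  simp only [h, iSup_bot] at h1
  exact bot_ne_top h1

/-- The difference of two support degrees: `p` and `p + (0, mμ)` have the same component in `𝔤`. -/
theorem scale_mem_suppGroup [Nontrivial 𝔤] (μ : Fin n → ℤ) :
    (0, scale m μ) ∈ (multiloopGrading ζ m σ 𝔥).suppGroup := by
  obtain ⟨p, hp⟩ := exists_homComp_ne_bot ζ m σ hσ hσm 𝔥
  have h1 := mem_suppGroup_of_homComp hp
  have h2 : p + (0, scale m μ) ∈ (multiloopGrading ζ m σ 𝔥).suppGroup :=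
    mem_suppGroup_of_homComp (by rwa [homComp_add_scale])
  have h3 := sub_mem h2 h1
  rwa [add_sub_cancel_left] at h3

theorem exists_mem_suppGroup (α : rootLattice σ 𝔥) :
    ∃ l, (α, l) ∈ (multiloopGrading ζ m σ 𝔥).suppGroup := by
  have h1 := mem_of_closure_hom (AddMonoidHom.id (rootLattice σ 𝔥))
    ((multiloopGrading ζ m σ 𝔥).suppGroup.map (AddMonoidHom.fst _ _)) (by
      intro α hα
      obtain ⟨x, hx, hx0⟩ := (Submodule.ne_bot_iff _).1 hα.2
      obtain ⟨p, -, hp1, hp⟩ := exists_fiber_of_mem (iSupIndep_rootSpace σ 𝔥)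
        (W := homComp ζ m σ 𝔥) (fun p => p.1) (fun p => inf_le_left) hx0
        (j := ⟨α, AddSubgroup.subset_closure hα⟩) hx (S := Set.univ) (by
          simp [iSup_homComp_eq_top ζ m σ hσ hσm 𝔥])
      exact ⟨p, mem_suppGroup_of_homComp hp, hp1⟩) α
  obtain ⟨⟨β, l⟩, hp, hβ⟩ := h1
  simp only [AddMonoidHom.id_apply, AddMonoidHom.coe_fst] at hβ
  subst hβ
  exact ⟨l, hp⟩

/-- Every `𝔤_α^{l'}` inside this eigenspace has `l' ≡ l` modulo `m`, so it may be relabelled by `l`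
itself. -/
theorem eigenComp_le_iSup (l : Fin n → ℤ) :
    eigenComp ζ m σ l ≤ ⨆ α, homComp ζ m σ 𝔥 (α, l) := by
  rw [eigenComp_eq_jointEigen, eq_iSup_fiber (iSupIndep_jointEigen σ)
    (W := homComp ζ m σ 𝔥) (fun p i => ζ.root (m i) ^ p.2 i) ?_
    (iSup_homComp_eq_top ζ m σ hσ hσm 𝔥)]
  · refine iSup₂_le fun p hp => ?_
    obtain ⟨μ, hμ⟩ := (root_zpow_eq_iff p.2 l).1 fun i => congrFun hp i
    refine le_trans ?_ (le_iSup _ p.1)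
    have h := homComp_add_scale (ζ := ζ) (m := m) p μ
    rw [← h, hμ, show p + (0, scale m μ) = (p.1, p.2 + scale m μ) from Prod.ext (add_zero _) rfl]
  · intro p x hx
    exact mem_jointEigen.2 hx.2

theorem loopMk_mem {l : Fin n → ℤ} {x : 𝔤} (hx : x ∈ eigenComp ζ m σ l) :
    loopMk l x ∈ multiloop ζ m σ 𝔥 := by
  have h1 : (⨆ α, homComp ζ m σ 𝔥 (α, l)) ≤ (multiloop ζ m σ 𝔥).toSubmodule.comap (loopMk l) :=
    iSup_le fun α x hx => loopMk_mem_of_homComp hx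
  exact h1 (eigenComp_le_iSup ζ m σ hσ hσm 𝔥 l hx)

theorem mem_second_comp {l : Fin n → ℤ} {y : multiloop ζ m σ 𝔥} :
    y ∈ (multiloopGrading ζ m σ 𝔥).second.comp l ↔
      ∃ x ∈ eigenComp ζ m σ l, loopMk l x = y.1 := by
  constructor
  · intro hy
    have h1 : (multiloopGrading ζ m σ 𝔥).second.comp l ≤
        ((eigenComp ζ m σ l).map (loopMk l)).comap (multiloop ζ m σ 𝔥).toSubmodule.subtype := by
      refine iSup_le fun α y hy => ?_
      obtain ⟨x, hx, hxy⟩ := mem_multiloopGrading_comp.1 hy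
      exact ⟨x, hx.2, hxy⟩
    exact h1 hy
  · rintro ⟨x, hx, hxy⟩
    have h2 : (⨆ α, homComp ζ m σ 𝔥 (α, l)) ≤
        (((multiloopGrading ζ m σ 𝔥).second.comp l).map
          (multiloop ζ m σ 𝔥).toSubmodule.subtype).comap (loopMk l) := by
      refine iSup_le fun α x hx => ⟨⟨_, loopMk_mem_of_homComp hx⟩, ?_, rfl⟩
      exact Submodule.mem_iSup_of_mem (p := fun q => (multiloopGrading ζ m σ 𝔥).comp (q, l)) α
        (mem_multiloopGrading_comp.2 ⟨x, hx, rfl⟩)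
    obtain ⟨z, hz, hzy⟩ := h2 (eigenComp_le_iSup ζ m σ hσ hσm 𝔥 l hx)
    have : z = y := Subtype.ext (by rw [← hxy]; exact hzy)
    rwa [← this]

end Spanning

/-! ### Centroid elements and characters of `ℤ^n` -/

theorem nontrivial_of_isSimple (k : Type*) [Field k] (𝔤 : Type*) [LieRing 𝔤] [LieAlgebra k 𝔤]
    [LieAlgebra.IsSimple k 𝔤] : Nontrivial 𝔤 := by
  by_contra h
  rw [not_nontrivial_iff_subsingleton] at h
  exact LieAlgebra.IsSimple.non_abelian (R := k) (L := 𝔤) ⟨fun x y => Subsingleton.elim _ _⟩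

/-- The kernel of `ψ` is stable under `T`, since `ψ (T z)` is central as soon as `ψ z = 0`, and the
center is zero. The induced endomorphism of `𝔤` has an eigenspace, which is a nonzero ideal and so
all of `𝔤`. -/
theorem exists_eq_smul_of_centroid {k : Type*} [Field k] [IsAlgClosed k] {L 𝔤 : Type*} [LieRing L]
    [LieAlgebra k L] [LieRing 𝔤] [LieAlgebra k 𝔤] [FiniteDimensional k 𝔤] [LieAlgebra.IsSimple k 𝔤]
    (ψ : L →ₗ⁅k⁆ 𝔤) (hψ : Function.Surjective ψ) (T : L →ₗ[k] L)
    (hT : ∀ z w, T ⁅z, w⁆ = ⁅T z, w⁆) : ∃ c : k, ∀ z, ψ (T z) = c • ψ z := by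
  have hker : ∀ z, ψ z = 0 → ψ (T z) = 0 := by
    intro z hz
    have h1 : ψ (T z) ∈ LieAlgebra.center k 𝔤 := by
      rw [LieModule.mem_maxTrivSubmodule]
      intro y
      obtain ⟨w, rfl⟩ := hψ y
      rw [← lie_skew, ← LieHom.map_lie, ← hT, ← lie_skew, map_neg, map_neg, hT, LieHom.map_lie, hz,
        lie_zero, neg_zero, neg_zero]
    rwa [LieAlgebra.center_eq_bot, LieSubmodule.mem_bot] at h1
  obtain ⟨g, hg⟩ := LinearMap.exists_rightInverse_of_surjective (ψ : L →ₗ[k] 𝔤)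
    (LinearMap.range_eq_top.2 hψ)
  have hg : ∀ y, ψ (g y) = y := fun y => LinearMap.congr_fun hg y
  let u : Module.End k 𝔤 := (ψ : L →ₗ[k] 𝔤).comp (T.comp g)
  have hu : ∀ z, ψ (T z) = u (ψ z) := by
    intro z
    have h1 : ψ (T (z - g (ψ z))) = 0 := hker _ (by rw [map_sub, hg, sub_self])
    rw [map_sub, map_sub, sub_eq_zero] at h1
    exact h1
  have hu' : ∀ x y, u ⁅x, y⁆ = ⁅u x, y⁆ := by
    intro x y
    obtain ⟨z, rfl⟩ := hψ x
    obtain ⟨w, rfl⟩ := hψ y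
    rw [← LieHom.map_lie, ← hu, hT, LieHom.map_lie, hu]
  have := nontrivial_of_isSimple k 𝔤
  obtain ⟨c, hc⟩ := Module.End.exists_eigenvalue u
  let I : LieIdeal k 𝔤 :=
    { u.eigenspace c with
      lie_mem := fun {x y} hy => by
        have hy : u y = c • y := Module.End.mem_eigenspace_iff.1 hy
        refine Module.End.mem_eigenspace_iff.2 ?_
        rw [← lie_skew, map_neg, hu', hy, smul_lie, smul_neg] }
  have hI : I = ⊤ := by
    refine (LieAlgebra.IsSimple.eq_bot_or_eq_top I).resolve_left fun h => ?_
    obtain ⟨x, hx⟩ := hc.exists_hasEigenvector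
    have h1 : x ∈ I := hx.1
    rw [h, LieSubmodule.mem_bot] at h1
    exact hx.2 h1
  refine ⟨c, fun z => ?_⟩
  have h1 : ψ z ∈ I := hI ▸ LieSubmodule.mem_top _
  rw [hu]
  exact Module.End.mem_eigenspace_iff.1 h1

/-- Choose `d_i` with `d_i ^ m_i = c(e_i)` and put `χ l = ∏ d_i ^ l_i`. -/
theorem exists_root_character {k : Type*} [Field k] [IsAlgClosed k] {n : ℕ} (m : Fin n → ℕ+)
    (c : (Fin n → ℤ) → k) (h0 : c 0 = 1) (hadd : ∀ a b, c (a + b) = c a * c b) :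
    ∃ χ : (Fin n → ℤ) → k, (∀ l, χ l ≠ 0) ∧ (∀ a b, χ (a + b) = χ a * χ b) ∧
      ∀ μ, χ (scale m μ) = c μ := by
  have hne : ∀ a, c a ≠ 0 := fun a ha => by
    have := hadd a (-a)
    rw [add_neg_cancel, h0, ha, zero_mul] at this
    exact one_ne_zero this
  let u : (Fin n → ℤ) →+ Additive kˣ := AddMonoidHom.mk' (fun a => Additive.ofMul (Units.mk0 (c a) (hne a)))
    fun a b => Additive.toMul.injective (Units.ext (hadd a b))
  have hu : ∀ a, c a = ((u a).toMul : kˣ) := fun a => rfl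
  choose d hd using fun i => IsAlgClosed.exists_pow_nat_eq (c (Pi.single i 1)) (m i).pos
  have hd0 : ∀ i, d i ≠ 0 := fun i h => by
    have := hd i
    rw [h, zero_pow (m i).ne_zero] at this
    exact hne _ this.symm
  refine ⟨fun l => ∏ i, d i ^ l i, fun l => Finset.prod_ne_zero_iff.2 fun i _ =>
    zpow_ne_zero _ (hd0 i), fun a b => ?_, fun μ => ?_⟩
  · rw [← Finset.prod_mul_distrib]
    exact Finset.prod_congr rfl fun i _ => zpow_add₀ (hd0 i) _ _
  · have h1 : μ = ∑ i, μ i • (Pi.single i 1 : Fin n → ℤ) := by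
      ext j
      simp [Finset.sum_apply, Pi.single_apply]
    conv_rhs => rw [h1, hu, map_sum]
    rw [toMul_sum, Units.coe_prod]
    refine Finset.prod_congr rfl fun i _ => ?_
    rw [map_zsmul, toMul_zsmul, Units.val_zpow_eq_zpow_val, ← hu, ← hd, scale_apply, zpow_mul,
      zpow_natCast]

/-! ### Multiplication by `t^{mμ}` on a multiloop algebra -/

section Shift

variable {k : Type*} [Field k] {𝔤 : Type*} [LieRing 𝔤] [LieAlgebra k 𝔤] {n : ℕ}
  {ζ : CompatibleRoots k} {m : Fin n → ℕ+} {σ : Fin n → (𝔤 ≃ₗ⁅k⁆ 𝔤)}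
  {𝔥 : LieSubalgebra k (fixed σ)}

theorem lie_mem_eigenComp {l l' : Fin n → ℤ} {x y : 𝔤} (hx : x ∈ eigenComp ζ m σ l)
    (hy : y ∈ eigenComp ζ m σ l') : ⁅x, y⁆ ∈ eigenComp ζ m σ (l + l') := by
  intro i
  rw [LieEquiv.map_lie, hx i, hy i, smul_lie, lie_smul, smul_smul, ← zpow_add₀ (ζ.root_ne_zero _)]
  rfl

/-- Multiplication by `t ^ (m μ)` on a multiloop algebra. -/
noncomputable def multiloopShift (ζ : CompatibleRoots k) (m : Fin n → ℕ+)
    (σ : Fin n → (𝔤 ≃ₗ⁅k⁆ 𝔤)) (𝔥 : LieSubalgebra k (fixed σ)) (μ : Fin n → ℤ) :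
    multiloop ζ m σ 𝔥 →ₗ[k] multiloop ζ m σ 𝔥 :=
  LinearMap.restrict (p := (multiloop ζ m σ 𝔥).toSubmodule) (q := (multiloop ζ m σ 𝔥).toSubmodule)
    (Algebra.lsmul k k (LieAlgebra.loopAlgebra k (Fin n → ℤ) 𝔤)
      (AddMonoidAlgebra.single (scale m μ) (1 : k))) (by
    have h : (multiloop ζ m σ 𝔥).toSubmodule ≤ (multiloop ζ m σ 𝔥).toSubmodule.comap
        (Algebra.lsmul k k (LieAlgebra.loopAlgebra k (Fin n → ℤ) 𝔤)
          (AddMonoidAlgebra.single (scale m μ) (1 : k))) := by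
      refine iSup_le fun p => ?_
      rintro _ ⟨x, hx, rfl⟩
      have hx' : x ∈ homComp ζ m σ 𝔥 (p + (0, scale m μ)) := by
        rw [homComp_add_scale]
        exact hx
      have h2 := loopMk_mem_of_homComp hx'
      have h3 := smul_loopMk (k := k) p.2 (scale m μ) x
      rw [Prod.snd_add, ← h3] at h2
      exact h2
    exact h)

theorem coe_multiloopShift (μ : Fin n → ℤ) (z : multiloop ζ m σ 𝔥) :
    (multiloopShift ζ m σ 𝔥 μ z : LieAlgebra.loopAlgebra k (Fin n → ℤ) 𝔤) =
      (AddMonoidAlgebra.single (scale m μ) (1 : k)) • z.1 := rfl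

theorem multiloopShift_lie (μ : Fin n → ℤ) (z w : multiloop ζ m σ 𝔥) :
    multiloopShift ζ m σ 𝔥 μ ⁅z, w⁆ = ⁅multiloopShift ζ m σ 𝔥 μ z, w⁆ := by
  refine Subtype.ext ?_
  rw [coe_multiloopShift]
  exact (smul_lie _ _ _).symm

theorem multiloopShift_zero (z : multiloop ζ m σ 𝔥) : multiloopShift ζ m σ 𝔥 0 z = z := by
  refine Subtype.ext ?_
  rw [coe_multiloopShift, map_zero]
  exact one_smul _ _

theorem multiloopShift_add (μ ν : Fin n → ℤ) (z : multiloop ζ m σ 𝔥) :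
    multiloopShift ζ m σ 𝔥 (μ + ν) z = multiloopShift ζ m σ 𝔥 μ (multiloopShift ζ m σ 𝔥 ν z) := by
  refine Subtype.ext ?_
  rw [coe_multiloopShift, coe_multiloopShift, coe_multiloopShift, smul_smul,
    AddMonoidAlgebra.single_mul_single, one_mul, map_add]

end Shift

/-! ### From an isomorphism of multiloop algebras to one of the simple algebras -/

section Untwist

variable {k : Type*} [Field k] [IsAlgClosed k] [CharZero k] (ζ : CompatibleRoots k)
  {𝔤 : Type*} [LieRing 𝔤] [LieAlgebra k 𝔤] [FiniteDimensional k 𝔤] [LieAlgebra.IsSimple k 𝔤]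
  {𝔤' : Type*} [LieRing 𝔤'] [LieAlgebra k 𝔤'] [FiniteDimensional k 𝔤'] [LieAlgebra.IsSimple k 𝔤']
  {n : ℕ} {m : Fin n → ℕ+} {σ : Fin n → (𝔤 ≃ₗ⁅k⁆ 𝔤)}
  {𝔥 : LieSubalgebra k (fixed σ)} {m' : Fin n → ℕ+} {σ' : Fin n → (𝔤' ≃ₗ⁅k⁆ 𝔤')}
  {𝔥' : LieSubalgebra k (fixed σ')}

theorem surjective_loopEval_multiloop (m : Fin n → ℕ+) (σ : Fin n → (𝔤 ≃ₗ⁅k⁆ 𝔤))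
    (hσ : ∀ i j, σ i * σ j = σ j * σ i) (hσm : ∀ i, σ i ^ (m i : ℕ) = 1)
    (𝔥 : LieSubalgebra k (fixed σ)) [𝔥.IsCartanSubalgebra] (y : 𝔤) :
    ∃ z : multiloop ζ m σ 𝔥, loopEval (k := k) z.1 = y := by
  refine iSup_top_induction (iSup_homComp_eq_top ζ m σ hσ hσm 𝔥)
    (p := fun y => ∃ z : multiloop ζ m σ 𝔥, loopEval (k := k) z.1 = y) y ?_ ⟨0, map_zero _⟩ ?_
  · exact fun p x hx => ⟨⟨_, loopMk_mem_of_homComp hx⟩, loopEval_mk p.2 x⟩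
  · rintro x y ⟨z, hz⟩ ⟨w, hw⟩
    exact ⟨z + w, by rw [← hz, ← hw]; exact map_add _ _ _⟩

/-- Evaluation at `1` after `Φ` turns the shifts `t^{mμ}` into scalars `c μ`. Correcting by a
character `χ` extending `c` makes `x ↦ χ(l)⁻¹ ψ(x ⊗ t^l)` independent of `l` modulo `m`, so it
defines a map on `𝔤`. No compatibility of `Φ` with the gradings is required. -/
theorem exists_untwist (hσ : ∀ i j, σ i * σ j = σ j * σ i) (hσm : ∀ i, σ i ^ (m i : ℕ) = 1)
    [𝔥.IsCartanSubalgebra]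
    (hσ' : ∀ i j, σ' i * σ' j = σ' j * σ' i) (hσm' : ∀ i, σ' i ^ (m' i : ℕ) = 1)
    [𝔥'.IsCartanSubalgebra] (Φ : multiloop ζ m σ 𝔥 ≃ₗ⁅k⁆ multiloop ζ m' σ' 𝔥') :
    ∃ (χ : (Fin n → ℤ) → k) (φ : 𝔤 ≃ₗ⁅k⁆ 𝔤'), (∀ l, χ l ≠ 0) ∧
      ∀ l x (hx : x ∈ eigenComp ζ m σ l),
        loopEval (k := k) (Φ ⟨loopMk l x, loopMk_mem ζ m σ hσ hσm 𝔥 hx⟩).1 = χ l • φ x := by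
  have hnt := nontrivial_of_isSimple k 𝔤
  have hnt' := nontrivial_of_isSimple k 𝔤'
  let ψ : multiloop ζ m σ 𝔥 →ₗ⁅k⁆ 𝔤' :=
    (loopEval.comp (multiloop ζ m' σ' 𝔥').incl).comp Φ.toLieHom
  have hψ : Function.Surjective ψ := by
    intro y
    obtain ⟨z, hz⟩ := surjective_loopEval_multiloop ζ m' σ' hσ' hσm' 𝔥' y
    refine ⟨Φ.symm z, ?_⟩
    change loopEval (k := k) (Φ (Φ.symm z)).1 = y
    rw [LieEquiv.apply_symm_apply, hz]
  choose c hc using fun μ => exists_eq_smul_of_centroid ψ hψ (multiloopShift ζ m σ 𝔥 μ)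
    (multiloopShift_lie μ)
  obtain ⟨z₀, hz₀⟩ : ∃ z, ψ z ≠ 0 := by
    obtain ⟨y, hy⟩ := exists_ne (0 : 𝔤')
    obtain ⟨z, rfl⟩ := hψ y
    exact ⟨z, hy⟩
  obtain ⟨χ, hχ0, hχadd, hχc⟩ := exists_root_character m c
    (smul_left_injective k hz₀ (by
      change c 0 • ψ z₀ = (1 : k) • ψ z₀
      rw [← hc, multiloopShift_zero, one_smul]))
    (fun a b => smul_left_injective k hz₀ (by
      change c (a + b) • ψ z₀ = (c a * c b) • ψ z₀
      rw [← hc, multiloopShift_add, hc, hc, smul_smul]))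
  -- An arbitrary linear extension to the whole loop algebra, used only on the multiloop algebra; it
  -- spares the membership proofs.
  obtain ⟨ψ₁, hψ₁⟩ := LinearMap.exists_extend (p := (multiloop ζ m σ 𝔥).toSubmodule)
    (ψ : multiloop ζ m σ 𝔥 →ₗ[k] 𝔤')
  have hψ₁ : ∀ z : multiloop ζ m σ 𝔥, ψ₁ z.1 = ψ z := fun z => LinearMap.congr_fun hψ₁ z
  have htop := iSup_eigenComp_eq_top ζ m σ hσ hσm
  have htop' : ⨆ c, jointEigen σ c = ⊤ := by
    rw [eq_top_iff, ← htop]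
    refine iSup_le fun l => ?_
    rw [eigenComp_eq_jointEigen]
    exact le_iSup (jointEigen σ) _
  classical
  -- Each eigenspace of `σ` uses one chosen exponent `l`; `hφ'` below shows that any other exponent
  -- gives the same map.
  obtain ⟨φ, hφ⟩ := exists_linearMap_of_iSupIndep (iSupIndep_jointEigen σ) htop'
    (fun d : Fin n → k => if h : ∃ l : Fin n → ℤ, ∀ i, ζ.root (m i) ^ l i = d i then
      (χ h.choose)⁻¹ • (ψ₁.comp (loopMk h.choose)) else 0)
  have hshift : ∀ l μ x (hx : x ∈ eigenComp ζ m σ l),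
      ψ₁ (loopMk (l + scale m μ) x) = c μ • ψ₁ (loopMk l x) := by
    intro l μ x hx
    have h1 := hc μ ⟨_, loopMk_mem ζ m σ hσ hσm 𝔥 hx⟩
    rw [← hψ₁, ← hψ₁, coe_multiloopShift, smul_loopMk] at h1
    exact h1
  have hφ' : ∀ l x (hx : x ∈ eigenComp ζ m σ l), ψ₁ (loopMk l x) = χ l • φ x := by
    intro l x hx
    have hx' := hx
    rw [eigenComp_eq_jointEigen] at hx'
    have hex : ∃ l' : Fin n → ℤ, ∀ i, ζ.root (m i) ^ l' i = ζ.root (m i) ^ l i := ⟨l, fun _ => rfl⟩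
    rw [hφ _ x hx', dif_pos hex]
    obtain ⟨μ, hμ⟩ := (root_zpow_eq_iff (ζ := ζ) hex.choose l).1 hex.choose_spec
    have hx2 : x ∈ eigenComp ζ m σ hex.choose := by
      rw [eigenComp_eq_jointEigen]
      simpa only [hex.choose_spec] using hx'
    generalize hex.choose = l₀ at hμ hx2
    subst hμ
    rw [hshift l₀ μ x hx2, hχadd, hχc, LinearMap.smul_apply, LinearMap.comp_apply, smul_smul,
      mul_comm (χ l₀), mul_assoc, mul_inv_cancel₀ (hχ0 _), mul_one]
  have hφlie : ∀ x y, φ ⁅x, y⁆ = ⁅φ x, φ y⁆ := by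
    intro x y
    refine iSup_top_induction htop (p := fun x => φ ⁅x, y⁆ = ⁅φ x, φ y⁆) x ?_ (by simp)
      fun u v hu hv => by rw [add_lie, map_add, map_add, add_lie, hu, hv]
    intro l x hx
    refine iSup_top_induction htop (p := fun y => φ ⁅x, y⁆ = ⁅φ x, φ y⁆) y ?_ (by simp)
      fun u v hu hv => by rw [lie_add, map_add, map_add, lie_add, hu, hv]
    intro l' y hy
    have h1 := hφ' _ _ (lie_mem_eigenComp hx hy)
    have h2 := LieHom.map_lie ψ ⟨_, loopMk_mem ζ m σ hσ hσm 𝔥 hx⟩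
      ⟨_, loopMk_mem ζ m σ hσ hσm 𝔥 hy⟩
    rw [← hψ₁, ← hψ₁, ← hψ₁, hφ' l x hx, hφ' l' y hy, smul_lie, lie_smul, smul_smul, ← hχadd] at h2
    rw [← loopMk_lie] at h1
    exact smul_right_injective _ (hχ0 _) (h1.symm.trans h2)
  let φ' : 𝔤 →ₗ⁅k⁆ 𝔤' := { φ with map_lie' := fun {x y} => hφlie x y }
  have hsurj : Function.Surjective φ' := by
    intro y
    obtain ⟨z, rfl⟩ := hψ y
    refine iSup_top_induction (multiloopGrading ζ m σ 𝔥).iSup_eq_top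
      (p := fun z => ∃ x, φ' x = ψ z) z ?_ ⟨0, by simp⟩ ?_
    · intro p z hz
      obtain ⟨x, hx, hxz⟩ := mem_multiloopGrading_comp.1 hz
      refine ⟨χ p.2 • x, ?_⟩
      rw [map_smul, ← hψ₁, ← hxz, hφ' _ _ hx.2]
      rfl
    · rintro u v ⟨x, hx⟩ ⟨y, hy⟩
      exact ⟨x + y, by rw [map_add, map_add, hx, hy]⟩
  have hinj : Function.Injective φ' := by
    rw [← LieHom.ker_eq_bot]
    refine (LieAlgebra.IsSimple.eq_bot_or_eq_top φ'.ker).resolve_right fun h => ?_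
    obtain ⟨y, hy⟩ := exists_ne (0 : 𝔤')
    obtain ⟨x, rfl⟩ := hsurj y
    exact hy (LieHom.mem_ker.1 (h ▸ LieSubmodule.mem_top x))
  refine ⟨χ, LieEquiv.ofBijective φ' ⟨hinj, hsurj⟩, hχ0, fun l x hx => ?_⟩
  have h1 := hψ₁ ⟨_, loopMk_mem ζ m σ hσ hσm 𝔥 hx⟩
  exact h1.symm.trans (hφ' l x hx)

end Untwist

/-! ### Diagonal automorphisms and powers of tuples -/

section Aut

variable {k : Type*} [Field k] {L : Type*} [LieRing L] [LieAlgebra k L]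

theorem LieGrading.exists_aut {Λ : Type*} [AddCommGroup Λ] (B : LieGrading k Λ L) (χ : Λ → k)
    (h0 : ∀ a, χ a ≠ 0) (hadd : ∀ a b, χ (a + b) = χ a * χ b) :
    ∃ τ : L ≃ₗ⁅k⁆ L, ∀ a, ∀ x ∈ B.comp a, τ x = χ a • x := by
  obtain ⟨f, hf⟩ := B.exists_lieHom (fun a => χ a • LinearMap.id) (fun a b x _ y _ => by
    simp only [LinearMap.smul_apply, LinearMap.id_apply]
    rw [hadd, smul_lie, lie_smul, smul_smul])
  obtain ⟨g, hg⟩ := B.exists_lieHom (fun a => (χ a)⁻¹ • LinearMap.id) (fun a b x _ y _ => by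
    simp only [LinearMap.smul_apply, LinearMap.id_apply]
    rw [hadd, smul_lie, lie_smul, smul_smul, mul_inv])
  have hf : ∀ a, ∀ x ∈ B.comp a, f x = χ a • x := hf
  have hg : ∀ a, ∀ x ∈ B.comp a, g x = (χ a)⁻¹ • x := hg
  have h1 : (g : L →ₗ[k] L).comp (f : L →ₗ[k] L) = LinearMap.id := by
    refine linearMap_ext_iSup B.iSup_eq_top fun a x hx => ?_
    change g (f x) = x
    rw [hf a x hx, map_smul, hg a x hx, smul_smul, mul_inv_cancel₀ (h0 a), one_smul]
  have h2 : (f : L →ₗ[k] L).comp (g : L →ₗ[k] L) = LinearMap.id := by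
    refine linearMap_ext_iSup B.iSup_eq_top fun a x hx => ?_
    change f (g x) = x
    rw [hg a x hx, map_smul, hf a x hx, smul_smul, inv_mul_cancel₀ (h0 a), one_smul]
  refine ⟨{ f with
    invFun := g
    left_inv := fun x => LinearMap.congr_fun h1 x
    right_inv := fun x => LinearMap.congr_fun h2 x }, hf⟩

theorem aut_zpow_apply {f : L ≃ₗ⁅k⁆ L} {x : L} {c : k} (hc : c ≠ 0) (h : f x = c • x) (z : ℤ) :
    (f ^ z) x = c ^ z • x := by
  have h1 : ∀ N : ℕ, (f ^ N) x = c ^ N • x := by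
    intro N
    induction N with
    | zero => simp
    | succ N ih => rw [pow_succ, aut_mul_apply, h, map_smul, ih, smul_smul, pow_succ, mul_comm]
  obtain ⟨N, rfl | rfl⟩ := z.eq_nat_or_neg
  · rw [zpow_natCast, zpow_natCast, h1]
  · have h2 : (f ^ (-(N : ℤ))) ((f ^ N) x) = x := by
      rw [← aut_mul_apply, zpow_neg, zpow_natCast, inv_mul_cancel]
      rfl
    rw [h1, map_smul] at h2
    conv_rhs => rw [← h2]
    rw [smul_smul, ← zpow_natCast, ← zpow_add₀ hc, neg_add_cancel, zpow_zero, one_smul]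

theorem tuplePow_apply (ζ : CompatibleRoots k) {n : ℕ} (f : Fin n → (L ≃ₗ⁅k⁆ L))
    (P : Matrix.GeneralLinearGroup (Fin n) ℤ) {x : L} {q : Fin n → ℚ}
    (h : ∀ i, f i x = ζ.ratPow (q i) • x) (j : Fin n) :
    tuplePow f P j x = ζ.ratPow (∑ i, (P.1 i j : ℚ) * q i) • x := by
  have h1 : ∀ l : List (Fin n), ((l.map fun i => f i ^ (P.1 i j)).prod) x =
      ((l.map fun i => ζ.ratPow ((P.1 i j : ℚ) * q i)).prod) • x := by
    intro l
    induction l with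
    | nil => simp
    | cons i l ih =>
      rw [List.map_cons, List.prod_cons, aut_mul_apply, ih, map_smul,
        aut_zpow_apply (ζ.ratPow_ne_zero _) (h i), ← ζ.ratPow_intMul, smul_smul, List.map_cons,
        List.prod_cons, mul_comm]
  rw [tuplePow, List.ofFn_eq_map, h1, ζ.ratPow_sum, ← List.prod_ofFn, List.ofFn_eq_map]

end Aut

/-! ### Extracting `P` and `s` from a map of degrees -/

section Factor

theorem exists_factor_fst {Q Λ X : Type*} [AddCommGroup Q] [AddCommGroup Λ] [AddCommGroup X]
    (M : AddSubgroup (Q × Λ)) (D : M →+ X) (hker : ∀ a : M, a.1.1 = 0 → D a = 0)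
    (hsurj : ∀ α, ∃ l, (α, l) ∈ M) : ∃ E : Q →+ X, ∀ a : M, E a.1.1 = D a := by
  have h1 : ∀ a b : M, a.1.1 = b.1.1 → D a = D b := by
    intro a b h
    rw [← sub_eq_zero, ← map_sub]
    exact hker _ (sub_eq_zero.2 h)
  choose l hl using hsurj
  refine ⟨AddMonoidHom.mk' (fun α => D ⟨(α, l α), hl α⟩) fun α β => ?_, fun a => h1 _ _ rfl⟩
  rw [← map_add]
  exact h1 _ _ rfl

theorem scale_injective {n : ℕ} (m : Fin n → ℕ+) : Function.Injective (scale m) := by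
  intro a b hab
  ext i
  have := congrFun hab i
  rw [scale_apply, scale_apply] at this
  exact mul_left_cancel₀ (by exact_mod_cast (m i).ne_zero) this

theorem exists_scaleHom {n : ℕ} {m : Fin n → ℕ+} {M : Type*} [AddCommGroup M]
    (F : M →+ (Fin n → ℤ)) (S : (Fin n → ℤ) →+ M) (h : ∀ μ, ∃ ν, F (S μ) = scale m ν) :
    ∃ A : (Fin n → ℤ) →+ (Fin n → ℤ), ∀ μ, F (S μ) = scale m (A μ) := by
  choose A hA using h
  exact ⟨AddMonoidHom.mk' A fun a b => scale_injective m (by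
    rw [map_add, ← hA, ← hA, ← hA, map_add, map_add]), hA⟩

/-- A surjective endomorphism of `ℤ^n` is bijective. The matrix is transposed because the index `i`
of `p_ij` is the one summed against `μ`. -/
theorem exists_generalLinearGroup {n : ℕ} (A : (Fin n → ℤ) →+ (Fin n → ℤ))
    (hA : Function.Surjective A) :
    ∃ P : Matrix.GeneralLinearGroup (Fin n) ℤ, ∀ μ j, A μ j = ∑ i, P.1 i j * μ i := by
  let f : (Fin n → ℤ) →ₗ[ℤ] (Fin n → ℤ) := A.toIntLinearMap
  let e := LinearEquiv.ofBijective f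
    ⟨OrzechProperty.injective_of_surjective_endomorphism f hA, hA⟩
  have h1 : (e : (Fin n → ℤ) →ₗ[ℤ] (Fin n → ℤ)).comp e.symm.toLinearMap = LinearMap.id :=
    LinearMap.ext fun x => e.apply_symm_apply x
  have h2 : e.symm.toLinearMap.comp (e : (Fin n → ℤ) →ₗ[ℤ] (Fin n → ℤ)) = LinearMap.id :=
    LinearMap.ext fun x => e.symm_apply_apply x
  refine ⟨⟨(LinearMap.toMatrix' e.toLinearMap).transpose,
    (LinearMap.toMatrix' e.symm.toLinearMap).transpose, ?_, ?_⟩, fun μ j => ?_⟩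
  · rw [← Matrix.transpose_mul, ← LinearMap.toMatrix'_comp, h2, LinearMap.toMatrix'_id,
      Matrix.transpose_one]
  · rw [← Matrix.transpose_mul, ← LinearMap.toMatrix'_comp, h1, LinearMap.toMatrix'_id,
      Matrix.transpose_one]
  · have h3 : A μ = (LinearMap.toMatrix' e.toLinearMap).mulVec μ := by
      rw [LinearMap.toMatrix'_mulVec]
      rfl
    rw [h3]
    rfl

/-- Let `D` be the defect `F / m'` minus `∑ p_ij l_i / m_i`. It vanishes on the degrees `(0, mμ)` by
the choice of `P`, hence on all `(0, l)` in `M`, since a multiple of these is of that form and `ℚ^n`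
is torsion-free. So `D` factors through `Q`, and `s` is minus this factor times `P⁻¹`. -/
theorem exists_rational_shift {Q : Type*} [AddCommGroup Q] {n : ℕ} {m m' : Fin n → ℕ+}
    {M : AddSubgroup (Q × (Fin n → ℤ))} (F : M →+ (Fin n → ℤ)) (S : (Fin n → ℤ) →+ M)
    (hS : ∀ μ, (S μ).1 = (0, scale m μ)) (A : (Fin n → ℤ) →+ (Fin n → ℤ))
    (hA : ∀ μ, F (S μ) = scale m' (A μ)) (hAsurj : Function.Surjective A)
    (hM : ∀ α, ∃ l, (α, l) ∈ M) :
    ∃ (s : Q →+ (Fin n → ℚ)) (P : Matrix.GeneralLinearGroup (Fin n) ℤ), ∀ (a : M) j,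
      ∑ i, (P.1 i j : ℚ) * ((a.1.2 i : ℚ) / (m i : ℕ) - s a.1.1 i) =
        (F a j : ℚ) / (m' j : ℕ) := by
  obtain ⟨P, hP⟩ := exists_generalLinearGroup A hAsurj
  obtain ⟨D, hD⟩ : ∃ D : M →+ (Fin n → ℚ), ∀ a j,
      D a j = (F a j : ℚ) / (m' j : ℕ) - ∑ i, (P.1 i j : ℚ) * ((a.1.2 i : ℚ) / (m i : ℕ)) :=
    ⟨AddMonoidHom.mk' (fun a j => (F a j : ℚ) / (m' j : ℕ) - ∑ i, (P.1 i j : ℚ) * ((a.1.2 i : ℚ) / (m i : ℕ)))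
    (fun a b => by
      ext j
      simp only [map_add, Pi.add_apply, AddSubgroup.coe_add, Prod.snd_add, Int.cast_add, add_div,
        mul_add, Finset.sum_add_distrib]
      ring), fun _ _ => rfl⟩
  have hDS : ∀ μ, D (S μ) = 0 := by
    intro μ
    ext j
    rw [hD, hS]
    have h1 := hP μ j
    have h2 : (F (S μ) j : ℚ) / (m' j : ℕ) = A μ j := by
      rw [hA, scale_apply]
      have : ((m' j : ℕ) : ℚ) ≠ 0 := by exact_mod_cast (m' j).ne_zero
      push_cast
      field_simp
    rw [h2, Pi.zero_apply, sub_eq_zero]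
    have h3 : ((A μ j : ℤ) : ℚ) = ((∑ i, P.1 i j * μ i : ℤ) : ℚ) := congrArg _ h1
    rw [h3, Int.cast_sum]
    refine Finset.sum_congr rfl fun i _ => ?_
    change _ = (P.1 i j : ℚ) * ((scale m μ i : ℚ) / (m i : ℕ))
    rw [scale_apply]
    have : ((m i : ℕ) : ℚ) ≠ 0 := by exact_mod_cast (m i).ne_zero
    push_cast
    field_simp
  obtain ⟨E, hE⟩ := exists_factor_fst _ D (by
    intro a ha
    -- With `α = 0`, multiplying the degree by `∏ m_i` makes its `i`-th coordinate a multiple of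
    -- `m_i`.
    have h1 : (∏ i, (m i : ℕ)) • a = S fun i => (∏ j ∈ Finset.univ.erase i, (m j : ℕ)) * a.1.2 i := by
      refine Subtype.ext (Prod.ext ?_ (funext fun i => ?_))
      · rw [hS]
        change (∏ i, (m i : ℕ)) • a.1.1 = 0
        rw [ha, smul_zero]
      · rw [hS]
        change (∏ i, (m i : ℕ)) • a.1.2 i = (m i : ℕ) * ((∏ j ∈ Finset.univ.erase i, (m j : ℕ) : ℕ) * a.1.2 i)
        rw [← Finset.mul_prod_erase _ _ (Finset.mem_univ i), nsmul_eq_mul]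
        push_cast
        ring
    have h2 := congrArg D h1
    rw [hDS, map_nsmul] at h2
    refine (smul_eq_zero.1 h2).resolve_left ?_
    exact Finset.prod_ne_zero_iff.2 fun i _ => (m i).ne_zero)
    hM
  let Pq : Matrix (Fin n) (Fin n) ℚ := P.1.map (Int.castRingHom ℚ)
  let Rq : Matrix (Fin n) (Fin n) ℚ := P⁻¹.1.map (Int.castRingHom ℚ)
  have hRP : Rq * Pq = 1 := by
    rw [← Matrix.map_mul, ← Units.val_mul, inv_mul_cancel]
    simp
  obtain ⟨s, hs₀⟩ : ∃ s : Q →+ (Fin n → ℚ),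
      ∀ α, s α = -(Matrix.vecMul (E α) Rq) :=
    ⟨AddMonoidHom.mk' (fun α => -(Matrix.vecMul (E α) Rq)) fun α β => by
      rw [map_add, Matrix.add_vecMul, neg_add], fun _ => rfl⟩
  refine ⟨s, P, fun a j => ?_⟩
  have h1 : ∑ i, (P.1 i j : ℚ) * s a.1.1 i = -(E a.1.1 j) := by
    have h2 : Matrix.vecMul (s a.1.1) Pq = -(E a.1.1) := by
      rw [hs₀, Matrix.neg_vecMul, Matrix.vecMul_vecMul, hRP, Matrix.vecMul_one]
    have h3 := congrFun h2 j
    rw [Pi.neg_apply] at h3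
    rw [← h3]
    simp only [Matrix.vecMul, dotProduct]
    exact Finset.sum_congr rfl fun i _ => mul_comm _ _
  simp only [mul_sub, Finset.sum_sub_distrib]
  rw [h1, hE, hD]
  ring

end Factor

/-! ### Graded isomorphisms yield condition (b) -/

section GradedIso

variable {k : Type*} [Field k] [IsAlgClosed k] [CharZero k]

/-- The root space decomposition as a grading. -/
def rootGrading (ζ : CompatibleRoots k) {𝔤 : Type*} [LieRing 𝔤] [LieAlgebra k 𝔤]
    [FiniteDimensional k 𝔤] [LieAlgebra.IsKilling k 𝔤] {n : ℕ} (m : Fin n → ℕ+)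
    (σ : Fin n → (𝔤 ≃ₗ⁅k⁆ 𝔤)) (hσ : ∀ i j, σ i * σ j = σ j * σ i)
    (hσm : ∀ i, σ i ^ (m i : ℕ) = 1) (𝔥 : LieSubalgebra k (fixed σ)) [𝔥.IsCartanSubalgebra] :
    LieGrading k (rootLattice σ 𝔥) 𝔤 where
  comp α := rootSpace σ 𝔥 α
  indep := iSupIndep_rootSpace σ 𝔥
  iSup_eq_top := by
    rw [eq_top_iff, ← iSup_homComp_eq_top ζ m σ hσ hσm 𝔥]
    exact iSup_le fun p => inf_le_left.trans
      (le_iSup (fun α : rootLattice σ 𝔥 => rootSpace σ 𝔥 α) p.1)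
  lie_mem {a b x y} hx hy h := by
    rw [leibniz_lie, hx h, hy h, smul_lie, lie_smul, ← add_smul]
    rfl

variable (ζ : CompatibleRoots k)
  {𝔤 : Type*} [LieRing 𝔤] [LieAlgebra k 𝔤] [FiniteDimensional k 𝔤] [LieAlgebra.IsSimple k 𝔤]
  {𝔤' : Type*} [LieRing 𝔤'] [LieAlgebra k 𝔤'] [FiniteDimensional k 𝔤'] [LieAlgebra.IsSimple k 𝔤']
  {n : ℕ} {m : Fin n → ℕ+} {σ : Fin n → (𝔤 ≃ₗ⁅k⁆ 𝔤)}
  {𝔥 : LieSubalgebra k (fixed σ)} {m' : Fin n → ℕ+} {σ' : Fin n → (𝔤' ≃ₗ⁅k⁆ 𝔤')}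
  {𝔥' : LieSubalgebra k (fixed σ')}

omit [IsAlgClosed k] [CharZero k] [FiniteDimensional k 𝔤] [LieAlgebra.IsSimple k 𝔤] in
theorem mul_apply_of_mem_homComp {s : rootLattice σ 𝔥 →+ (Fin n → ℚ)} {τ : Fin n → (𝔤 ≃ₗ⁅k⁆ 𝔤)}
    (hτ : ∀ (i : Fin n) (α : rootLattice σ 𝔥), ∀ x ∈ rootSpace σ 𝔥 α,
      τ i x = ζ.ratPow (-(s α i)) • x) {p : rootLattice σ 𝔥 × (Fin n → ℤ)} {x : 𝔤}
    (hx : x ∈ homComp ζ m σ 𝔥 p) (i : Fin n) :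
    (τ i * σ i) x = ζ.ratPow ((p.2 i : ℚ) / (m i : ℕ) - s p.1 i) • x := by
  rw [aut_mul_apply, hx.2 i, map_smul, hτ i _ x hx.1, ← ζ.ratPow_div, smul_smul, ← ζ.ratPow_add,
    sub_eq_add_neg]

/-- The element `φ(x) ⊗ t^l` lies in the sum of the `Φ(L^a)` with `F a = l`. Evaluating at `1` and
applying `φ⁻¹` returns `x` and sends each `Φ(L^a)` into the corresponding component of `𝔤`. -/
theorem mem_iSup_homComp_of_mem (hσ : ∀ i j, σ i * σ j = σ j * σ i)
    (hσm : ∀ i, σ i ^ (m i : ℕ) = 1) [𝔥.IsCartanSubalgebra]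
    (hσ' : ∀ i j, σ' i * σ' j = σ' j * σ' i) (hσm' : ∀ i, σ' i ^ (m' i : ℕ) = 1)
    [𝔥'.IsCartanSubalgebra] (Φ : multiloop ζ m σ 𝔥 ≃ₗ⁅k⁆ multiloop ζ m' σ' 𝔥')
    {χ : (Fin n → ℤ) → k} {φ : 𝔤 ≃ₗ⁅k⁆ 𝔤'} (hφ : ∀ l x (hx : x ∈ eigenComp ζ m σ l),
      loopEval (k := k) (Φ ⟨loopMk l x, loopMk_mem ζ m σ hσ hσm 𝔥 hx⟩).1 = χ l • φ x)
    (F : (multiloopGrading ζ m σ 𝔥).suppGroup → (Fin n → ℤ))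
    (hF : ∀ a : (multiloopGrading ζ m σ 𝔥).suppGroup, ∀ x ∈ (multiloopGrading ζ m σ 𝔥).comp a,
      Φ x ∈ (multiloopGrading ζ m' σ' 𝔥').second.comp (F a)) {l : Fin n → ℤ} {x : 𝔤}
    (hx : φ x ∈ eigenComp ζ m' σ' l) :
    x ∈ ⨆ a ∈ {a | F a = l}, homComp ζ m σ 𝔥 a := by
  let z : multiloop ζ m' σ' 𝔥' := ⟨_, loopMk_mem ζ m' σ' hσ' hσm' 𝔥' hx⟩
  have h2 : z ∈ (multiloopGrading ζ m' σ' 𝔥').second.comp l :=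
    (mem_second_comp ζ m' σ' hσ' hσm' 𝔥').2 ⟨_, hx, rfl⟩
  rw [LieGrading.map_comp_eq _ _ Φ F hF] at h2
  let T : multiloop ζ m' σ' 𝔥' →ₗ[k] 𝔤 := φ.symm.toLinearEquiv.toLinearMap.comp
    ((loopEval (k := k)).comp (multiloop ζ m' σ' 𝔥').incl).toLinearMap
  have h3 : (⨆ (a : (multiloopGrading ζ m σ 𝔥).suppGroup) (_ : F a = l),
      ((multiloopGrading ζ m σ 𝔥).comp a).map (Φ.toLinearEquiv : _ →ₗ[k] _)) ≤
      (⨆ a ∈ {a | F a = l}, homComp ζ m σ 𝔥 a).comap T := by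
    refine iSup₂_le fun a ha => ?_
    rintro _ ⟨w, hw, rfl⟩
    obtain ⟨x, hx, hxw⟩ := mem_multiloopGrading_comp.1 hw
    obtain rfl : ⟨_, loopMk_mem ζ m σ hσ hσm 𝔥 hx.2⟩ = w := Subtype.ext hxw
    have h4 : T (Φ ⟨_, loopMk_mem ζ m σ hσ hσm 𝔥 hx.2⟩) = χ a.1.2 • x := by
      change φ.symm (loopEval (k := k) (Φ _).1) = _
      rw [hφ _ x hx.2, map_smul, LieEquiv.symm_apply_apply]
    refine Submodule.mem_comap.2 (h4 ▸ ?_ : T (Φ ⟨_, loopMk_mem ζ m σ hσ hσm 𝔥 hx.2⟩) ∈ _)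
    exact Submodule.smul_mem _ _ (Submodule.mem_iSup_of_mem a (Submodule.mem_iSup_of_mem ha hx))
  have h5 := h3 h2
  have h6 : T z = x := by
    change φ.symm (loopEval (k := k) (loopMk l (φ x))) = x
    rw [loopEval_mk, LieEquiv.symm_apply_apply]
  rwa [Submodule.mem_comap, h6] at h5

-- The common source of (b) from (a) and from (c): only the `ℤ^n`-degree of the image is controlled,
-- by an additive `F`. That suffices because (b) does not mention `𝔥'`.
set_option maxHeartbeats 400000 in
theorem exists_tuplePow_of_graded (hσ : ∀ i j, σ i * σ j = σ j * σ i)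
    (hσm : ∀ i, σ i ^ (m i : ℕ) = 1) [𝔥.IsCartanSubalgebra]
    (hσ' : ∀ i j, σ' i * σ' j = σ' j * σ' i) (hσm' : ∀ i, σ' i ^ (m' i : ℕ) = 1)
    [𝔥'.IsCartanSubalgebra] (Φ : multiloop ζ m σ 𝔥 ≃ₗ⁅k⁆ multiloop ζ m' σ' 𝔥')
    (F : (multiloopGrading ζ m σ 𝔥).suppGroup →+ (Fin n → ℤ))
    (hF : ∀ a : (multiloopGrading ζ m σ 𝔥).suppGroup, ∀ x ∈ (multiloopGrading ζ m σ 𝔥).comp a,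
      Φ x ∈ (multiloopGrading ζ m' σ' 𝔥').second.comp (F a)) :
    ∃ (s : rootLattice σ 𝔥 →+ (Fin n → ℚ)) (P : Matrix.GeneralLinearGroup (Fin n) ℤ)
      (φ : 𝔤 ≃ₗ⁅k⁆ 𝔤') (τ : Fin n → (𝔤 ≃ₗ⁅k⁆ 𝔤)),
      (∀ (i : Fin n) (α : rootLattice σ 𝔥), ∀ x ∈ rootSpace σ 𝔥 α,
        τ i x = ζ.ratPow (-(s α i)) • x) ∧
      ∀ j, σ' j = conj φ (tuplePow (fun i => τ i * σ i) P j) := by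
  have hnt := nontrivial_of_isSimple k 𝔤
  obtain ⟨χ, φ, hχ0, hφ⟩ := exists_untwist ζ hσ hσm hσ' hσm' Φ
  have hφF : ∀ (a : (multiloopGrading ζ m σ 𝔥).suppGroup) (x : 𝔤), x ∈ homComp ζ m σ 𝔥 a →
      φ x ∈ eigenComp ζ m' σ' (F a) := by
    intro a x hx
    have h1 := hF a ⟨loopMk a.1.2 x, loopMk_mem_of_homComp hx⟩
      (mem_multiloopGrading_comp.2 ⟨x, hx, rfl⟩)
    obtain ⟨y, hy, hyΦ⟩ := (mem_second_comp ζ m' σ' hσ' hσm' 𝔥').1 h1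
    have h2 := hφ _ x hx.2
    rw [← hyΦ, loopEval_mk] at h2
    rw [h2] at hy
    have h3 := Submodule.smul_mem _ (χ a.1.2)⁻¹ hy
    rwa [smul_smul, inv_mul_cancel₀ (hχ0 _), one_smul] at h3
  obtain ⟨S, hS⟩ : ∃ S : (Fin n → ℤ) →+ (multiloopGrading ζ m σ 𝔥).suppGroup,
      ∀ μ, (S μ).1 = (0, scale m μ) :=
    ⟨AddMonoidHom.mk' (fun μ => ⟨(0, scale m μ), scale_mem_suppGroup ζ m σ hσ hσm 𝔥 μ⟩)
      fun a b => Subtype.ext (Prod.ext (add_zero 0).symm (map_add (scale m) a b)), fun _ => rfl⟩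
  obtain ⟨p₀, hp₀⟩ := exists_homComp_ne_bot ζ m σ hσ hσm 𝔥
  obtain ⟨x₀, hx₀, hx₀0⟩ := (Submodule.ne_bot_iff _).1 hp₀
  let a₀ : (multiloopGrading ζ m σ 𝔥).suppGroup := ⟨p₀, mem_suppGroup_of_homComp hp₀⟩
  have hφx₀ : φ x₀ ≠ 0 := fun h => hx₀0 (φ.injective (h.trans (map_zero φ).symm))
  -- The same nonzero vector `φ x₀` has degrees `F a₀` and `F a₀ + F (S μ)`, which must agree modulo
  -- `m'`.
  have hA : ∀ μ, ∃ ν, F (S μ) = scale m' ν := by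
    intro μ
    have h1 := hφF a₀ x₀ hx₀
    have h2 : φ x₀ ∈ eigenComp ζ m' σ' (F (a₀ + S μ)) := by
      refine hφF (a₀ + S μ) x₀ ?_
      rw [AddSubgroup.coe_add, hS, homComp_add_scale]
      exact hx₀
    obtain ⟨ν, hν⟩ := exists_scale_of_mem hφx₀ h1 h2
    rw [F.map_add, add_right_inj] at hν
    exact ⟨ν, hν⟩
  obtain ⟨A, hA⟩ := exists_scaleHom F S hA
  -- Surjectivity of `Φ` enters here: `φ x₀` also has degree `F a₀ + m' ν`, so it arises from some
  -- degree `b` with this value of `F`. Then `x₀` has both degrees `a₀` and `b`, which therefore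
  -- differ by some `(0, mμ)`.
  have hAsurj : Function.Surjective A := by
    intro ν
    have h1 : φ x₀ ∈ eigenComp ζ m' σ' (F a₀ + scale m' ν) := by
      rw [eigenComp_add_scale]
      exact hφF a₀ x₀ hx₀
    have hx := mem_iSup_homComp_of_mem ζ hσ hσm hσ' hσm' Φ hφ F hF h1
    obtain ⟨b, hb, hb2, -⟩ := exists_fiber_of_mem (iSupIndep_jointComp σ 𝔥 σ)
      (W := fun a : (multiloopGrading ζ m σ 𝔥).suppGroup => homComp ζ m σ 𝔥 a)
      (fun a => (a.1.1, fun i => ζ.root (m i) ^ a.1.2 i)) (fun a => homComp_le_jointComp a.1)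
      hx₀0 (homComp_le_jointComp _ hx₀) hx
    obtain ⟨hb3, hb4⟩ := Prod.ext_iff.1 hb2
    obtain ⟨μ, hμ⟩ := (root_zpow_eq_iff (ζ := ζ) p₀.2 b.1.2).1 fun i => (congrFun hb4 i).symm
    have h5 : b = a₀ + S μ := Subtype.ext (by
      rw [AddSubgroup.coe_add, hS]
      exact Prod.ext (hb3.trans (add_zero _).symm) hμ)
    refine ⟨μ, scale_injective m' ?_⟩
    have h6 : F b = F a₀ + scale m' ν := hb
    rw [h5, F.map_add, add_right_inj, hA] at h6
    exact h6
  obtain ⟨s, P, hs⟩ := exists_rational_shift F S hS A hA hAsurj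
    (exists_mem_suppGroup ζ m σ hσ hσm 𝔥)
  choose τ hτ using fun i => (rootGrading ζ m σ hσ hσm 𝔥).exists_aut
    (fun α => ζ.ratPow (-(s α i))) (fun α => ζ.ratPow_ne_zero _) (fun α β => by
      rw [← ζ.ratPow_add, map_add, Pi.add_apply, neg_add])
  refine ⟨s, P, φ, τ, hτ, fun j => LieEquiv.ext fun y => ?_⟩
  obtain ⟨x, rfl⟩ := φ.surjective y
  have h1 : conj φ (tuplePow (fun i => τ i * σ i) P j) (φ x) =
      φ (tuplePow (fun i => τ i * σ i) P j x) := by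
    change φ (tuplePow _ P j (φ.symm (φ x))) = _
    rw [LieEquiv.symm_apply_apply]
  refine Eq.trans ?_ h1.symm
  refine iSup_top_induction (iSup_homComp_eq_top ζ m σ hσ hσm 𝔥)
    (p := fun x => σ' j (φ x) = φ (tuplePow (fun i => τ i * σ i) P j x)) x ?_ (by simp)
    fun u v hu hv => by simp only [map_add, hu, hv]
  intro p x hx
  by_cases hx0 : x = 0
  · simp [hx0]
  have hp : homComp ζ m σ 𝔥 p ≠ ⊥ := (Submodule.ne_bot_iff _).2 ⟨x, hx, hx0⟩
  have h2 := hs ⟨p, mem_suppGroup_of_homComp hp⟩ j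
  rw [tuplePow_apply ζ _ P (mul_apply_of_mem_homComp ζ hτ hx) j, h2, ζ.ratPow_div, map_smul]
  exact hφF ⟨p, mem_suppGroup_of_homComp hp⟩ x hx j

end GradedIso

/-! ### Following degrees through a chain of regradings -/

namespace LieGrading

variable {k : Type*} [CommRing k] {Q Λ : Type*} [AddCommGroup Q] [AddCommGroup Λ]
  {L L' : Type*} [LieRing L] [LieAlgebra k L] [LieRing L'] [LieAlgebra k L']

theorem mem_second_suppGroup_of_le {B₀ B : LieGrading k (Q × Λ) L} {F : B₀.suppGroup →+ Λ}
    (hF : ∀ a : B₀.suppGroup, B₀.comp a ≤ B.comp (a.1.1, F a)) (a : B₀.suppGroup) :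
    F a ∈ B.second.suppGroup := by
  refine mem_of_closure_hom F _ (fun a ha => ?_) a
  refine B.mem_second_suppGroup (p := (a.1, F ⟨a, AddSubgroup.subset_closure ha⟩)) fun h => ha ?_
  rw [eq_bot_iff, ← h]
  exact hF ⟨a, AddSubgroup.subset_closure ha⟩

theorem comp_le_regrade {B₀ B : LieGrading k (Q × Λ) L} {F : B₀.suppGroup →+ Λ}
    (hF : ∀ a : B₀.suppGroup, B₀.comp a ≤ B.comp (a.1.1, F a)) (ρ : B.second.suppGroup →+ Λ)
    (hρ : Function.Injective ρ) (a : B₀.suppGroup) :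
    B₀.comp a ≤ (B.regrade ρ hρ).comp
      (a.1.1, ρ (F.codRestrict _ (mem_second_suppGroup_of_le hF) a)) := by
  rw [regrade_comp_apply]
  exact hF a

theorem comp_le_shift {B₀ B : LieGrading k (Q × Λ) L} {F : B₀.suppGroup →+ Λ}
    (hF : ∀ a : B₀.suppGroup, B₀.comp a ≤ B.comp (a.1.1, F a)) (s : Q →+ Λ) (a : B₀.suppGroup) :
    B₀.comp a ≤ (B.shift s).comp (a.1.1, F a - s a.1.1) := by
  change _ ≤ B.comp (a.1.1, F a - s a.1.1 + s a.1.1)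
  rw [sub_add_cancel]
  exact hF a

/-- The invariant of a chain: each original component keeps its `Q`-degree, and its new `Λ`-degree
depends additively on the original degree. A regrading composes this homomorphism with `ρ`; a shift
subtracts `s`. -/
theorem IsRegrading.exists_hom {B₀ B B' : LieGrading k (Q × Λ) L} (h : B.IsRegrading B')
    (hB : ∃ F : B₀.suppGroup →+ Λ, ∀ a : B₀.suppGroup, B₀.comp a ≤ B.comp (a.1.1, F a)) :
    ∃ F : B₀.suppGroup →+ Λ, ∀ a : B₀.suppGroup, B₀.comp a ≤ B'.comp (a.1.1, F a) := by
  obtain ⟨F, hF⟩ := hB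
  rcases h with ⟨ρ, hρ, rfl⟩ | ⟨s, rfl⟩
  · exact ⟨ρ.comp (F.codRestrict _ (mem_second_suppGroup_of_le hF)), comp_le_regrade hF ρ hρ⟩
  · exact ⟨F - s.comp ((AddMonoidHom.fst Q Λ).comp B₀.suppGroup.subtype), comp_le_shift hF s⟩

theorem comp_le_second (B : LieGrading k (Q × Λ) L) (p : Q × Λ) :
    B.comp p ≤ B.second.comp p.2 :=
  le_iSup (fun q => B.comp (q, p.2)) p.1

theorem second_comp_eq {B₀ B : LieGrading k (Q × Λ) L} {F : B₀.suppGroup → Λ}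
    (hF : ∀ a : B₀.suppGroup, B₀.comp a ≤ B.comp (a.1.1, F a)) (l : Λ) :
    B.second.comp l = ⨆ (a : B₀.suppGroup) (_ : F a = l), B₀.comp a := by
  have h := map_comp_eq B₀ B.second LieEquiv.refl F
    (fun a x hx => B.comp_le_second (a.1.1, F a) (hF a hx)) l
  rw [h]
  exact iSup_congr fun a => iSup_congr fun _ => Submodule.map_id _

theorem isogradedIso_second {Q' : Type*} [AddCommGroup Q'] {B₀ B : LieGrading k (Q × Λ) L}
    {B' : LieGrading k (Q' × Λ) L'} {F : B₀.suppGroup → Λ}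
    (hF : ∀ a : B₀.suppGroup, B₀.comp a ≤ B.comp (a.1.1, F a)) (Φ : L ≃ₗ⁅k⁆ L')
    (hΦ : ∀ a : B₀.suppGroup, ∀ x ∈ B₀.comp a, Φ x ∈ B'.second.comp (F a)) :
    B.second.IsogradedIso B'.second := by
  refine ⟨Φ, AddEquiv.refl _, fun l => ?_⟩
  rw [second_comp_eq hF, AddEquiv.refl_apply, map_comp_eq B₀ B'.second Φ F hΦ]
  simp only [Submodule.map_iSup]

end LieGrading

/-! ### (a) implies (b), and (c) implies (b) -/

section Forward

variable {k : Type*} [Field k] [IsAlgClosed k] [CharZero k] (ζ : CompatibleRoots k)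
  {𝔤 : Type*} [LieRing 𝔤] [LieAlgebra k 𝔤] [FiniteDimensional k 𝔤] [LieAlgebra.IsSimple k 𝔤]
  {𝔤' : Type*} [LieRing 𝔤'] [LieAlgebra k 𝔤'] [FiniteDimensional k 𝔤'] [LieAlgebra.IsSimple k 𝔤']
  {n : ℕ} {m : Fin n → ℕ+} {σ : Fin n → (𝔤 ≃ₗ⁅k⁆ 𝔤)}
  {𝔥 : LieSubalgebra k (fixed σ)} {m' : Fin n → ℕ+} {σ' : Fin n → (𝔤' ≃ₗ⁅k⁆ 𝔤')}
  {𝔥' : LieSubalgebra k (fixed σ')}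

theorem exists_tuplePow_of_supportIso (hσ : ∀ i j, σ i * σ j = σ j * σ i)
    (hσm : ∀ i, σ i ^ (m i : ℕ) = 1) [𝔥.IsCartanSubalgebra]
    (hσ' : ∀ i j, σ' i * σ' j = σ' j * σ' i) (hσm' : ∀ i, σ' i ^ (m' i : ℕ) = 1)
    [𝔥'.IsCartanSubalgebra]
    (h : (multiloopGrading ζ m σ 𝔥).SupportIso (multiloopGrading ζ m' σ' 𝔥')) :
    ∃ (s : rootLattice σ 𝔥 →+ (Fin n → ℚ)) (P : Matrix.GeneralLinearGroup (Fin n) ℤ)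
      (φ : 𝔤 ≃ₗ⁅k⁆ 𝔤') (τ : Fin n → (𝔤 ≃ₗ⁅k⁆ 𝔤)),
      (∀ (i : Fin n) (α : rootLattice σ 𝔥), ∀ x ∈ rootSpace σ 𝔥 α,
        τ i x = ζ.ratPow (-(s α i)) • x) ∧
      ∀ j, σ' j = conj φ (tuplePow (fun i => τ i * σ i) P j) := by
  obtain ⟨Φ, f, hf⟩ := h
  refine exists_tuplePow_of_graded ζ hσ hσm hσ' hσm' Φ
    ((AddMonoidHom.snd _ _).comp ((multiloopGrading ζ m' σ' 𝔥').suppGroup.subtype.comp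
      f.toAddMonoidHom)) fun a x hx => ?_
  have h1 : Φ x ∈ (multiloopGrading ζ m' σ' 𝔥').comp (f a) := by
    rw [← hf a]
    exact ⟨x, hx, rfl⟩
  exact LieGrading.comp_le_second _ _ h1

theorem exists_tuplePow_of_regradings (hσ : ∀ i j, σ i * σ j = σ j * σ i)
    (hσm : ∀ i, σ i ^ (m i : ℕ) = 1) [𝔥.IsCartanSubalgebra]
    (hσ' : ∀ i j, σ' i * σ' j = σ' j * σ' i) (hσm' : ∀ i, σ' i ^ (m' i : ℕ) = 1)
    [𝔥'.IsCartanSubalgebra] {p : ℕ} (B : Fin (p + 1) →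
      LieGrading k (rootLattice σ 𝔥 × (Fin n → ℤ)) (multiloop ζ m σ 𝔥))
    (h0 : B 0 = multiloopGrading ζ m σ 𝔥)
    (hlast : (B (Fin.last p)).second.IsogradedIso (multiloopGrading ζ m' σ' 𝔥').second)
    (hstep : ∀ i : Fin p, (B i.castSucc).IsRegrading (B i.succ)) :
    ∃ (s : rootLattice σ 𝔥 →+ (Fin n → ℚ)) (P : Matrix.GeneralLinearGroup (Fin n) ℤ)
      (φ : 𝔤 ≃ₗ⁅k⁆ 𝔤') (τ : Fin n → (𝔤 ≃ₗ⁅k⁆ 𝔤)),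
      (∀ (i : Fin n) (α : rootLattice σ 𝔥), ∀ x ∈ rootSpace σ 𝔥 α,
        τ i x = ζ.ratPow (-(s α i)) • x) ∧
      ∀ j, σ' j = conj φ (tuplePow (fun i => τ i * σ i) P j) := by
  have h1 : ∀ i : Fin (p + 1), ∃ F : (multiloopGrading ζ m σ 𝔥).suppGroup →+ (Fin n → ℤ),
      ∀ a : (multiloopGrading ζ m σ 𝔥).suppGroup,
        (multiloopGrading ζ m σ 𝔥).comp a ≤ (B i).comp (a.1.1, F a) := by
    intro i
    induction i using Fin.induction with
    | zero =>
      rw [h0]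
      exact ⟨(AddMonoidHom.snd _ _).comp (multiloopGrading ζ m σ 𝔥).suppGroup.subtype,
        fun a => le_rfl⟩
    | succ i ih => exact (hstep i).exists_hom ih
  obtain ⟨F, hF⟩ := h1 (Fin.last p)
  obtain ⟨Φ, f, hf⟩ := hlast
  refine exists_tuplePow_of_graded ζ hσ hσm hσ' hσm' Φ (f.toAddMonoidHom.comp F) fun a x hx => ?_
  have h2 := LieGrading.comp_le_second _ _ (hF a hx)
  change Φ x ∈ (multiloopGrading ζ m' σ' 𝔥').second.comp (f (F a))
  rw [← hf]
  exact ⟨x, h2, rfl⟩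

end Forward

/-! ### Exponents of the twisted tuple -/

section TwistWeight

variable {Q : Type*} [AddCommGroup Q] {n : ℕ} (m : Fin n → ℕ+) (s : Q →+ (Fin n → ℚ))
  (P : Matrix.GeneralLinearGroup (Fin n) ℤ)

/-- The exponents by which `(τ σ) ^ P` acts on the component of degree `(α, l)`. -/
def twistWeight : Q × (Fin n → ℤ) →+ (Fin n → ℚ) where
  toFun p j := ∑ i, (P.1 i j : ℚ) * ((p.2 i : ℚ) / (m i : ℕ) - s p.1 i)
  map_zero' := by
    ext j
    simp
  map_add' p q := by
    ext j
    rw [Pi.add_apply, ← Finset.sum_add_distrib]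
    refine Finset.sum_congr rfl fun i _ => ?_
    rw [Prod.snd_add, Prod.fst_add, map_add, Pi.add_apply, Pi.add_apply]
    push_cast
    ring

theorem twistWeight_apply (p : Q × (Fin n → ℤ)) (j : Fin n) : twistWeight m s P p j =
    ∑ i, (P.1 i j : ℚ) * ((p.2 i : ℚ) / (m i : ℕ) - s p.1 i) := rfl

theorem twistWeight_scale (μ : Fin n → ℤ) (j : Fin n) :
    twistWeight m s P (0, scale m μ) j = ((∑ i, P.1 i j * μ i : ℤ) : ℚ) := by
  rw [twistWeight_apply, Int.cast_sum]
  refine Finset.sum_congr rfl fun i _ => ?_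
  change (P.1 i j : ℚ) * ((scale m μ i : ℚ) / (m i : ℕ) - s 0 i) = _
  have : ((m i : ℕ) : ℚ) ≠ 0 := by exact_mod_cast (m i).ne_zero
  rw [scale_apply, map_zero, Pi.zero_apply, sub_zero]
  push_cast
  field_simp

theorem sum_twistWeight (p : Q × (Fin n → ℤ)) (i : Fin n) :
    ∑ j, ((P⁻¹).1 j i : ℚ) * twistWeight m s P p j = (p.2 i : ℚ) / (m i : ℕ) - s p.1 i := by
  let w : Fin n → ℚ := fun i => (p.2 i : ℚ) / (m i : ℕ) - s p.1 i
  let Pq : Matrix (Fin n) (Fin n) ℚ := P.1.map (Int.castRingHom ℚ)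
  let Rq : Matrix (Fin n) (Fin n) ℚ := P⁻¹.1.map (Int.castRingHom ℚ)
  have hPR : Pq * Rq = 1 := by
    rw [← Matrix.map_mul, ← Units.val_mul, mul_inv_cancel]
    simp
  have h1 : twistWeight m s P p = Matrix.vecMul w Pq := by
    ext j
    rw [twistWeight_apply]
    simp only [Matrix.vecMul, dotProduct]
    exact Finset.sum_congr rfl fun i _ => mul_comm _ _
  have h2 : Matrix.vecMul (twistWeight m s P p) Rq = w := by
    rw [h1, Matrix.vecMul_vecMul, hPR, Matrix.vecMul_one]
  refine Eq.trans ?_ (congrFun h2 i)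
  simp only [Matrix.vecMul, dotProduct]
  exact Finset.sum_congr rfl fun i _ => mul_comm _ _

theorem exists_sum_mul_eq (ν : Fin n → ℤ) : ∃ μ : Fin n → ℤ, ∀ j, ∑ i, P.1 i j * μ i = ν j := by
  refine ⟨Matrix.vecMul ν (P⁻¹).1, fun j => ?_⟩
  have h1 : Matrix.vecMul (Matrix.vecMul ν (P⁻¹).1) P.1 = ν := by
    rw [Matrix.vecMul_vecMul, ← Units.val_mul, inv_mul_cancel, Units.val_one, Matrix.vecMul_one]
  conv_rhs => rw [← h1]
  exact Finset.sum_congr rfl fun i _ => mul_comm _ _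

theorem eq_of_twistWeight_eq {p q : Q × (Fin n → ℤ)} (h1 : p.1 = q.1)
    (h : twistWeight m s P p = twistWeight m s P q) : p = q := by
  refine Prod.ext h1 (funext fun i => ?_)
  have h2 := (sum_twistWeight m s P p i).symm.trans (h ▸ sum_twistWeight m s P q i)
  rw [h1, sub_left_inj] at h2
  have : ((m i : ℕ) : ℚ) ≠ 0 := by exact_mod_cast (m i).ne_zero
  field_simp at h2
  exact_mod_cast h2

/-- For `α = 0` the weight is `l / m` transformed by `P`; as `P` is unimodular, it is integral only
if `l / m` is. -/
theorem exists_eq_scale_of_twistWeight {p : Q × (Fin n → ℤ)} (h1 : p.1 = 0)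
    (h : ∀ j, ∃ z : ℤ, twistWeight m s P p j = z) : ∃ μ, p = (0, scale m μ) := by
  choose ν hν using h
  obtain ⟨μ, hμ⟩ := exists_sum_mul_eq P ν
  refine ⟨μ, eq_of_twistWeight_eq m s P h1 (funext fun j => ?_)⟩
  rw [hν, twistWeight_scale, hμ]

end TwistWeight

/-! ### Transporting the Cartan subalgebra and the root lattice -/

section Transport

variable {k : Type*} [Field k] [IsAlgClosed k] [CharZero k] {ζ : CompatibleRoots k}
  {𝔤 : Type*} [LieRing 𝔤] [LieAlgebra k 𝔤] [FiniteDimensional k 𝔤] [LieAlgebra.IsSimple k 𝔤]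
  {𝔤' : Type*} [LieRing 𝔤'] [LieAlgebra k 𝔤'] [FiniteDimensional k 𝔤'] [LieAlgebra.IsSimple k 𝔤']
  {n : ℕ} {m : Fin n → ℕ+} {σ : Fin n → (𝔤 ≃ₗ⁅k⁆ 𝔤)}
  {𝔥 : LieSubalgebra k (fixed σ)} {m' : Fin n → ℕ+} {σ' : Fin n → (𝔤' ≃ₗ⁅k⁆ 𝔤')}
  {𝔥' : LieSubalgebra k (fixed σ')}
  {s : rootLattice σ 𝔥 →+ (Fin n → ℚ)} {P : Matrix.GeneralLinearGroup (Fin n) ℤ}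
  {φ : 𝔤 ≃ₗ⁅k⁆ 𝔤'}

omit [IsAlgClosed k] [CharZero k] [FiniteDimensional k 𝔤] [LieAlgebra.IsSimple k 𝔤]
  [FiniteDimensional k 𝔤'] [LieAlgebra.IsSimple k 𝔤'] in
theorem exists_int_twistWeight (hσm' : ∀ i, σ' i ^ (m' i : ℕ) = 1)
    (hφ : ∀ p, ∀ x ∈ homComp ζ m σ 𝔥 p, ∀ j,
      σ' j (φ x) = ζ.ratPow (twistWeight m s P p j) • φ x)
    {p : rootLattice σ 𝔥 × (Fin n → ℤ)} (hp : homComp ζ m σ 𝔥 p ≠ ⊥) (j : Fin n) :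
    ∃ z : ℤ, (m' j : ℕ) * twistWeight m s P p j = z := by
  obtain ⟨x, hx, hx0⟩ := (Submodule.ne_bot_iff _).1 hp
  have h1 := aut_zpow_apply (ζ.ratPow_ne_zero _) (hφ p x hx j) (m' j : ℕ)
  rw [zpow_natCast, zpow_natCast, hσm', ← ζ.ratPow_natMul] at h1
  have h2 : φ x ≠ 0 := fun h => hx0 (φ.injective (h.trans (map_zero φ).symm))
  rw [← ζ.ratPow_eq_one_iff]
  exact smul_left_injective k h2 (h1.symm.trans (one_smul k (φ x)).symm)

omit [IsAlgClosed k] [CharZero k] [FiniteDimensional k 𝔤] [LieAlgebra.IsSimple k 𝔤]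
  [FiniteDimensional k 𝔤'] [LieAlgebra.IsSimple k 𝔤'] in
theorem exists_degreeHom (hσm' : ∀ i, σ' i ^ (m' i : ℕ) = 1)
    (hφ : ∀ p, ∀ x ∈ homComp ζ m σ 𝔥 p, ∀ j,
      σ' j (φ x) = ζ.ratPow (twistWeight m s P p j) • φ x) :
    ∃ F : (multiloopGrading ζ m σ 𝔥).suppGroup →+ (Fin n → ℤ),
      ∀ a j, (F a j : ℚ) = (m' j : ℕ) * twistWeight m s P a j := by
  let G : (multiloopGrading ζ m σ 𝔥).suppGroup →+ (Fin n → ℚ) :=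
    { toFun := fun a j => (m' j : ℕ) * twistWeight m s P a j
      map_zero' := by ext j; simp
      map_add' := fun a b => by
        ext j
        rw [AddSubgroup.coe_add, map_add, Pi.add_apply, Pi.add_apply, mul_add] }
  refine exists_int_lift G ?_
  refine mem_of_closure_hom G (integralVectors n) fun a ha => ?_
  exact fun j => exists_int_twistWeight hσm' hφ ((comp_ne_bot_iff a).1 ha) j

-- The weight vanishes at degree `0`, so `φ(𝔥)` is fixed by `σ'`. Its centralizer there is the sum
-- of the `φ(𝔤_0^l)` with integral weight; these have `l ∈ m ℤ^n`, so they equal `φ(𝔤_0^0)`, which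
-- is `φ(𝔥)` because `𝔥` is its own centralizer in `𝔤^σ`.
omit [LieAlgebra.IsSimple k 𝔤'] [FiniteDimensional k 𝔤'] in
theorem isToralCartan_map (hσ : ∀ i j, σ i * σ j = σ j * σ i)
    (hσm : ∀ i, σ i ^ (m i : ℕ) = 1) [𝔥.IsCartanSubalgebra]
    (hφ : ∀ p, ∀ x ∈ homComp ζ m σ 𝔥 p, ∀ j,
      σ' j (φ x) = ζ.ratPow (twistWeight m s P p j) • φ x) :
    IsToralCartan (fixed σ') ((ambient σ 𝔥).map (φ.toLinearEquiv : 𝔤 →ₗ[k] 𝔤')) := by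
  have hH := isToralCartan_ambient ζ m σ hσ hσm 𝔥
  have h0 : ∀ x ∈ ambient σ 𝔥, x ∈ homComp ζ m σ 𝔥 0 := by
    refine fun x hx => ⟨fun h => ?_, fun i => ?_⟩
    · rw [hH.lie_eq_zero _ (mem_ambient.2 ⟨h, rfl⟩) _ hx]
      simp
    · rw [hH.le x hx i]
      simp
  refine ⟨?_, ?_, ?_, ?_⟩
  · rintro _ ⟨x, hx, rfl⟩ j
    refine (hφ 0 x (h0 x hx) j).trans ?_
    rw [map_zero, Pi.zero_apply, ζ.ratPow_zero, one_smul]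
    rfl
  · rintro _ ⟨x, hx, rfl⟩ _ ⟨y, hy, rfl⟩
    change ⁅φ x, φ y⁆ = 0
    rw [← LieEquiv.map_lie, hH.lie_eq_zero x hx y hy, map_zero]
  · intro y hy hyH
    obtain ⟨x, rfl⟩ := φ.surjective y
    refine ⟨x, ?_, rfl⟩
    let f : Fin n → (𝔤 ≃ₗ⁅k⁆ 𝔤) := fun j => conj φ.symm (σ' j)
    have hf : ∀ j u, f j u = φ.symm (σ' j (φ u)) := fun _ _ => rfl
    have h1 : x ∈ jointComp σ 𝔥 f (0, fun _ => 1) := by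
      refine ⟨fun h => ?_, fun j => ?_⟩
      · refine φ.injective ?_
        change φ ⁅((h : fixed σ) : 𝔤), x⁆ = φ ((0 : k) • x)
        rw [zero_smul, map_zero, LieEquiv.map_lie]
        exact hyH _ ⟨_, mem_ambient.2 ⟨h, rfl⟩, rfl⟩
      · have h2 : σ' j (φ x) = φ x := hy j
        rw [hf, h2, LieEquiv.symm_apply_apply, one_smul]
    rw [eq_iSup_fiber (iSupIndep_jointComp σ 𝔥 f) (W := homComp ζ m σ 𝔥)
      (fun p => (p.1, fun j => ζ.ratPow (twistWeight m s P p j))) (fun p u hu => ⟨hu.1, fun j => by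
        rw [hf, hφ p u hu j, map_smul, LieEquiv.symm_apply_apply]⟩)
      (iSup_homComp_eq_top ζ m σ hσ hσm 𝔥)] at h1
    refine (iSup₂_le fun p hp u hu => ?_ : _ ≤ ambient σ 𝔥) h1
    obtain ⟨hp1, hp2⟩ := Prod.ext_iff.1 hp
    obtain ⟨μ, rfl⟩ := exists_eq_scale_of_twistWeight m s P hp1 fun j =>
      (ζ.ratPow_eq_one_iff _).1 (congrFun hp2 j)
    have h2 : u ∈ homComp ζ m σ 𝔥 0 := by
      have h3 := homComp_add_scale (ζ := ζ) (σ := σ) (𝔥 := 𝔥) (m := m) 0 μ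
      rw [zero_add] at h3
      rwa [h3] at hu
    refine mem_cartan_of_lie σ 𝔥 (fun i => ?_) fun h hh => ?_
    · have := h2.2 i
      simpa using this
    · obtain ⟨h, rfl⟩ := mem_ambient.1 hh
      have := h2.1 h
      simpa using this
  · rintro _ ⟨h, hh, rfl⟩
    have h1 := hH.isSemisimple h hh
    refine (LinearEquiv.isSemisimple_iff _ _ φ.toLinearEquiv (LinearMap.ext fun y => ?_)).1 h1
    exact LieEquiv.map_lie φ h y

/-- The conjugating automorphism commutes with `σ'`, so composing with it leaves the eigenvalue
formula intact. -/
theorem exists_equiv_map_cartan (hσ : ∀ i j, σ i * σ j = σ j * σ i)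
    (hσm : ∀ i, σ i ^ (m i : ℕ) = 1) [𝔥.IsCartanSubalgebra]
    (hσ' : ∀ i j, σ' i * σ' j = σ' j * σ' i) (hσm' : ∀ i, σ' i ^ (m' i : ℕ) = 1)
    [𝔥'.IsCartanSubalgebra]
    (hφ : ∀ p, ∀ x ∈ homComp ζ m σ 𝔥 p, ∀ j,
      σ' j (φ x) = ζ.ratPow (twistWeight m s P p j) • φ x) :
    ∃ φ : 𝔤 ≃ₗ⁅k⁆ 𝔤', (∀ x, φ x ∈ ambient σ' 𝔥' ↔ x ∈ ambient σ 𝔥) ∧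
      ∀ p, ∀ x ∈ homComp ζ m σ 𝔥 p, ∀ j,
        σ' j (φ x) = ζ.ratPow (twistWeight m s P p j) • φ x := by
  obtain ⟨ψ, hψ, hψH⟩ := (isToralCartan_ambient ζ m' σ' hσ' hσm' 𝔥').exists_conj
    (isToralCartan_map hσ hσm hφ)
  have h1 : ∀ x, (φ.trans ψ) x = ψ (φ x) := fun _ => rfl
  refine ⟨φ.trans ψ, fun x => ?_, fun p x hx j => ?_⟩
  · rw [h1, hψH]
    constructor
    · rintro ⟨y, hy, hyx⟩
      rwa [← φ.injective hyx]
    · exact fun hx => ⟨x, hx, rfl⟩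
  · rw [h1, mem_autCentralizer.1 hψ, hφ p x hx j, map_smul]

omit [IsAlgClosed k] [CharZero k] [FiniteDimensional k 𝔤] [LieAlgebra.IsSimple k 𝔤]
  [FiniteDimensional k 𝔤'] [LieAlgebra.IsSimple k 𝔤'] in
theorem exists_rootLattice_hom (hφ𝔥 : ∀ x, φ x ∈ ambient σ' 𝔥' ↔ x ∈ ambient σ 𝔥) :
    ∃ g : rootLattice σ 𝔥 →+ rootLattice σ' 𝔥', Function.Injective g ∧
      ∀ α : rootLattice σ 𝔥, ∀ x ∈ rootSpace σ 𝔥 α, φ x ∈ rootSpace σ' 𝔥' (g α) := by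
  have h1 : ∀ h : 𝔥', ∃ u : 𝔥, φ ((u : fixed σ) : 𝔤) = ((h : fixed σ') : 𝔤') := by
    intro h
    have h2 : φ (φ.symm ((h : fixed σ') : 𝔤')) ∈ ambient σ' 𝔥' := by
      rw [LieEquiv.apply_symm_apply]
      exact mem_ambient.2 ⟨h, rfl⟩
    obtain ⟨u, hu⟩ := mem_ambient.1 ((hφ𝔥 _).1 h2)
    exact ⟨u, by rw [hu, LieEquiv.apply_symm_apply]⟩
  choose t ht using h1
  have hinj : ∀ u v : 𝔥, φ ((u : fixed σ) : 𝔤) = φ ((v : fixed σ) : 𝔤) → u = v :=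
    fun u v h => Subtype.ext (Subtype.ext (φ.injective h))
  -- `T` is the restriction of `φ⁻¹`; the map of root lattices is its transpose.
  let T : 𝔥' →ₗ[k] 𝔥 :=
    { toFun := t
      map_add' := fun a b => hinj _ _ (by
        change _ = φ (((t a : fixed σ) : 𝔤) + ((t b : fixed σ) : 𝔤))
        rw [map_add, ht, ht, ht]
        rfl)
      map_smul' := fun c a => hinj _ _ (by
        change _ = φ (c • ((t a : fixed σ) : 𝔤))
        rw [map_smul, ht, ht]
        rfl) }
  have hT : Function.Surjective T := by
    intro u
    obtain ⟨h, hh⟩ := mem_ambient.1 ((hφ𝔥 _).2 (mem_ambient.2 ⟨u, rfl⟩))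
    exact ⟨h, hinj _ _ ((ht h).trans hh)⟩
  have hroot : ∀ α : Module.Dual k 𝔥, ∀ x ∈ rootSpace σ 𝔥 α,
      φ x ∈ rootSpace σ' 𝔥' (T.dualMap α) := by
    intro α x hx h
    rw [← ht, ← LieEquiv.map_lie, hx, map_smul]
    rfl
  have hTinj : Function.Injective T.dualMap := LinearMap.dualMap_injective_of_surjective hT
  let G : rootLattice σ 𝔥 →+ Module.Dual k 𝔥' :=
    T.dualMap.toAddMonoidHom.comp (rootLattice σ 𝔥).subtype
  have hG : ∀ α, G α ∈ rootLattice σ' 𝔥' := by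
    refine mem_of_closure_hom G _ fun α hα => AddSubgroup.subset_closure ⟨fun h => ?_, ?_⟩
    · exact hα.1 (hTinj (h.trans (map_zero _).symm))
    · obtain ⟨x, hx, hx0⟩ := (Submodule.ne_bot_iff _).1 hα.2
      exact (Submodule.ne_bot_iff _).2 ⟨φ x, hroot α x hx,
        fun h => hx0 (φ.injective (h.trans (map_zero φ).symm))⟩
  refine ⟨G.codRestrict _ hG, fun α β h => Subtype.ext (hTinj ?_), fun α x hx => hroot α x hx⟩
  exact congrArg Subtype.val h

end Transport

theorem injective_degree {Q Q' : Type*} [AddCommGroup Q] [AddCommGroup Q'] {n : ℕ}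
    {m m' : Fin n → ℕ+} {s : Q →+ (Fin n → ℚ)} {P : Matrix.GeneralLinearGroup (Fin n) ℤ}
    {M : AddSubgroup (Q × (Fin n → ℤ))} {g : Q →+ Q'} (hg : Function.Injective g)
    {F : M →+ (Fin n → ℤ)} (hF : ∀ a j, (F a j : ℚ) = (m' j : ℕ) * twistWeight m s P a j) :
    Function.Injective fun a : M => (g a.1.1, F a) := by
  intro a b h
  obtain ⟨h1, h2⟩ := Prod.ext_iff.1 h
  refine Subtype.ext (eq_of_twistWeight_eq m s P (hg h1) (funext fun j => ?_))
  have h3 : (F a j : ℚ) = F b j := congrArg (Int.cast (R := ℚ)) (congrFun h2 j)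
  rw [hF, hF] at h3
  exact mul_left_cancel₀ (by exact_mod_cast (m' j).ne_zero) h3

/-! ### Lie homomorphisms into loop algebras -/

section LoopHom

variable {k : Type*} [Field k] {Λ : Type*} [AddCommGroup Λ] {L L' : Type*} [LieRing L]
  [LieAlgebra k L] [LieRing L'] [LieAlgebra k L'] {n : ℕ}

theorem LieGrading.exists_loopHom (B : LieGrading k Λ L) (F : B.suppGroup →+ (Fin n → ℤ))
    (T : L →ₗ⁅k⁆ L') : ∃ Φ : L →ₗ⁅k⁆ LieAlgebra.loopAlgebra k (Fin n → ℤ) L',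
      ∀ a : B.suppGroup, ∀ x ∈ B.comp a, Φ x = loopMk (F a) (T x) := by
  classical
  -- Extension of `F` by zero outside the support group. Additivity is needed only at degrees of
  -- nonzero elements, which lie in that group.
  obtain ⟨F₁, hF₁⟩ : ∃ F₁ : Λ → (Fin n → ℤ), ∀ a : B.suppGroup, F₁ a = F a :=
    ⟨fun a => if h : a ∈ B.suppGroup then F ⟨a, h⟩ else 0, fun a => dif_pos a.2⟩
  obtain ⟨Φ, hΦ⟩ := B.exists_lieHom (fun a => (loopMk (k := k) (F₁ a)).comp T.toLinearMap) (by
    intro a b x hx y hy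
    change loopMk (k := k) (F₁ (a + b)) (T ⁅x, y⁆) =
      ⁅loopMk (k := k) (F₁ a) (T x), loopMk (k := k) (F₁ b) (T y)⁆
    rw [LieHom.map_lie, loopMk_lie]
    by_cases hx0 : x = 0
    · simp [hx0]
    by_cases hy0 : y = 0
    · simp [hy0]
    have h1 : F₁ (a + b) = F₁ a + F₁ b :=
      (hF₁ (⟨a, B.mem_suppGroup hx hx0⟩ + ⟨b, B.mem_suppGroup hy hy0⟩)).trans
        ((map_add F _ _).trans (congrArg₂ _ (hF₁ ⟨a, _⟩).symm (hF₁ ⟨b, _⟩).symm))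
    rw [h1])
  refine ⟨Φ, fun a x hx => (hΦ a x hx).trans ?_⟩
  rw [hF₁]
  rfl

theorem LieGrading.exists_codRestrict (B : LieGrading k Λ L) (Φ : L →ₗ⁅k⁆ L')
    (S : LieSubalgebra k L') (h : ∀ a, ∀ x ∈ B.comp a, Φ x ∈ S) :
    ∃ Φ' : L →ₗ⁅k⁆ S, ∀ x, (Φ' x : L') = Φ x := by
  have hmem : ∀ z, Φ z ∈ S := by
    intro z
    refine iSup_top_induction B.iSup_eq_top (p := fun z => Φ z ∈ S) z h ?_ ?_
    · rw [map_zero]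
      exact zero_mem _
    · intro x y hx hy
      rw [map_add]
      exact add_mem hx hy
  exact ⟨{ toFun := fun z => ⟨Φ z, hmem z⟩
           map_add' := fun a b => Subtype.ext (map_add Φ a b)
           map_smul' := fun c a => Subtype.ext (map_smul Φ c a)
           map_lie' := fun {a b} => Subtype.ext (LieHom.map_lie Φ a b) }, fun _ => rfl⟩

end LoopHom

/-! ### The isomorphism of multiloop algebras built from (b) -/

section Transport

variable {k : Type*} [Field k] [IsAlgClosed k] [CharZero k] {ζ : CompatibleRoots k}
  {𝔤 : Type*} [LieRing 𝔤] [LieAlgebra k 𝔤] [FiniteDimensional k 𝔤] [LieAlgebra.IsSimple k 𝔤]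
  {𝔤' : Type*} [LieRing 𝔤'] [LieAlgebra k 𝔤'] [FiniteDimensional k 𝔤'] [LieAlgebra.IsSimple k 𝔤']
  {n : ℕ} {m : Fin n → ℕ+} {σ : Fin n → (𝔤 ≃ₗ⁅k⁆ 𝔤)}
  {𝔥 : LieSubalgebra k (fixed σ)} {m' : Fin n → ℕ+} {σ' : Fin n → (𝔤' ≃ₗ⁅k⁆ 𝔤')}
  {𝔥' : LieSubalgebra k (fixed σ')}
  {s : rootLattice σ 𝔥 →+ (Fin n → ℚ)} {P : Matrix.GeneralLinearGroup (Fin n) ℤ}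
  {φ : 𝔤 ≃ₗ⁅k⁆ 𝔤'}

set_option maxHeartbeats 1000000 in
omit [IsAlgClosed k] [CharZero k] [FiniteDimensional k 𝔤] [LieAlgebra.IsSimple k 𝔤]
  [FiniteDimensional k 𝔤'] [LieAlgebra.IsSimple k 𝔤'] in
theorem exists_multiloop_lieHom {g : rootLattice σ 𝔥 →+ rootLattice σ' 𝔥'}
    {F : (multiloopGrading ζ m σ 𝔥).suppGroup →+ (Fin n → ℤ)}
    (hφ : ∀ a : (multiloopGrading ζ m σ 𝔥).suppGroup, ∀ x ∈ homComp ζ m σ 𝔥 a,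
      φ x ∈ homComp ζ m' σ' 𝔥' (g a.1.1, F a)) :
    ∃ Φ : multiloop ζ m σ 𝔥 →ₗ⁅k⁆ multiloop ζ m' σ' 𝔥',
      ∀ a : (multiloopGrading ζ m σ 𝔥).suppGroup, ∀ x, ∀ hx : x ∈ homComp ζ m σ 𝔥 a,
        (Φ ⟨loopMk a.1.2 x, loopMk_mem_of_homComp hx⟩).1 = loopMk (F a) (φ x) := by
  obtain ⟨T, hT⟩ : ∃ T : multiloop ζ m σ 𝔥 →ₗ⁅k⁆ 𝔤', ∀ y, T y = φ (loopEval (k := k) y.1) :=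
    ⟨φ.toLieHom.comp ((loopEval (k := k)).comp (multiloop ζ m σ 𝔥).incl), fun _ => rfl⟩
  obtain ⟨Φ, hΦ⟩ := (multiloopGrading ζ m σ 𝔥).exists_loopHom F T
  have hΦ' : ∀ a : (multiloopGrading ζ m σ 𝔥).suppGroup, ∀ x, ∀ hx : x ∈ homComp ζ m σ 𝔥 a,
      Φ ⟨loopMk a.1.2 x, loopMk_mem_of_homComp hx⟩ = loopMk (F a) (φ x) := by
    intro a x hx
    refine (hΦ a _ (mem_multiloopGrading_comp.2 ⟨x, hx, rfl⟩)).trans ?_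
    rw [hT, loopEval_mk]
  obtain ⟨Φ₁, hΦ₁⟩ := (multiloopGrading ζ m σ 𝔥).exists_codRestrict Φ (multiloop ζ m' σ' 𝔥') (by
    intro a z hz
    by_cases hz0 : z = 0
    · rw [hz0, map_zero]
      exact zero_mem _
    obtain ⟨x, hx, hxz⟩ := mem_multiloopGrading_comp.1 hz
    obtain rfl : ⟨_, loopMk_mem_of_homComp hx⟩ = z := Subtype.ext hxz
    rw [hΦ' ⟨a, (multiloopGrading ζ m σ 𝔥).mem_suppGroup hz hz0⟩ x hx]
    exact loopMk_mem_of_homComp (hφ _ x hx))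
  exact ⟨Φ₁, fun a x hx => (hΦ₁ _).trans (hΦ' a x hx)⟩

omit [IsAlgClosed k] [CharZero k] [FiniteDimensional k 𝔤] [LieAlgebra.IsSimple k 𝔤]
  [FiniteDimensional k 𝔤'] [LieAlgebra.IsSimple k 𝔤'] in
theorem map_mem_homComp {g : rootLattice σ 𝔥 →+ rootLattice σ' 𝔥'}
    {F : (multiloopGrading ζ m σ 𝔥).suppGroup →+ (Fin n → ℤ)}
    (hφ : ∀ p, ∀ x ∈ homComp ζ m σ 𝔥 p, ∀ j,
      σ' j (φ x) = ζ.ratPow (twistWeight m s P p j) • φ x)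
    (hgφ : ∀ α : rootLattice σ 𝔥, ∀ x ∈ rootSpace σ 𝔥 α, φ x ∈ rootSpace σ' 𝔥' (g α))
    (hF : ∀ a j, (F a j : ℚ) = (m' j : ℕ) * twistWeight m s P a j)
    (a : (multiloopGrading ζ m σ 𝔥).suppGroup) (x : 𝔤) (hx : x ∈ homComp ζ m σ 𝔥 a) :
    φ x ∈ homComp ζ m' σ' 𝔥' (g a.1.1, F a) := by
  refine ⟨hgφ _ x hx.1, fun j => ?_⟩
  rw [hφ _ x hx, ← ζ.ratPow_div, hF, mul_div_cancel_left₀]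
  exact_mod_cast (m' j).ne_zero

-- This gives surjectivity on each degree `l`. A component in the right `σ'`-eigenspace has `F a ≡
-- l` modulo `m'` only; adding a suitable `(0, mμ)`, found by inverting `P`, does not change the
-- component and makes `F` equal to `l`.
set_option maxHeartbeats 1000000 in
omit [FiniteDimensional k 𝔤'] [LieAlgebra.IsSimple k 𝔤'] in
theorem mem_iSup_map_homComp (hσ : ∀ i j, σ i * σ j = σ j * σ i)
    (hσm : ∀ i, σ i ^ (m i : ℕ) = 1) [𝔥.IsCartanSubalgebra]
    (hφ : ∀ p, ∀ x ∈ homComp ζ m σ 𝔥 p, ∀ j,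
      σ' j (φ x) = ζ.ratPow (twistWeight m s P p j) • φ x)
    {F : (multiloopGrading ζ m σ 𝔥).suppGroup →+ (Fin n → ℤ)}
    (hF : ∀ a j, (F a j : ℚ) = (m' j : ℕ) * twistWeight m s P a j)
    {l : Fin n → ℤ} {x : 𝔤} (hx : φ x ∈ eigenComp ζ m' σ' l) :
    x ∈ ⨆ (a : (multiloopGrading ζ m σ 𝔥).suppGroup) (_ : F a = l), homComp ζ m σ 𝔥 a := by
  have := nontrivial_of_isSimple k 𝔤
  let f : Fin n → (𝔤 ≃ₗ⁅k⁆ 𝔤) := fun j => conj φ.symm (σ' j)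
  have hf : ∀ j u, f j u = φ.symm (σ' j (φ u)) := fun _ _ => rfl
  have h1 : x ∈ jointEigen f (fun j => ζ.root (m' j) ^ l j) := by
    refine mem_jointEigen.2 fun j => ?_
    rw [hf, hx j, map_smul, LieEquiv.symm_apply_apply]
  rw [eq_iSup_fiber (iSupIndep_jointEigen f) (W := homComp ζ m σ 𝔥)
    (fun p j => ζ.ratPow (twistWeight m s P p j)) (fun p u hu => mem_jointEigen.2 fun j => by
      rw [hf, hφ p u hu j, map_smul, LieEquiv.symm_apply_apply])
    (iSup_homComp_eq_top ζ m σ hσ hσm 𝔥)] at h1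
  refine (iSup₂_le fun p hp u hu => ?_ : (⨆ (p) (_ : (fun j => ζ.ratPow (twistWeight m s P p j)) =
    fun j => ζ.root (m' j) ^ l j), homComp ζ m σ 𝔥 p) ≤ _) h1
  by_cases hu0 : u = 0
  · rw [hu0]
    exact zero_mem _
  have hp' : p ∈ (multiloopGrading ζ m σ 𝔥).suppGroup := 
    mem_suppGroup_of_homComp fun h => hu0 (by simpa [h] using hu)
  obtain ⟨a, rfl⟩ : ∃ a : (multiloopGrading ζ m σ 𝔥).suppGroup, a.1 = p := ⟨⟨p, hp'⟩, rfl⟩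
  obtain ⟨ν, hν⟩ := (root_zpow_eq_iff (ζ := ζ) (m := m') (F a) l).1 fun j => by
    rw [← congrFun hp j, ← ζ.ratPow_div, hF, mul_div_cancel_left₀]
    exact_mod_cast (m' j).ne_zero
  obtain ⟨μ, hμ⟩ := exists_sum_mul_eq P ν
  obtain ⟨b, hb⟩ : ∃ b : (multiloopGrading ζ m σ 𝔥).suppGroup, b.1 = a.1 + (0, scale m μ) :=
    ⟨a + ⟨_, scale_mem_suppGroup ζ m σ hσ hσm 𝔥 μ⟩, rfl⟩
  refine Submodule.mem_iSup_of_mem b (Submodule.mem_iSup_of_mem (funext fun j => ?_) ?_)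
  · have h2 : (F b j : ℚ) = l j := by
      rw [hF, hb, map_add, Pi.add_apply, twistWeight_scale, hμ, mul_add, ← hF, hν, Pi.add_apply,
        scale_apply]
      push_cast
      ring
    exact_mod_cast h2
  · rw [hb, homComp_add_scale]
    exact hu

set_option maxHeartbeats 1000000 in
omit [FiniteDimensional k 𝔤'] [LieAlgebra.IsSimple k 𝔤'] in
theorem exists_multiloop_equiv (hσ : ∀ i j, σ i * σ j = σ j * σ i)
    (hσm : ∀ i, σ i ^ (m i : ℕ) = 1) [𝔥.IsCartanSubalgebra]
    (hφ : ∀ p, ∀ x ∈ homComp ζ m σ 𝔥 p, ∀ j,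
      σ' j (φ x) = ζ.ratPow (twistWeight m s P p j) • φ x)
    {g : rootLattice σ 𝔥 →+ rootLattice σ' 𝔥'} (hg : Function.Injective g)
    (hgφ : ∀ α : rootLattice σ 𝔥, ∀ x ∈ rootSpace σ 𝔥 α, φ x ∈ rootSpace σ' 𝔥' (g α))
    {F : (multiloopGrading ζ m σ 𝔥).suppGroup →+ (Fin n → ℤ)}
    (hF : ∀ a j, (F a j : ℚ) = (m' j : ℕ) * twistWeight m s P a j) :
    ∃ Φ : multiloop ζ m σ 𝔥 ≃ₗ⁅k⁆ multiloop ζ m' σ' 𝔥',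
      ∀ a : (multiloopGrading ζ m σ 𝔥).suppGroup, ∀ x ∈ (multiloopGrading ζ m σ 𝔥).comp a,
        Φ x ∈ (multiloopGrading ζ m' σ' 𝔥').comp (g a.1.1, F a) := by
  classical
  obtain ⟨Φ, hΦ⟩ := exists_multiloop_lieHom (map_mem_homComp hφ hgφ hF)
  have hΦmem : ∀ a : (multiloopGrading ζ m σ 𝔥).suppGroup,
      ∀ x ∈ (multiloopGrading ζ m σ 𝔥).comp a,
        Φ x ∈ (multiloopGrading ζ m' σ' 𝔥').comp (g a.1.1, F a) := by
    intro a x hx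
    obtain ⟨u, hu, hux⟩ := mem_multiloopGrading_comp.1 hx
    obtain rfl : ⟨_, loopMk_mem_of_homComp hu⟩ = x := Subtype.ext hux
    exact mem_multiloopGrading_comp.2 ⟨φ u, map_mem_homComp hφ hgφ hF a u hu, (hΦ a u hu).symm⟩
  have hinj : Function.Injective Φ := by
    obtain ⟨d, hd⟩ : ∃ d : rootLattice σ 𝔥 × (Fin n → ℤ) → rootLattice σ' 𝔥' × (Fin n → ℤ),
        ∀ a : (multiloopGrading ζ m σ 𝔥).suppGroup, d a = (g a.1.1, F a) :=
      ⟨fun a => if h : a ∈ (multiloopGrading ζ m σ 𝔥).suppGroup then (g a.1, F ⟨a, h⟩) else 0,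
        fun a => dif_pos a.2⟩
    refine injective_of_iSupIndep_map (multiloopGrading ζ m σ 𝔥).iSup_eq_top
      (multiloopGrading ζ m' σ' 𝔥').indep Φ.toLinearMap d ?_ ?_ ?_
    · intro a ha b hb hab
      have h1 := injective_degree hg hF (a₁ := ⟨a, AddSubgroup.subset_closure ha⟩)
        (a₂ := ⟨b, AddSubgroup.subset_closure hb⟩) ((hd ⟨a, AddSubgroup.subset_closure ha⟩).symm.trans
          (hab.trans (hd ⟨b, AddSubgroup.subset_closure hb⟩)))
      exact congrArg Subtype.val h1
    · intro a x hx
      by_cases hx0 : x = 0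
      · rw [hx0, map_zero]
        exact zero_mem _
      · have h1 := hΦmem ⟨a, (multiloopGrading ζ m σ 𝔥).mem_suppGroup hx hx0⟩ x hx
        rw [← hd] at h1
        exact h1
    · intro a x hx h
      by_contra hx0
      have ha := (multiloopGrading ζ m σ 𝔥).mem_suppGroup hx hx0
      obtain ⟨u, hu, hux⟩ := mem_multiloopGrading_comp.1 hx
      obtain rfl : ⟨_, loopMk_mem_of_homComp hu⟩ = x := Subtype.ext hux
      have h1 : loopMk (F ⟨a, ha⟩) (φ u) = 0 :=
        (hΦ ⟨a, ha⟩ u hu).symm.trans (congrArg Subtype.val h)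
      have h2 := congrArg (loopEval (k := k)) h1
      rw [loopEval_mk, map_zero] at h2
      have h3 : u = 0 := φ.injective (h2.trans (map_zero φ).symm)
      refine hx0 (Subtype.ext ?_)
      change loopMk _ u = 0
      rw [h3, map_zero]
  have hsurj : Function.Surjective Φ := by
    have h1 : Φ.toLinearMap.range = ⊤ := by
      rw [eq_top_iff, ← (multiloopGrading ζ m' σ' 𝔥').iSup_eq_top]
      refine iSup_le fun b y hy => ?_
      obtain ⟨v, hv, hvy⟩ := mem_multiloopGrading_comp.1 hy
      obtain ⟨x, rfl⟩ := φ.surjective v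
      have h2 := mem_iSup_map_homComp hσ hσm hφ hF hv.2
      have h3 : ∃ z : multiloop ζ m σ 𝔥, (Φ z).1 = loopMk b.2 (φ x) := by
        rw [iSup_subtype'] at h2
        refine Submodule.iSup_induction _ (motive := fun x => ∃ z : multiloop ζ m σ 𝔥,
          (Φ z).1 = loopMk b.2 (φ x)) h2 ?_ ?_ ?_
        · intro a u hu
          exact ⟨⟨loopMk a.1.1.2 u, loopMk_mem_of_homComp hu⟩, by rw [hΦ a.1 u hu, a.2]⟩
        · exact ⟨0, by rw [map_zero, map_zero, map_zero]; rfl⟩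
        · rintro u v ⟨z, hz⟩ ⟨w, hw⟩
          exact ⟨z + w, by rw [map_add, map_add, map_add, ← hz, ← hw]; rfl⟩
      obtain ⟨z, hz⟩ := h3
      exact ⟨z, Subtype.ext (hz.trans hvy)⟩
    exact LinearMap.range_eq_top.1 h1
  exact ⟨LieEquiv.ofBijective Φ ⟨hinj, hsurj⟩, hΦmem⟩

end Transport

/-! ### Realizing a map of degrees by three regradings -/

namespace LieGrading

variable {k : Type*} [CommRing k] {Q : Type*} [AddCommGroup Q] {n : ℕ}
  {L : Type*} [LieRing L] [LieAlgebra k L]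

/-- `R` may take non-integral values on `ℤ^n`, but the `ℤ^n`-support of `B` consists of values of
`G`, where `R ∘ G = F` is integral; hence `R` restricts to an admissible `ρ`. -/
theorem exists_regrade_intertwining {B₀ B : LieGrading k (Q × (Fin n → ℤ)) L}
    {G F : B₀.suppGroup →+ (Fin n → ℤ)}
    (hG : ∀ a : B₀.suppGroup, B₀.comp a ≤ B.comp (a.1.1, G a))
    (R : (Fin n → ℤ) →+ (Fin n → ℚ)) (hR : Function.Injective R)
    (hRF : ∀ a j, R (G a) j = F a j) :
    ∃ B' : LieGrading k (Q × (Fin n → ℤ)) L, B.IsRegrading B' ∧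
      ∀ a : B₀.suppGroup, B₀.comp a ≤ B'.comp (a.1.1, F a) := by
  have hint : ∀ y : B.second.suppGroup, ∀ i, ∃ z : ℤ, (R.comp B.second.suppGroup.subtype) y i = z := by
    refine mem_of_closure_hom (R.comp B.second.suppGroup.subtype) (integralVectors n) ?_
    intro y hy
    obtain ⟨a, rfl⟩ : ∃ a, G a = y := by
      by_contra! h
      refine hy ?_
      rw [second_comp_eq hG, eq_bot_iff]
      exact iSup₂_le fun a ha => (h a ha).elim
    exact fun j => ⟨F a j, hRF a j⟩
  obtain ⟨ρ, hρ⟩ := exists_int_lift _ hint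
  have hρinj : Function.Injective ρ := by
    intro y z h
    refine Subtype.ext (hR (funext fun j => ?_))
    exact (hρ y j).symm.trans ((congrArg (fun v : Fin n → ℤ => (v j : ℚ)) h).trans (hρ z j))
  refine ⟨B.regrade ρ hρinj, Or.inl ⟨ρ, hρinj, rfl⟩, fun a => ?_⟩
  have h1 : ρ (G.codRestrict _ (mem_second_suppGroup_of_le hG) a) = F a := by
    funext j
    have h2 := (hρ (G.codRestrict _ (mem_second_suppGroup_of_le hG) a) j).trans (hRF a j)
    exact_mod_cast h2
  rw [← h1]
  exact comp_le_regrade hG ρ hρinj a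

/-- Multiply degrees by `N`, shift by `t`, then apply `R`. The first move makes room for the
rational shift, which only becomes integral after clearing denominators. -/
theorem exists_regradings (B₀ : LieGrading k (Q × (Fin n → ℤ)) L)
    (F : B₀.suppGroup →+ (Fin n → ℤ)) {N : ℕ} (hN : N ≠ 0) (t : Q →+ (Fin n → ℤ))
    (R : (Fin n → ℤ) →+ (Fin n → ℚ)) (hR : Function.Injective R)
    (hRF : ∀ a : B₀.suppGroup, ∀ j, R (N • a.1.2 - t a.1.1) j = F a j) :
    ∃ B : Fin 4 → LieGrading k (Q × (Fin n → ℤ)) L, B 0 = B₀ ∧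
      (∀ i : Fin 3, (B i.castSucc).IsRegrading (B i.succ)) ∧
      ∀ a : B₀.suppGroup, B₀.comp a ≤ (B (Fin.last 3)).comp (a.1.1, F a) := by
  obtain ⟨S, hS⟩ : ∃ S : B₀.suppGroup →+ (Fin n → ℤ), ∀ a, S a = a.1.2 :=
    ⟨(AddMonoidHom.snd _ _).comp B₀.suppGroup.subtype, fun _ => rfl⟩
  obtain ⟨S₁, hS₁⟩ : ∃ S : B₀.suppGroup →+ (Fin n → ℤ), ∀ a, S a = N • a.1.2 :=
    ⟨(nsmulAddMonoidHom N).comp S, fun a => by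
      change N • S a = _
      rw [hS]⟩
  obtain ⟨S₂, hS₂⟩ : ∃ S : B₀.suppGroup →+ (Fin n → ℤ), ∀ a, S a = N • a.1.2 - t a.1.1 :=
    ⟨S₁ - t.comp ((AddMonoidHom.fst _ _).comp B₀.suppGroup.subtype), fun a => by
      rw [AddMonoidHom.sub_apply, hS₁]
      rfl⟩
  obtain ⟨C, hC⟩ : ∃ C : (Fin n → ℤ) →+ (Fin n → ℚ), ∀ y j, C y j = y j :=
    ⟨{ toFun := fun y j => y j
       map_zero' := by ext; simp
       map_add' := fun a b => by ext; simp }, fun _ _ => rfl⟩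
  have hCN : Function.Injective (C.comp (nsmulAddMonoidHom N)) := by
    intro y z h
    funext j
    have h1 : C (N • y) j = C (N • z) j := congrFun h j
    rw [hC, hC] at h1
    have h2 : (N • y) j = (N • z) j := by exact_mod_cast h1
    rw [Pi.smul_apply, Pi.smul_apply] at h2
    exact nsmul_right_injective hN h2
  obtain ⟨B₁, h₁, hB₁⟩ := exists_regrade_intertwining (B₀ := B₀) (B := B₀) (G := S) (F := S₁)
    (fun a => by rw [hS]) _ hCN (fun a j => by
      rw [hS₁]
      change C (N • S a) j = _
      rw [hC, hS])
  have hB₂ := fun a => comp_le_shift hB₁ t a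
  obtain ⟨B₃, h₃, hB₃⟩ := exists_regrade_intertwining (B₀ := B₀) (B := B₁.shift t) (G := S₂)
    (F := F) (fun a => by
      rw [hS₂, ← hS₁]
      exact hB₂ a) R hR (fun a j => by rw [hS₂, hRF])
  refine ⟨![B₀, B₁, B₁.shift t, B₃], rfl, fun i => ?_, hB₃⟩
  fin_cases i
  · exact h₁
  · exact Or.inr ⟨t, rfl⟩
  · exact h₃

end LieGrading

/-! ### Clearing denominators -/

section TwistWeight

variable {Q : Type*} [AddCommGroup Q] {n : ℕ} {m : Fin n → ℕ+} {s : Q →+ (Fin n → ℚ)}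
  {P : Matrix.GeneralLinearGroup (Fin n) ℤ}

/-- Solve for `s`: it is `l / m` minus the weight transformed by `P⁻¹`. The factor `m_i` clears the
first term and `∏ m'_j` the second. -/
theorem exists_int_of_twistWeight {m' : Fin n → ℕ+} {p : Q × (Fin n → ℤ)} {f : Fin n → ℤ}
    (hf : ∀ j, (f j : ℚ) = (m' j : ℕ) * twistWeight m s P p j) (i : Fin n) :
    ∃ z : ℤ, ((∏ j, (m' j : ℕ) : ℕ) : ℚ) * (m i : ℕ) * s p.1 i = z := by
  obtain ⟨N, hN⟩ : ∃ N, N = ∏ j, (m' j : ℕ) := ⟨_, rfl⟩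
  rw [← hN]
  have hdvd : ∀ j, ∃ d : ℕ, N = m' j * d := by
    rw [hN]
    exact fun j => Finset.dvd_prod_of_mem (fun j => (m' j : ℕ)) (Finset.mem_univ j)
  choose d hd using hdvd
  have h2 : ∀ j, (N : ℚ) * twistWeight m s P p j = ((d j * f j : ℤ) : ℚ) := by
    intro j
    have h3 : (N : ℚ) = (m' j : ℕ) * d j := by exact_mod_cast hd j
    rw [Int.cast_mul, Int.cast_natCast, hf, h3]
    ring
  have hm : ((m i : ℕ) : ℚ) ≠ 0 := by exact_mod_cast (m i).ne_zero
  have h4 : s p.1 i = (p.2 i : ℚ) / (m i : ℕ) -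
      ∑ j, ((P⁻¹).1 j i : ℚ) * twistWeight m s P p j := by
    rw [sum_twistWeight m s P p i]
    ring
  have h5 : (N : ℚ) * ∑ j, ((P⁻¹).1 j i : ℚ) * twistWeight m s P p j =
      ((∑ j, (P⁻¹).1 j i * (d j * f j) : ℤ) : ℚ) := by
    rw [Finset.mul_sum, Int.cast_sum]
    refine Finset.sum_congr rfl fun j _ => ?_
    rw [mul_left_comm, h2, ← Int.cast_mul]
  refine ⟨N * p.2 i - m i * ∑ j, (P⁻¹).1 j i * (d j * f j), ?_⟩
  rw [h4, Int.cast_sub, Int.cast_mul, Int.cast_mul _ (∑ j, _), ← h5]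
  push_cast
  field_simp

theorem exists_int_lift_mul (c : Fin n → ℚ) (s : Q →+ (Fin n → ℚ))
    (h : ∀ α i, ∃ z : ℤ, c i * s α i = z) :
    ∃ t : Q →+ (Fin n → ℤ), ∀ α i, (t α i : ℚ) = c i * s α i :=
  exists_int_lift
    { toFun := fun α i => c i * s α i
      map_zero' := by ext i; simp
      map_add' := fun a b => by
        ext i
        rw [map_add, Pi.add_apply, Pi.add_apply, mul_add] } h

theorem twistWeight_shift {N : ℕ} {t : Q →+ (Fin n → ℤ)}
    (ht : ∀ α i, (t α i : ℚ) = (N : ℚ) * (m i : ℕ) * s α i) (p : Q × (Fin n → ℤ)) (j : Fin n) :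
    twistWeight m s P (0, N • p.2 - t p.1) j = N * twistWeight m s P p j := by
  rw [twistWeight_apply, twistWeight_apply, Finset.mul_sum]
  refine Finset.sum_congr rfl fun i _ => ?_
  have hm : ((m i : ℕ) : ℚ) ≠ 0 := by exact_mod_cast (m i).ne_zero
  have h1 : (((N • p.2 - t p.1) i : ℤ) : ℚ) = N * p.2 i - N * (m i : ℕ) * s p.1 i := by
    rw [← ht, Pi.sub_apply, Pi.smul_apply, nsmul_eq_mul]
    push_cast
    rfl
  rw [h1, map_zero, Pi.zero_apply]
  field_simp
  ring

variable (m s P) in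
theorem exists_injective_hom {c : Fin n → ℚ} (hc : ∀ j, c j ≠ 0) :
    ∃ R : (Fin n → ℤ) →+ (Fin n → ℚ), Function.Injective R ∧
      ∀ y j, R y j = c j * twistWeight m s P (0, y) j := by
  obtain ⟨R, hR⟩ : ∃ R : (Fin n → ℤ) →+ (Fin n → ℚ), ∀ y j,
      R y j = c j * twistWeight m s P (0, y) j :=
    ⟨{ toFun := fun y j => c j * twistWeight m s P (0, y) j
       map_zero' := by
        ext j
        rw [← Prod.zero_eq_mk, map_zero, Pi.zero_apply, mul_zero]
       map_add' := fun a b => by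
        ext j
        rw [Pi.add_apply, ← mul_add, ← Pi.add_apply (twistWeight m s P (0, a)), ← map_add,
          Prod.mk_add_mk, add_zero] }, fun _ _ => rfl⟩
  refine ⟨R, fun y z h => ?_, hR⟩
  have h1 : ((0, y) : Q × (Fin n → ℤ)) = (0, z) := by
    refine eq_of_twistWeight_eq m s P rfl (funext fun j => ?_)
    have h2 := congrFun h j
    rw [hR, hR] at h2
    exact mul_left_cancel₀ (hc j) h2
  exact congrArg Prod.snd h1

end TwistWeight

/-! ### Conditions (a) and (c) from a map of degrees -/

namespace LieGrading

variable {k : Type*} [CommRing k] {Q Q' : Type*} [AddCommGroup Q] [AddCommGroup Q'] {n : ℕ}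
  {L L' : Type*} [LieRing L] [LieAlgebra k L] [LieRing L'] [LieAlgebra k L']
  {B₀ : LieGrading k (Q × (Fin n → ℤ)) L} {B' : LieGrading k (Q' × (Fin n → ℤ)) L'}
  {m m' : Fin n → ℕ+} {s : Q →+ (Fin n → ℚ)} {P : Matrix.GeneralLinearGroup (Fin n) ℤ}
  {g : Q →+ Q'} {F : B₀.suppGroup →+ (Fin n → ℤ)} {Φ : L ≃ₗ⁅k⁆ L'}

theorem supportIso_of_twistWeight (hg : Function.Injective g)
    (hF : ∀ a j, (F a j : ℚ) = (m' j : ℕ) * twistWeight m s P a j)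
    (hΦ : ∀ a : B₀.suppGroup, ∀ x ∈ B₀.comp a, Φ x ∈ B'.comp (g a.1.1, F a)) :
    B₀.SupportIso B' := by
  obtain ⟨f, hf⟩ : ∃ f : B₀.suppGroup →+ Q' × (Fin n → ℤ), ∀ a, f a = (g a.1.1, F a) :=
    ⟨(g.comp ((AddMonoidHom.fst _ _).comp B₀.suppGroup.subtype)).prod F, fun _ => rfl⟩
  refine supportIso_of_injective _ _ Φ f ?_ fun a x hx => ?_
  · rw [funext hf]
    exact injective_degree hg hF
  · rw [hf]
    exact hΦ a x hx

theorem exists_regradings_of_twistWeight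
    (hF : ∀ a j, (F a j : ℚ) = (m' j : ℕ) * twistWeight m s P a j)
    (hB₀ : ∀ α, ∃ l, (α, l) ∈ B₀.suppGroup)
    (hΦ : ∀ a : B₀.suppGroup, ∀ x ∈ B₀.comp a, Φ x ∈ B'.comp (g a.1.1, F a)) :
    ∃ B : Fin 4 → LieGrading k (Q × (Fin n → ℤ)) L, B 0 = B₀ ∧
      (B (Fin.last 3)).second.IsogradedIso B'.second ∧
      ∀ i : Fin 3, (B i.castSucc).IsRegrading (B i.succ) := by
  obtain ⟨t, ht⟩ := exists_int_lift_mul (fun i => ((∏ j, (m' j : ℕ) : ℕ) : ℚ) * (m i : ℕ)) s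
    fun α i => by
      obtain ⟨l, hl⟩ := hB₀ α
      exact exists_int_of_twistWeight (hF ⟨_, hl⟩) i
  obtain ⟨N, hN⟩ : ∃ N, N = ∏ j, (m' j : ℕ) := ⟨_, rfl⟩
  rw [← hN] at ht
  have hN0 : N ≠ 0 := hN ▸ Finset.prod_ne_zero_iff.2 fun j _ => (m' j).ne_zero
  have hNq : (N : ℚ) ≠ 0 := by exact_mod_cast hN0
  have hm' : ∀ j, ((m' j : ℕ) : ℚ) ≠ 0 := fun j => by exact_mod_cast (m' j).ne_zero
  -- With `t = N m s`, the weight of `(0, N l - t α)` is `N w(α, l)`; the factor `m'_j / N` turns it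
  -- into `m'_j w_j = F_j`.
  obtain ⟨R, hRinj, hR⟩ := exists_injective_hom m s P (c := fun j => (m' j : ℕ) / (N : ℚ))
    fun j => div_ne_zero (hm' j) hNq
  have hRF : ∀ a : B₀.suppGroup, ∀ j, R (N • a.1.2 - t a.1.1) j = F a j := by
    intro a j
    rw [hR, hF, twistWeight_shift ht]
    field_simp
  obtain ⟨B, hB0, hB, hBF⟩ := B₀.exists_regradings F hN0 t R hRinj hRF
  have h1 : ∀ a : B₀.suppGroup, ∀ x ∈ B₀.comp a, Φ x ∈ B'.second.comp (F a) :=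
    fun a x hx => comp_le_second B' (g a.1.1, F a) (hΦ a x hx)
  exact ⟨B, hB0, isogradedIso_second (F := F) hBF Φ h1, hB⟩

end LieGrading

/-! ### Assembling the implications -/

section Transport

variable {k : Type*} [Field k] [IsAlgClosed k] [CharZero k] {ζ : CompatibleRoots k}
  {𝔤 : Type*} [LieRing 𝔤] [LieAlgebra k 𝔤] [FiniteDimensional k 𝔤] [LieAlgebra.IsSimple k 𝔤]
  {𝔤' : Type*} [LieRing 𝔤'] [LieAlgebra k 𝔤'] [FiniteDimensional k 𝔤'] [LieAlgebra.IsSimple k 𝔤']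
  {n : ℕ} {m : Fin n → ℕ+} {σ : Fin n → (𝔤 ≃ₗ⁅k⁆ 𝔤)}
  {𝔥 : LieSubalgebra k (fixed σ)} {m' : Fin n → ℕ+} {σ' : Fin n → (𝔤' ≃ₗ⁅k⁆ 𝔤')}
  {𝔥' : LieSubalgebra k (fixed σ')}
  {s : rootLattice σ 𝔥 →+ (Fin n → ℚ)} {P : Matrix.GeneralLinearGroup (Fin n) ℤ}

set_option maxHeartbeats 1000000 in
/-- The data that turn an isomorphism of twisted tuples into an isomorphism of multiloop algebras
which is compatible with the gradings. -/
theorem exists_multiloop_equiv_of_tuplePow (hσ : ∀ i j, σ i * σ j = σ j * σ i)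
    (hσm : ∀ i, σ i ^ (m i : ℕ) = 1) [𝔥.IsCartanSubalgebra]
    (hσ' : ∀ i j, σ' i * σ' j = σ' j * σ' i) (hσm' : ∀ i, σ' i ^ (m' i : ℕ) = 1)
    [𝔥'.IsCartanSubalgebra] {φ : 𝔤 ≃ₗ⁅k⁆ 𝔤'} {τ : Fin n → (𝔤 ≃ₗ⁅k⁆ 𝔤)}
    (hτ : ∀ (i : Fin n) (α : rootLattice σ 𝔥), ∀ x ∈ rootSpace σ 𝔥 α,
      τ i x = ζ.ratPow (-(s α i)) • x)
    (hφ : ∀ j, σ' j = conj φ (tuplePow (fun i => τ i * σ i) P j)) :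
    ∃ (g : rootLattice σ 𝔥 →+ rootLattice σ' 𝔥')
      (F : (multiloopGrading ζ m σ 𝔥).suppGroup →+ (Fin n → ℤ))
      (Φ : multiloop ζ m σ 𝔥 ≃ₗ⁅k⁆ multiloop ζ m' σ' 𝔥'),
      Function.Injective g ∧ (∀ a j, (F a j : ℚ) = (m' j : ℕ) * twistWeight m s P a j) ∧
      ∀ a : (multiloopGrading ζ m σ 𝔥).suppGroup, ∀ x ∈ (multiloopGrading ζ m σ 𝔥).comp a,
        Φ x ∈ (multiloopGrading ζ m' σ' 𝔥').comp (g a.1.1, F a) := by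
  have h1 : ∀ p, ∀ x ∈ homComp ζ m σ 𝔥 p, ∀ j,
      σ' j (φ x) = ζ.ratPow (twistWeight m s P p j) • φ x := by
    intro p x hx j
    rw [hφ]
    change φ (tuplePow (fun i => τ i * σ i) P j (φ.symm (φ x))) = _
    rw [LieEquiv.symm_apply_apply,
      tuplePow_apply ζ _ P (fun i => mul_apply_of_mem_homComp ζ hτ hx i) j, map_smul]
    rfl
  obtain ⟨ψ, hψ, h2⟩ := exists_equiv_map_cartan (𝔥' := 𝔥') hσ hσm hσ' hσm' h1
  obtain ⟨g, hg, hgψ⟩ := exists_rootLattice_hom hψ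
  obtain ⟨F, hF⟩ := exists_degreeHom hσm' h2
  obtain ⟨Φ, hΦ⟩ := exists_multiloop_equiv hσ hσm h2 hg hgψ hF
  exact ⟨g, F, Φ, hg, hF, hΦ⟩

end Transport

end MultiloopLie

theorem theorem4p2p5 {k : Type*} [Field k] [IsAlgClosed k] [CharZero k]
    (ζ : CompatibleRoots k)
    {𝔤 : Type*} [LieRing 𝔤] [LieAlgebra k 𝔤] [FiniteDimensional k 𝔤] [LieAlgebra.IsSimple k 𝔤]
    {𝔤' : Type*} [LieRing 𝔤'] [LieAlgebra k 𝔤'] [FiniteDimensional k 𝔤']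
    [LieAlgebra.IsSimple k 𝔤']
    (n : ℕ) (hn : 0 < n)
    (m : Fin n → ℕ+) (σ : Fin n → (𝔤 ≃ₗ⁅k⁆ 𝔤))
    (hσ : ∀ i j, σ i * σ j = σ j * σ i) (hσm : ∀ i, σ i ^ (m i : ℕ) = 1)
    (𝔥 : LieSubalgebra k (fixed σ)) (h𝔥 : 𝔥.IsCartanSubalgebra)
    (m' : Fin n → ℕ+) (σ' : Fin n → (𝔤' ≃ₗ⁅k⁆ 𝔤'))
    (hσ' : ∀ i j, σ' i * σ' j = σ' j * σ' i) (hσm' : ∀ i, σ' i ^ (m' i : ℕ) = 1)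
    (𝔥' : LieSubalgebra k (fixed σ')) (h𝔥' : 𝔥'.IsCartanSubalgebra) :
    List.TFAE [
      (multiloopGrading ζ m σ 𝔥).SupportIso (multiloopGrading ζ m' σ' 𝔥'),
      ∃ (s : rootLattice σ 𝔥 →+ (Fin n → ℚ)) (P : Matrix.GeneralLinearGroup (Fin n) ℤ)
        (φ : 𝔤 ≃ₗ⁅k⁆ 𝔤') (τ : Fin n → (𝔤 ≃ₗ⁅k⁆ 𝔤)),
        (∀ (i : Fin n) (α : rootLattice σ 𝔥), ∀ x ∈ rootSpace σ 𝔥 α,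
          τ i x = ζ.ratPow (-(s α i)) • x) ∧
        ∀ j, σ' j = conj φ (tuplePow (fun i => τ i * σ i) P j),
      ∃ (p : ℕ) (B : Fin (p + 1) →
          LieGrading k (rootLattice σ 𝔥 × (Fin n → ℤ)) (multiloop ζ m σ 𝔥)),
        B 0 = multiloopGrading ζ m σ 𝔥 ∧
        (B (Fin.last p)).second.IsogradedIso (multiloopGrading ζ m' σ' 𝔥').second ∧
        ∀ i : Fin p, (B i.castSucc).IsRegrading (B i.succ)] := by
  have := nontrivial_of_isSimple k 𝔤
  tfae_have 1 → 2 := exists_tuplePow_of_supportIso ζ hσ hσm hσ' hσm'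
  tfae_have 2 → 1 := by
    rintro ⟨s, P, φ, τ, hτ, hφ⟩
    obtain ⟨g, F, Φ, hg, hF, hΦ⟩ := exists_multiloop_equiv_of_tuplePow (𝔥 := 𝔥) (𝔥' := 𝔥')
      hσ hσm hσ' hσm' hτ hφ
    exact LieGrading.supportIso_of_twistWeight hg hF hΦ
  tfae_have 2 → 3 := by
    rintro ⟨s, P, φ, τ, hτ, hφ⟩
    obtain ⟨g, F, Φ, hg, hF, hΦ⟩ := exists_multiloop_equiv_of_tuplePow (𝔥 := 𝔥) (𝔥' := 𝔥')
      hσ hσm hσ' hσm' hτ hφ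
    exact ⟨3, LieGrading.exists_regradings_of_twistWeight hF
      (exists_mem_suppGroup ζ m σ hσ hσm 𝔥) hΦ⟩
  tfae_have 3 → 2 := by
    rintro ⟨p, B, h0, hlast, hstep⟩
    exact exists_tuplePow_of_regradings ζ hσ hσm hσ' hσm' B h0 hlast hstep
  tfae_finish
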